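/- **Syntax.** Fix a set $B$ of base types. Types are generated by $\to$ from individuals $\iota$, the elements of $B$, and the types $h$ (positive formulas), $a$ (atoms), $r$ (rigid atoms), $p$ (programs), $g$ (goals), with inclusions $r\subseteq a\subseteq h\subseteq g$ and $r\subseteq p$. *Argument types* are built by $\to$ from $\iota$, $B$, $h$. A *variable type* is an argument type or $\alpha_1\to\dots\to\alpha_n\to a$ with argument types $\alpha_i$; a *constant type* is a variable type or $\alpha_1\to\dots\to\alpha_n\to r$ with argument types $\alpha_i$. For each level $i\in\mathbb N$ and each type there are countably many logic variables of that level (variable types) and countably many non-logical constants (constant types). The logical constants are $\top_g,\top_h$; $\wedge_p,\wedge_g,\wedge_h$; $\vee_g,\vee_h$; $\supset_g\colon p\to g\to g$; $\supset_p\colon g\to r\to p$; and, for each variable type $\alpha$, $\Sigma_g,\Sigma_h,\Pi_g,\Pi_p$. Terms are simply typed $\lambda$-terms, abstracting over variables of variable type, modulo $\beta\eta$-equivalence and modulo the identification of a formula of type $h$ with the corresponding goal. We write $\exists x\,G=\Sigma_g(\lambda x.G)$, $\forall x\,G=\Pi_g(\lambda x.G)$, $\forall x\,D=\Pi_p(\lambda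 x.D)$. A term is *over* $\mathcal U_i$ if all free variables and constants of its normal form have level at most $i$. A *substitution* $\theta$ maps variables to terms of the same type, has finite support, and sends each variable of level $i$ to a term over $\mathcal U_i$. $\theta\varphi$ means first $\theta$, then $\varphi$. A *state* $\langle i;\mathcal P;G\rangle$ consists of a level $i$, a finite sequence $\mathcal P$ of terms of type $p$ and a goal $G$ of type $g$, all over $\mathcal U_i$. A *state vector* $\mathbf A=A_1\otimes\dots\otimes A_n$ is a finite sequence of states; $\square$ is the empty one; $\mathbf A\theta$ is componentwise application. The *elaboration* of $D$ is: $\{A\}$ for a rigid atom $A$; $\{G\supset A\}$ for $G\supset A$; the union of those of $D$ and $D'$ for $D\wedge D'$; and $\{\forall x\,K\mid K\text{ in the elaboration of }D\}$ for $\forall x\,D$. **Resolution.** One step replaces one state of a vector as follows, and applies its substitution $\theta$ to all other states. *Null*: $\langle i;\mathcal P;\top_g\rangle$ is deleted, $\theta=\mathrm{id}$. *True*: if $G$ is an atomic goal (its head is a variable or a non-logical constant), $\theta\neq\mathrm{id}$ and $G\theta=\top_g$, then $\langle i;\mathcal P;G\rangle$ becomes $\langle i;\mathcal P\theta;\top_g\rangle$.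 *Backchain*: $\langle i;\mathcal P;A'\rangle$, with $A'$ a rigid atom, becomes $\langle i;\mathcal P\theta;G\theta\rangle$ if $\forall\bar x(G\supset A)$ is in the elaboration of a member of $\mathcal P$, with $\bar x$ renamed to distinct fresh variables of level $\le i$, and $A'\theta=A\theta$. *Axiom*: the same with a fact $\forall\bar x\,A$; the state is deleted. *Or*: $G_1\vee G_2$ becomes $G_1$, or becomes $G_2$. *And*: $\langle i;\mathcal P;G_1\wedge G_2\rangle$ becomes $\langle i;\mathcal P;G_1\rangle\otimes\langle i;\mathcal P;G_2\rangle$. *Instance*: $\exists x\,G$ becomes $G[t/x]$, for any $t$ over $\mathcal U_i$. *Augment*: $\langle i;\mathcal P;D\supset G\rangle$ becomes $\langle i;\mathcal P,D;G\rangle$. *Generic*: $\langle i;\mathcal P;\forall x\,G\rangle$ becomes $\langle i+1;\mathcal P;G[c/x]\rangle$, with $c$ a fresh constant of level $i+1$. (In the last five rules $\theta=\mathrm{id}$.) Fresh means: not having occurred so far in the derivation, its substitutions and renamings included. *Enriched* ($*$-) resolution has in addition *Sub*: $\langle i;\mathcal P;G\rangle$ becomes $\langle i;\mathcal P\theta;G\theta\rangle$,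 for an arbitrary substitution $\theta$. $\mathbf A$ *resolves to* $\mathbf A'$ *with answer* $\theta$ if there is a finite sequence of steps from $\mathbf A$ to $\mathbf A'$ and $\theta$ is the composition of their substitutions, restricted to the free variables of $\mathbf A$. **Uniform algebras.** A *uniform applicative structure* $M$ has carriers $D_{i,\tau}$ for all levels $i$ and types $\tau$; extensional application $D_{i,\alpha\to\beta}\times D_{i,\alpha}\to D_{i,\beta}$; a functorial system of injective inclusions $D_{i,\tau}\to D_{j,\tau}$ ($i\le j$) commuting with application; injective maps $D_{i,\sigma}\to D_{i,\tau}$ for the basic inclusions $\sigma\subseteq\tau$ ($r\subseteq a$, $a\subseteq h$, $h\subseteq g$, $r\subseteq p$); an element of $D_{i,\tau}$ for each constant of level $i$ and type $\tau$, and of $D_{0,\tau}$ for each logical constant (considered at every level through the inclusions); and on each $D_{i,p}$ a preorder $\preceq$ and an element $\top_p$ with $\top_p\wedge_p d=d=d\wedge_p\top_p$, $d\preceq d\wedge_p d'$, $d\wedge_p d'\preceq d'\wedge_p d$, and $f d\preceq\Pi_p f$. Let $\Omega$ be a distributive lattice with top $\top$. An *$\Omega$-valuation* is a family $I_i\colon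 D_{i,p}\times D_{i,g}\to\Omega$ such that $I_i(x,x)=\top$ for $x\in D_{i,r}$; $I_i(d,e)\le I_{i+1}(d,e)$; $I_i(d,\top_g)=\top$; $I_i(d,e\wedge e')=I_i(d,e)\wedge I_i(d,e')$; $I_i(d,e\vee e')=I_i(d,e)\vee I_i(d,e')$; $I_i(d,d'\supset e)=I_i(d\wedge_p d',e)$; $I_i(d,\Sigma_g f)=\bigvee_{x\in D_{i,\alpha}}I_i(d,fx)$ and $I_i(d,\Pi_g f)=\bigwedge_{x\in D_{i,\alpha}}I_i(d,fx)$ (these bounds exist); $d\preceq d'$ implies $I_i(d,e)\le I_i(d',e)$; and $(e\supset_p x)\preceq d$ implies $I_i(d,e)\le I_i(d,x)$ for $x\in D_{i,r}$. An assignment $\varphi$ sends each variable of level $i$ and type $\tau$ into $D_{i,\tau}$. A *uniform algebra* over $\Omega$ is such an $M$ with a valuation and an interpretation assigning, to each term $t$ of type $\tau$ over $\mathcal U_i$ and each $\varphi$, an element $t_\varphi\in D_{i,\tau}$, compatibly with the inclusions, which interprets variables, constants, inclusions and application as given and satisfies $(\lambda x.t)_\varphi\,d=(t[y/x])_{\varphi[d/y]}$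 for $d\in D_{i,\alpha}$ and fresh $y$ of level $i$. The *truth value* $[\![\mathbf A]\!]_\varphi\in\Omega$ of a state vector is the meet over its states $\langle i;\mathcal P;G\rangle$ of $I_i((\bigwedge\mathcal P)_\varphi,G_\varphi)$, where $\bigwedge(D_1,\dots,D_n)=(\cdots(\top_p\wedge_p D_1)\cdots)\wedge_p D_n$. **Corollary ($*$-deduction is conservative).** Let $\mathbf A$ be a state vector. 1. (Soundness.) If $\mathbf A$ $*$-resolves to $\mathbf A'$ with answer $\theta$, then for every distributive lattice $\Omega$ with top: if $[\![\mathbf A']\!]_\varphi=\top$ in all uniform algebras over $\Omega$ for all assignments $\varphi$, then $[\![\mathbf A\theta]\!]_\varphi=\top$ in all uniform algebras over $\Omega$ for all $\varphi$. 2. In particular, if $\mathbf A$ $*$-resolves to $\square$ with answer $\theta$, then $[\![\mathbf A\theta]\!]_\varphi=\top$ in every uniform algebra, for every $\Omega$ and every $\varphi$. 3. If $\mathbf A$ $*$-resolves to $\mathbf A'$ with answer $\theta$ without use of the rule Generic, then $[\![\mathbf A']\!]_\varphi\le[\![\mathbf A\theta]\!]_\varphi$ in every uniform algebra, for every $\Omega$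 and every $\varphi$. 4. (Conservativity.) If $\mathbf A$ $*$-resolves to $\square$ with the identity answer, then $\mathbf A$ resolves to $\square$, without the rule Sub, with the identity answer. 5. (Lifting.) Let $\theta$ be a substitution. If $\mathbf A\theta$ $*$-resolves to $\mathbf A'$ with answer $\varphi$, and either $\mathbf A'=\square$ or the constants introduced by the Generic steps of that resolution occur neither in $\mathbf A$ nor in $\theta$ restricted to the free variables of $\mathbf A$, then $\mathbf A$ $*$-resolves to the same $\mathbf A'$ with answer $\theta\varphi$ restricted to the free variables of $\mathbf A$. -/

import Mathlib

universe u v w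

namespace UCTT

/-! ### Types, constants and variables -/

/-- Types over a set `B` of user-defined base types: individuals `iota`, positive formulas `h`,
atoms `a`, rigid atoms `r`, programs `p`, goals `g`, and function types. -/
inductive Ty (B : Type u) : Type u
  | iota : Ty B
  | base (b : B) : Ty B
  | h : Ty B
  | a : Ty B
  | r : Ty B
  | p : Ty B
  | g : Ty B
  | arr (α β : Ty B) : Ty B

section Types

variable {B : Type u}

/-- Argument types: built by arrows from the non-logical base types and `h`. -/
def Ty.ArgTy : Ty B → Prop
  | .iota => True
  | .base _ => True
  | .h => True
  | .arr α β => α.ArgTy ∧ β.ArgTy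
  | _ => False

/-- Types of variables: argument types, and `α₁ → ⋯ → αₙ → a` with argument types `αᵢ`. -/
def Ty.VarTy : Ty B → Prop
  | .a => True
  | .arr α β => α.ArgTy ∧ β.VarTy
  | .iota => True
  | .base _ => True
  | .h => True
  | _ => False

/-- Types of non-logical constants: those of variables, and `α₁ → ⋯ → αₙ → r`. -/
def Ty.ConTy : Ty B → Prop
  | .r => True
  | .a => True
  | .arr α β => α.ArgTy ∧ β.ConTy
  | .iota => True
  | .base _ => True
  | .h => True
  | _ => False

/-- Logic (free) variables: countably many for each level and each type of variables. -/
structure LVar (τ : Ty B) : Type where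
  level : ℕ
  idx : ℕ
  ok : τ.VarTy

/-- Non-logical constants: countably many for each level and each type of constants. -/
structure Con (τ : Ty B) : Type where
  level : ℕ
  idx : ℕ
  ok : τ.ConTy

/-- Logical constants. -/
inductive LCon : Ty B → Type u
  | topG : LCon .g
  | topH : LCon .h
  | andP : LCon (.arr .p (.arr .p .p))
  | andG : LCon (.arr .g (.arr .g .g))
  | andH : LCon (.arr .h (.arr .h .h))
  | orG : LCon (.arr .g (.arr .g .g))
  | orH : LCon (.arr .h (.arr .h .h))
  | impG : LCon (.arr .p (.arr .g .g))
  | impP : LCon (.arr .g (.arr .r .p))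
  | sigG {α : Ty B} (hα : α.VarTy) : LCon (.arr (.arr α .g) .g)
  | sigH {α : Ty B} (hα : α.VarTy) : LCon (.arr (.arr α .h) .h)
  | piG {α : Ty B} (hα : α.VarTy) : LCon (.arr (.arr α .g) .g)
  | piP {α : Ty B} (hα : α.VarTy) : LCon (.arr (.arr α .p) .p)

/-- The basic inclusions between the subtypes of the type of formulas. -/
inductive Incl : Ty B → Ty B → Type u
  | ra : Incl .r .a
  | ah : Incl .a .h
  | hg : Incl .h .g
  | rp : Incl .r .p

/-- Variables in the context `Γ`: de Bruijn indices for the bound variables listed in `Γ`,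
and the logic variables. -/
inductive Vr : List (Ty B) → Ty B → Type u
  | free {τ : Ty B} (x : LVar τ) : Vr [] τ
  | zero {Γ : List (Ty B)} {α : Ty B} : Vr (α :: Γ) α
  | succ {Γ : List (Ty B)} {α τ : Ty B} (y : Vr Γ τ) : Vr (α :: Γ) τ

/-- Raw typed terms in the context `Γ` of bound variables. -/
inductive Tm : List (Ty B) → Ty B → Type u
  | var {Γ : List (Ty B)} {τ : Ty B} (y : Vr Γ τ) : Tm Γ τ
  | con {Γ : List (Ty B)} {τ : Ty B} (c : Con τ) : Tm Γ τ
  | lcon {Γ : List (Ty B)} {τ : Ty B} (k : LCon τ) : Tm Γ τ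
  | inc {Γ : List (Ty B)} {σ τ : Ty B} (e : Incl σ τ) (t : Tm Γ σ) : Tm Γ τ
  | app {Γ : List (Ty B)} {α β : Ty B} (t : Tm Γ (.arr α β)) (s : Tm Γ α) : Tm Γ β
  | lam {Γ : List (Ty B)} {α β : Ty B} (hα : α.VarTy) (t : Tm (α :: Γ) β) : Tm Γ (.arr α β)

/-- A logic variable together with its type. -/
abbrev AVar (B : Type u) : Type u := Σ τ : Ty B, LVar τ

/-- A non-logical constant together with its type. -/
abbrev ACon (B : Type u) : Type u := Σ τ : Ty B, Con τ

/-! ### Renaming and substitution on raw terms -/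

/-- Lifting of a renaming under a binder. -/
def liftRen {Γ Δ : List (Ty B)} (ρ : ∀ τ, Vr Γ τ → Vr Δ τ) (α : Ty B) :
    ∀ τ, Vr (α :: Γ) τ → Vr (α :: Δ) τ
  | _, .zero => .zero
  | _, .succ y => .succ (ρ _ y)

def Tm.ren : ∀ {Γ Δ : List (Ty B)} {τ : Ty B}, (∀ σ, Vr Γ σ → Vr Δ σ) → Tm Γ τ → Tm Δ τ
  | _, _, _, ρ, .var y => .var (ρ _ y)
  | _, _, _, _, .con c => .con c
  | _, _, _, _, .lcon k => .lcon k
  | _, _, _, ρ, .inc e t => .inc e (t.ren ρ)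
  | _, _, _, ρ, .app t s => .app (t.ren ρ) (s.ren ρ)
  | _, _, _, ρ, .lam hα t => .lam hα (t.ren (liftRen ρ _))

/-- Weakening of a term by one bound variable. -/
def Tm.wk {Γ : List (Ty B)} {τ : Ty B} (α : Ty B) (t : Tm Γ τ) : Tm (α :: Γ) τ :=
  t.ren (fun _ y => .succ y)

/-- Lifting of a substitution under a binder. -/
def liftSub {Γ Δ : List (Ty B)} (s : ∀ τ, Vr Γ τ → Tm Δ τ) (α : Ty B) :
    ∀ τ, Vr (α :: Γ) τ → Tm (α :: Δ) τ
  | _, .zero => .var .zero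
  | _, .succ y => (s _ y).wk α

/-- Simultaneous capture-avoiding substitution. -/
def Tm.bind : ∀ {Γ Δ : List (Ty B)} {τ : Ty B}, (∀ σ, Vr Γ σ → Tm Δ σ) → Tm Γ τ → Tm Δ τ
  | _, _, _, s, .var y => s _ y
  | _, _, _, _, .con c => .con c
  | _, _, _, _, .lcon k => .lcon k
  | _, _, _, s, .inc e t => .inc e (t.bind s)
  | _, _, _, s, .app t t' => .app (t.bind s) (t'.bind s)
  | _, _, _, s, .lam hα t => .lam hα (t.bind (liftSub s _))

/-- The substitution replacing the innermost bound variable by `t`. -/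
def instSub {Γ : List (Ty B)} {α : Ty B} (t : Tm Γ α) : ∀ τ, Vr (α :: Γ) τ → Tm Γ τ
  | _, .zero => t
  | _, .succ y => .var y

theorem liftRen_comp {Γ Δ Θ : List (Ty B)} (ρ : ∀ τ, Vr Γ τ → Vr Δ τ)
    (ρ' : ∀ τ, Vr Δ τ → Vr Θ τ) (α : Ty B) :
    (fun τ y => liftRen ρ' α τ (liftRen ρ α τ y)) = liftRen (fun τ y => ρ' τ (ρ τ y)) α := by
  funext τ y
  cases y <;> rfl

theorem Tm.ren_ren {Γ : List (Ty B)} {τ : Ty B} (t : Tm Γ τ) :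
    ∀ {Δ Θ : List (Ty B)} (ρ : ∀ σ, Vr Γ σ → Vr Δ σ) (ρ' : ∀ σ, Vr Δ σ → Vr Θ σ),
      (t.ren ρ).ren ρ' = t.ren (fun σ y => ρ' σ (ρ σ y)) := by
  induction t with
  | var y => intros; rfl
  | con c => intros; rfl
  | lcon k => intros; rfl
  | inc e t ih => intros; simp only [Tm.ren, ih]
  | app t s iht ihs => intros; simp only [Tm.ren, iht, ihs]
  | lam hα t ih => intros; simp only [Tm.ren, ih, liftRen_comp]

theorem Tm.ren_wk {Γ Δ : List (Ty B)} {τ : Ty B} (t : Tm Γ τ) (ρ : ∀ σ, Vr Γ σ → Vr Δ σ)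
    (α : Ty B) : (t.wk α).ren (liftRen ρ α) = (t.ren ρ).wk α := by
  simp only [Tm.wk, Tm.ren_ren]
  rfl

theorem liftSub_ren {Γ Δ Θ : List (Ty B)} (ρ : ∀ τ, Vr Γ τ → Vr Δ τ)
    (s : ∀ τ, Vr Δ τ → Tm Θ τ) (α : Ty B) :
    (fun τ y => liftSub s α τ (liftRen ρ α τ y)) = liftSub (fun τ y => s τ (ρ τ y)) α := by
  funext τ y
  cases y <;> rfl

theorem Tm.bind_ren {Γ : List (Ty B)} {τ : Ty B} (t : Tm Γ τ) :
    ∀ {Δ Θ : List (Ty B)} (ρ : ∀ σ, Vr Γ σ → Vr Δ σ) (s : ∀ σ, Vr Δ σ → Tm Θ σ),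
      (t.ren ρ).bind s = t.bind (fun σ y => s σ (ρ σ y)) := by
  induction t with
  | var y => intros; rfl
  | con c => intros; rfl
  | lcon k => intros; rfl
  | inc e t ih => intros; simp only [Tm.ren, Tm.bind, ih]
  | app t s iht ihs => intros; simp only [Tm.ren, Tm.bind, iht, ihs]
  | lam hα t ih => intros; simp only [Tm.ren, Tm.bind, ih, liftSub_ren]

theorem ren_liftSub {Γ Δ Θ : List (Ty B)} (s : ∀ τ, Vr Γ τ → Tm Δ τ)
    (ρ : ∀ τ, Vr Δ τ → Vr Θ τ) (α : Ty B) :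
    (fun τ y => (liftSub s α τ y).ren (liftRen ρ α)) = liftSub (fun τ y => (s τ y).ren ρ) α := by
  funext τ y
  cases y with
  | zero => rfl
  | succ y => exact Tm.ren_wk _ _ _

theorem Tm.ren_bind {Γ : List (Ty B)} {τ : Ty B} (t : Tm Γ τ) :
    ∀ {Δ Θ : List (Ty B)} (s : ∀ σ, Vr Γ σ → Tm Δ σ) (ρ : ∀ σ, Vr Δ σ → Vr Θ σ),
      (t.bind s).ren ρ = t.bind (fun σ y => (s σ y).ren ρ) := by
  induction t with
  | var y => intros; rfl
  | con c => intros; rfl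
  | lcon k => intros; rfl
  | inc e t ih => intros; simp only [Tm.ren, Tm.bind, ih]
  | app t s iht ihs => intros; simp only [Tm.ren, Tm.bind, iht, ihs]
  | lam hα t ih => intros; simp only [Tm.ren, Tm.bind, ih, ren_liftSub]

theorem Tm.bind_wk {Γ Δ : List (Ty B)} {τ : Ty B} (t : Tm Γ τ) (s : ∀ σ, Vr Γ σ → Tm Δ σ)
    (α : Ty B) : (t.wk α).bind (liftSub s α) = (t.bind s).wk α := by
  simp only [Tm.wk, Tm.bind_ren, Tm.ren_bind]
  rfl

theorem liftSub_comp {Γ Δ Θ : List (Ty B)} (s : ∀ τ, Vr Γ τ → Tm Δ τ)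
    (s' : ∀ τ, Vr Δ τ → Tm Θ τ) (α : Ty B) :
    (fun τ y => (liftSub s α τ y).bind (liftSub s' α)) =
      liftSub (fun τ y => (s τ y).bind s') α := by
  funext τ y
  cases y with
  | zero => rfl
  | succ y => exact Tm.bind_wk _ _ _

theorem Tm.bind_bind {Γ : List (Ty B)} {τ : Ty B} (t : Tm Γ τ) :
    ∀ {Δ Θ : List (Ty B)} (s : ∀ σ, Vr Γ σ → Tm Δ σ) (s' : ∀ σ, Vr Δ σ → Tm Θ σ),
      (t.bind s).bind s' = t.bind (fun σ y => (s σ y).bind s') := by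
  induction t with
  | var y => intros; rfl
  | con c => intros; rfl
  | lcon k => intros; rfl
  | inc e t ih => intros; simp only [Tm.bind, ih]
  | app t s iht ihs => intros; simp only [Tm.bind, iht, ihs]
  | lam hα t ih => intros; simp only [Tm.bind, ih, liftSub_comp]

theorem liftSub_var (Γ : List (Ty B)) (α : Ty B) :
    liftSub (fun τ (y : Vr Γ τ) => Tm.var y) α = fun _ y => Tm.var y := by
  funext τ y
  cases y <;> rfl

theorem Tm.bind_var {Γ : List (Ty B)} {τ : Ty B} (t : Tm Γ τ) :
    t.bind (fun _ y => .var y) = t := by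
  induction t with
  | var y => rfl
  | con c => rfl
  | lcon k => rfl
  | inc e t ih => simp only [Tm.bind, ih]
  | app t s iht ihs => simp only [Tm.bind, iht, ihs]
  | lam hα t ih => simp only [Tm.bind, liftSub_var, ih]

/-! ### Convertibility -/

/-- `λ`-equivalence: `β`- and `η`-conversion, and the identification of a positive formula with
the goal formula it is included as. -/
inductive Conv : ∀ {Γ : List (Ty B)} {τ : Ty B}, Tm Γ τ → Tm Γ τ → Prop
  | refl {Γ : List (Ty B)} {τ : Ty B} (t : Tm Γ τ) : Conv t t
  | symm {Γ : List (Ty B)} {τ : Ty B} {t t' : Tm Γ τ} : Conv t t' → Conv t' t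
  | trans {Γ : List (Ty B)} {τ : Ty B} {t t' t'' : Tm Γ τ} : Conv t t' → Conv t' t'' → Conv t t''
  | inc {Γ : List (Ty B)} {σ τ : Ty B} (e : Incl σ τ) {t t' : Tm Γ σ} :
      Conv t t' → Conv (.inc e t) (.inc e t')
  | app {Γ : List (Ty B)} {α β : Ty B} {t t' : Tm Γ (.arr α β)} {s s' : Tm Γ α} :
      Conv t t' → Conv s s' → Conv (.app t s) (.app t' s')
  | lam {Γ : List (Ty B)} {α β : Ty B} (hα : α.VarTy) {t t' : Tm (α :: Γ) β} :
      Conv t t' → Conv (.lam hα t) (.lam hα t')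
  | beta {Γ : List (Ty B)} {α β : Ty B} (hα : α.VarTy) (t : Tm (α :: Γ) β) (s : Tm Γ α) :
      Conv (.app (.lam hα t) s) (t.bind (instSub s))
  | eta {Γ : List (Ty B)} {α β : Ty B} (hα : α.VarTy) (t : Tm Γ (.arr α β)) :
      Conv (.lam hα (.app (t.wk α) (.var .zero))) t
  | incTop {Γ : List (Ty B)} : Conv (Γ := Γ) (.inc .hg (.lcon .topH)) (.lcon .topG)
  | incAnd {Γ : List (Ty B)} (t s : Tm Γ .h) :
      Conv (.inc .hg (.app (.app (.lcon .andH) t) s))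
        (.app (.app (.lcon .andG) (.inc .hg t)) (.inc .hg s))
  | incOr {Γ : List (Ty B)} (t s : Tm Γ .h) :
      Conv (.inc .hg (.app (.app (.lcon .orH) t) s))
        (.app (.app (.lcon .orG) (.inc .hg t)) (.inc .hg s))
  | incSig {Γ : List (Ty B)} {α : Ty B} (hα : α.VarTy) (t : Tm (α :: Γ) .h) :
      Conv (.inc .hg (.app (.lcon (.sigH hα)) (.lam hα t)))
        (.app (.lcon (.sigG hα)) (.lam hα (.inc .hg t)))

theorem Conv.bind {Γ : List (Ty B)} {τ : Ty B} {t t' : Tm Γ τ} (hc : Conv t t') :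
    ∀ {Δ : List (Ty B)} (s : ∀ σ, Vr Γ σ → Tm Δ σ), Conv (t.bind s) (t'.bind s) := by
  induction hc with
  | refl t => intros; exact .refl _
  | symm _ ih => intro Δ s; exact (ih s).symm
  | trans _ _ ih ih' => intro Δ s; exact (ih s).trans (ih' s)
  | inc e _ ih => intro Δ s; exact .inc e (ih s)
  | app _ _ ih ih' => intro Δ s; exact .app (ih s) (ih' s)
  | lam hα _ ih => intro Δ s; exact .lam hα (ih _)
  | @beta Γ α β hα t u =>
    intro Δ s
    have key : (t.bind (instSub u)).bind s = (t.bind (liftSub s α)).bind (instSub (u.bind s)) := by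
      simp only [Tm.bind_bind]
      congr 1
      funext σ y
      cases y with
      | zero => rfl
      | succ y =>
        simp only [instSub, liftSub, Tm.wk, Tm.bind_ren, Tm.bind, Tm.bind_var]
    rw [key]
    exact .beta hα _ _
  | eta hα t =>
    intro Δ s
    simp only [Tm.bind, Tm.bind_wk]
    exact .eta hα _
  | incTop => intros; exact .incTop
  | incAnd t u => intros; exact .incAnd _ _
  | incOr t u => intros; exact .incOr _ _
  | incSig hα t => intros; exact .incSig hα _

/-! ### Levels and occurrences -/

def Vr.LevelLE (i : ℕ) : ∀ {Γ : List (Ty B)} {τ : Ty B}, Vr Γ τ → Prop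
  | _, _, .free x => x.level ≤ i
  | _, _, .zero => True
  | _, _, .succ y => y.LevelLE i

/-- All the logic variables and constants of the raw term have level at most `i`. -/
def Tm.LevelLE (i : ℕ) : ∀ {Γ : List (Ty B)} {τ : Ty B}, Tm Γ τ → Prop
  | _, _, .var y => y.LevelLE i
  | _, _, .con c => c.level ≤ i
  | _, _, .lcon _ => True
  | _, _, .inc _ t => t.LevelLE i
  | _, _, .app t s => t.LevelLE i ∧ s.LevelLE i
  | _, _, .lam _ t => t.LevelLE i

def Vr.Is (x : AVar B) : ∀ {Γ : List (Ty B)} {τ : Ty B}, Vr Γ τ → Prop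
  | _, τ, .free y => (⟨τ, y⟩ : AVar B) = x
  | _, _, .zero => False
  | _, _, .succ y => y.Is x

/-- The logic variable `x` occurs in the raw term. -/
def Tm.HasVar (x : AVar B) : ∀ {Γ : List (Ty B)} {τ : Ty B}, Tm Γ τ → Prop
  | _, _, .var y => y.Is x
  | _, _, .con _ => False
  | _, _, .lcon _ => False
  | _, _, .inc _ t => t.HasVar x
  | _, _, .app t s => t.HasVar x ∨ s.HasVar x
  | _, _, .lam _ t => t.HasVar x

/-- The non-logical constant `c` occurs in the raw term. -/
def Tm.HasCon (c : ACon B) : ∀ {Γ : List (Ty B)} {τ : Ty B}, Tm Γ τ → Prop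
  | _, _, .var _ => False
  | _, τ, .con d => (⟨τ, d⟩ : ACon B) = c
  | _, _, .lcon _ => False
  | _, _, .inc _ t => t.HasCon c
  | _, _, .app t s => t.HasCon c ∨ s.HasCon c
  | _, _, .lam _ t => t.HasCon c

/-! ### Terms -/

/-- Terms: raw terms up to `λ`-equivalence (equivalently, principal normal forms). -/
def Term (Γ : List (Ty B)) (τ : Ty B) : Type u := Quot (Conv (Γ := Γ) (τ := τ))

/-- Terms without free occurrences of bound variables. -/
abbrev CTerm (τ : Ty B) : Type u := Term ([] : List (Ty B)) τ

namespace Term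

variable {Γ Δ : List (Ty B)} {σ τ α β : Ty B}

def mk (t : Tm Γ τ) : Term Γ τ := Quot.mk _ t

def var (y : Vr Γ τ) : Term Γ τ := mk (.var y)

def con (c : Con τ) : Term Γ τ := mk (.con c)

def lcon (k : LCon τ) : Term Γ τ := mk (.lcon k)

def inc (e : Incl σ τ) : Term Γ σ → Term Γ τ :=
  Quot.map (.inc e) (fun _ _ hc => .inc e hc)

def app : Term Γ (.arr α β) → Term Γ α → Term Γ β :=
  Quot.map₂ .app (fun _ _ _ hc => .app (.refl _) hc) (fun _ _ _ hc => .app hc (.refl _))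

def lam (hα : α.VarTy) : Term (α :: Γ) β → Term Γ (.arr α β) :=
  Quot.map (.lam hα) (fun _ _ hc => .lam hα hc)

/-- Simultaneous substitution on terms. -/
noncomputable def bind (s : ∀ σ, Vr Γ σ → Term Δ σ) : Term Γ τ → Term Δ τ :=
  Quot.map (fun t => t.bind (fun σ y => (s σ y).out)) (fun _ _ hc => hc.bind _)

/-- The substitution replacing the innermost bound variable by `s`. -/
def single (s : Term Γ α) : ∀ τ, Vr (α :: Γ) τ → Term Γ τ
  | _, .zero => s
  | _, .succ y => var y

/-- `t[s/x]` for the innermost bound variable `x` of `t`. -/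
noncomputable def inst (t : Term (α :: Γ) β) (s : Term Γ α) : Term Γ β := t.bind (single s)

/-- The term has level at most `i`, that is, its normal form is over the `i`-th universe. -/
def LevelLE (i : ℕ) (q : Term Γ τ) : Prop := ∃ t, mk t = q ∧ t.LevelLE i

/-- Free logic variables of (the normal form of) a term. -/
def fv (q : Term Γ τ) : Set (AVar B) := {x | ∀ t, mk t = q → t.HasVar x}

/-- Non-logical constants of (the normal form of) a term. -/
def oc (q : Term Γ τ) : Set (ACon B) := {c | ∀ t, mk t = q → t.HasCon c}

def topG : Term Γ .g := lcon .topG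

def andG (G G' : Term Γ .g) : Term Γ .g := app (app (lcon .andG) G) G'

def orG (G G' : Term Γ .g) : Term Γ .g := app (app (lcon .orG) G) G'

/-- The goal `D ⊃ G`. -/
def impG (D : Term Γ .p) (G : Term Γ .g) : Term Γ .g := app (app (lcon .impG) D) G

def exG (hα : α.VarTy) (G : Term (α :: Γ) .g) : Term Γ .g := app (lcon (.sigG hα)) (lam hα G)

def allG (hα : α.VarTy) (G : Term (α :: Γ) .g) : Term Γ .g := app (lcon (.piG hα)) (lam hα G)

def andP (D D' : Term Γ .p) : Term Γ .p := app (app (lcon .andP) D) D'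

/-- The clause `G ⊃ A`. -/
def impP (G : Term Γ .g) (A : Term Γ .r) : Term Γ .p := app (app (lcon .impP) G) A

def allP (hα : α.VarTy) (D : Term (α :: Γ) .p) : Term Γ .p := app (lcon (.piP hα)) (lam hα D)

/-- A rigid atom as a goal. -/
def rigid (A : Term Γ .r) : Term Γ .g := inc .hg (inc .ah (inc .ra A))

end Term

/-- A raw term whose head is a variable or a non-logical constant. -/
inductive Neutral {Γ : List (Ty B)} : ∀ {τ : Ty B}, Tm Γ τ → Prop
  | var {τ : Ty B} (y : Vr Γ τ) : Neutral (.var y)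
  | con {τ : Ty B} (c : Con τ) : Neutral (.con c)
  | app {α β : Ty B} {t : Tm Γ (.arr α β)} (s : Tm Γ α) : Neutral t → Neutral (.app t s)
  | ra {t : Tm Γ .r} : Neutral t → Neutral (.inc .ra t)
  | ah {t : Tm Γ .a} : Neutral t → Neutral (.inc .ah t)

/-- Atomic goals. -/
def Atomic (G : CTerm (B := B) .g) : Prop :=
  ∃ t : Tm ([] : List (Ty B)) .h, Neutral t ∧ G = Term.inc .hg (Term.mk t)

/-! ### Substitutions -/

/-- Assignments of terms to logic variables; substitutions proper are the `Legal` ones. -/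
abbrev Subst (B : Type u) : Type u := ∀ τ : Ty B, LVar τ → CTerm τ

namespace Subst

def id : Subst B := fun _ x => Term.var (.free x)

/-- The variables not fixed by the substitution. -/
def dom (θ : Subst B) : Set (AVar B) := {x | θ x.1 x.2 ≠ id x.1 x.2}

/-- Finite support, and level preservation. (Types are preserved, and ranges are positive,
by construction.) -/
def Legal (θ : Subst B) : Prop :=
  θ.dom.Finite ∧ ∀ (τ : Ty B) (x : LVar τ), (θ τ x).LevelLE x.level

/-- Variables occurring in the substitution. -/
def fv (θ : Subst B) : Set (AVar B) := θ.dom ∪ ⋃ x ∈ θ.dom, (θ x.1 x.2).fv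

/-- Constants occurring in the substitution. -/
def oc (θ : Subst B) : Set (ACon B) := ⋃ x ∈ θ.dom, (θ x.1 x.2).oc

/-- The variables of the empty context are the logic variables. -/
def onVr (θ : Subst B) {τ : Ty B} : Vr [] τ → CTerm τ
  | .free x => θ τ x

/-- Application of a substitution to a term. -/
noncomputable def apply (θ : Subst B) {τ : Ty B} (t : CTerm τ) : CTerm τ :=
  t.bind (fun _ y => θ.onVr y)

/-- Composition in diagrammatic order: first `θ`, then `γ`. -/
noncomputable def comp (θ γ : Subst B) : Subst B := fun τ x => γ.apply (θ τ x)

open Classical in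
/-- Restriction of the domain to `X`. -/
noncomputable def restrict (θ : Subst B) (X : Set (AVar B)) : Subst B :=
  fun τ x => if (⟨τ, x⟩ : AVar B) ∈ X then θ τ x else id τ x

end Subst

/-! ### Elaboration of programs -/

/-- Universally closed facts `A` and rules `G ⊃ A`. -/
inductive Clause : List (Ty B) → Type u
  | fact {Γ : List (Ty B)} (A : Term Γ .r) : Clause Γ
  | rule {Γ : List (Ty B)} (G : Term Γ .g) (A : Term Γ .r) : Clause Γ
  | all {Γ : List (Ty B)} {α : Ty B} (hα : α.VarTy) (K : Clause (α :: Γ)) : Clause Γ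

/-- `InElaboration i D K`: the program formula `D` is over the `i`-th universe and the clause `K`
belongs to the elaboration of `D`. -/
inductive InElaboration (i : ℕ) : ∀ {Γ : List (Ty B)}, Term Γ .p → Clause Γ → Prop
  | fact {Γ : List (Ty B)} {A : Term Γ .r} :
      A.LevelLE i → InElaboration i (Term.inc .rp A) (.fact A)
  | rule {Γ : List (Ty B)} {G : Term Γ .g} {A : Term Γ .r} :
      G.LevelLE i → A.LevelLE i → InElaboration i (Term.impP G A) (.rule G A)
  | left {Γ : List (Ty B)} {D D' : Term Γ .p} {K : Clause Γ} :
      D'.LevelLE i → InElaboration i D K → InElaboration i (Term.andP D D') K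
  | right {Γ : List (Ty B)} {D D' : Term Γ .p} {K : Clause Γ} :
      D.LevelLE i → InElaboration i D' K → InElaboration i (Term.andP D D') K
  | all {Γ : List (Ty B)} {α : Ty B} (hα : α.VarTy) {D : Term (α :: Γ) .p}
      {K : Clause (α :: Γ)} :
      InElaboration i D K → InElaboration i (Term.allP hα D) (.all hα K)

/-- Replacement of the variables of a context by logic variables. -/
noncomputable def Term.renFree {Γ : List (Ty B)} {τ : Ty B} (δ : ∀ σ, Vr Γ σ → LVar σ)
    (t : Term Γ τ) : CTerm τ :=
  t.bind (fun _ y => Term.var (.free (δ _ y)))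

/-- Extension of a replacement by a value for the innermost bound variable. -/
def consVar {Γ : List (Ty B)} {α : Ty B} (w : LVar α) (δ : ∀ σ, Vr Γ σ → LVar σ) :
    ∀ σ, Vr (α :: Γ) σ → LVar σ
  | _, .zero => w
  | _, .succ y => δ _ y

/-- `Apart δ K ws G A`: replacing the quantified variables of the clause `K` by the logic
variables `ws`, in this order, and the variables of its context according to `δ`, yields the
body `G` (`none` for a fact) and the head `A`. -/
inductive Apart : ∀ {Γ : List (Ty B)}, (∀ σ, Vr Γ σ → LVar σ) → Clause Γ → List (AVar B) →
    Option (CTerm (B := B) .g) → CTerm (B := B) .r → Prop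
  | fact {Γ : List (Ty B)} (δ : ∀ σ, Vr Γ σ → LVar σ) (A : Term Γ .r) :
      Apart δ (.fact A) [] none (A.renFree δ)
  | rule {Γ : List (Ty B)} (δ : ∀ σ, Vr Γ σ → LVar σ) (G : Term Γ .g) (A : Term Γ .r) :
      Apart δ (.rule G A) [] (some (G.renFree δ)) (A.renFree δ)
  | all {Γ : List (Ty B)} {δ : ∀ σ, Vr Γ σ → LVar σ} {α : Ty B} (hα : α.VarTy)
      {K : Clause (α :: Γ)} (w : LVar α) {ws : List (AVar B)} {G : Option (CTerm (B := B) .g)}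
      {A : CTerm (B := B) .r} :
      Apart (consVar w δ) K ws G A → Apart δ (.all hα K) (⟨α, w⟩ :: ws) G A

/-- The variables of the empty context are the logic variables. -/
def freeVar : ∀ σ : Ty B, Vr [] σ → LVar σ
  | _, .free x => x

/-! ### Resolution -/

/-- A state: a level, a program and a goal. -/
structure State (B : Type u) : Type u where
  idx : ℕ
  prog : List (CTerm (B := B) .p)
  goal : CTerm (B := B) .g

/-- The program and the goal are over the universe given by the state index. -/
def State.Valid (s : State B) : Prop :=
  (∀ D ∈ s.prog, D.LevelLE s.idx) ∧ s.goal.LevelLE s.idx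

noncomputable def State.apply (θ : Subst B) (s : State B) : State B :=
  ⟨s.idx, s.prog.map θ.apply, θ.apply s.goal⟩

/-- State vectors; the null vector `□` is `[]`. -/
abbrev StateVector (B : Type u) : Type u := List (State B)

namespace StateVector

def Valid (A : StateVector B) : Prop := ∀ s ∈ A, s.Valid

noncomputable def apply (θ : Subst B) (A : StateVector B) : StateVector B :=
  A.map (State.apply θ)

def fv (A : StateVector B) : Set (AVar B) :=
  {x | ∃ s ∈ A, (∃ D ∈ s.prog, x ∈ D.fv) ∨ x ∈ s.goal.fv}

def oc (A : StateVector B) : Set (ACon B) :=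
  {c | ∃ s ∈ A, (∃ D ∈ s.prog, c ∈ D.oc) ∨ c ∈ s.goal.oc}

end StateVector

/-- The names of the resolution rules. -/
inductive Rule : Type
  | null | true | backchain | axm | or | and | instance_ | augment | generic | sub

/-- `Step ρ V C A θ A' W K`: by the rule `ρ`, the vector `A` is transformed into `A'` with the
substitution `θ`, when the variables `V` and the constants `C` have occurred before. `W` and `K`
are the fresh variables and constants introduced by the step. -/
inductive Step : Rule → Set (AVar B) → Set (ACon B) → StateVector B → Subst B → StateVector B →
    Set (AVar B) → Set (ACon B) → Prop
  | null {V : Set (AVar B)} {C : Set (ACon B)} (L R : StateVector B) (i : ℕ)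
      (P : List (CTerm (B := B) .p)) :
      Step .null V C (L ++ ⟨i, P, Term.topG⟩ :: R) Subst.id (L ++ R) ∅ ∅
  | true {V : Set (AVar B)} {C : Set (ACon B)} (L R : StateVector B) (i : ℕ)
      (P : List (CTerm (B := B) .p)) {G : CTerm (B := B) .g} {θ : Subst B} :
      Atomic G → θ.Legal → θ ≠ Subst.id → θ.apply G = Term.topG →
      Step .true V C (L ++ ⟨i, P, G⟩ :: R) θ
        (L.apply θ ++ ⟨i, P.map θ.apply, Term.topG⟩ :: R.apply θ) ∅ ∅
  | backchain {V : Set (AVar B)} {C : Set (ACon B)} (L R : StateVector B) (i : ℕ)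
      (P : List (CTerm (B := B) .p)) {A' A : CTerm (B := B) .r} {D : CTerm (B := B) .p} {K : Clause []}
      {ws : List (AVar B)} {G : CTerm (B := B) .g} {θ : Subst B} :
      A'.LevelLE i → D ∈ P → InElaboration i D K → Apart freeVar K ws (some G) A →
      ws.Nodup → (∀ x ∈ ws, x ∉ V ∧ x.2.level ≤ i) → θ.Legal → θ.apply A' = θ.apply A →
      Step .backchain V C (L ++ ⟨i, P, Term.rigid A'⟩ :: R) θ
        (L.apply θ ++ ⟨i, P.map θ.apply, θ.apply G⟩ :: R.apply θ) {x | x ∈ ws} ∅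
  | axm {V : Set (AVar B)} {C : Set (ACon B)} (L R : StateVector B) (i : ℕ)
      (P : List (CTerm (B := B) .p)) {A' A : CTerm (B := B) .r} {D : CTerm (B := B) .p} {K : Clause []}
      {ws : List (AVar B)} {θ : Subst B} :
      A'.LevelLE i → D ∈ P → InElaboration i D K → Apart freeVar K ws none A →
      ws.Nodup → (∀ x ∈ ws, x ∉ V ∧ x.2.level ≤ i) → θ.Legal → θ.apply A' = θ.apply A →
      Step .axm V C (L ++ ⟨i, P, Term.rigid A'⟩ :: R) θ (L.apply θ ++ R.apply θ)
        {x | x ∈ ws} ∅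
  | orLeft {V : Set (AVar B)} {C : Set (ACon B)} (L R : StateVector B) (i : ℕ)
      (P : List (CTerm (B := B) .p)) {G G' : CTerm (B := B) .g} :
      G.LevelLE i → G'.LevelLE i →
      Step .or V C (L ++ ⟨i, P, Term.orG G G'⟩ :: R) Subst.id (L ++ ⟨i, P, G⟩ :: R) ∅ ∅
  | orRight {V : Set (AVar B)} {C : Set (ACon B)} (L R : StateVector B) (i : ℕ)
      (P : List (CTerm (B := B) .p)) {G G' : CTerm (B := B) .g} :
      G.LevelLE i → G'.LevelLE i →
      Step .or V C (L ++ ⟨i, P, Term.orG G G'⟩ :: R) Subst.id (L ++ ⟨i, P, G'⟩ :: R) ∅ ∅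
  | and {V : Set (AVar B)} {C : Set (ACon B)} (L R : StateVector B) (i : ℕ)
      (P : List (CTerm (B := B) .p)) {G G' : CTerm (B := B) .g} :
      G.LevelLE i → G'.LevelLE i →
      Step .and V C (L ++ ⟨i, P, Term.andG G G'⟩ :: R) Subst.id
        (L ++ ⟨i, P, G⟩ :: ⟨i, P, G'⟩ :: R) ∅ ∅
  | instance_ {V : Set (AVar B)} {C : Set (ACon B)} (L R : StateVector B) (i : ℕ)
      (P : List (CTerm (B := B) .p)) {α : Ty B} (hα : α.VarTy) {G : Term [α] .g} {t : CTerm α} :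
      G.LevelLE i → t.LevelLE i →
      Step .instance_ V C (L ++ ⟨i, P, Term.exG hα G⟩ :: R) Subst.id
        (L ++ ⟨i, P, G.inst t⟩ :: R) ∅ ∅
  | augment {V : Set (AVar B)} {C : Set (ACon B)} (L R : StateVector B) (i : ℕ)
      (P : List (CTerm (B := B) .p)) {D : CTerm (B := B) .p} {G : CTerm (B := B) .g} :
      D.LevelLE i → G.LevelLE i →
      Step .augment V C (L ++ ⟨i, P, Term.impG D G⟩ :: R) Subst.id
        (L ++ ⟨i, P ++ [D], G⟩ :: R) ∅ ∅
  | generic {V : Set (AVar B)} {C : Set (ACon B)} (L R : StateVector B) (i : ℕ)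
      (P : List (CTerm (B := B) .p)) {α : Ty B} (hα : α.VarTy) {G : Term [α] .g} {c : Con α} :
      G.LevelLE i → c.level = i + 1 → (⟨α, c⟩ : ACon B) ∉ C →
      Step .generic V C (L ++ ⟨i, P, Term.allG hα G⟩ :: R) Subst.id
        (L ++ ⟨i + 1, P, G.inst (Term.con c)⟩ :: R) ∅ {⟨α, c⟩}
  | sub {V : Set (AVar B)} {C : Set (ACon B)} (L R : StateVector B) (i : ℕ)
      (P : List (CTerm (B := B) .p)) (G : CTerm (B := B) .g) {θ : Subst B} :
      θ.Legal →
      Step .sub V C (L ++ ⟨i, P, G⟩ :: R) θ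
        (L.apply θ ++ ⟨i, P.map θ.apply, θ.apply G⟩ :: R.apply θ) ∅ ∅

/-- Sequences of resolution steps from `A`, by rules in `S`. `Res S A θ A' V C N`: the sequence
ends in `A'`; the composition of the intervening substitutions is `θ`; the variables `V` and
constants `C` have occurred in it; `N` are the constants introduced by its generic steps. -/
inductive Res (S : Set Rule) (A : StateVector B) : Subst B → StateVector B → Set (AVar B) →
    Set (ACon B) → Set (ACon B) → Prop
  | refl : Res S A Subst.id A A.fv A.oc ∅
  | step {θ γ : Subst B} {A' A'' : StateVector B} {V W : Set (AVar B)} {C N K : Set (ACon B)}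
      {ρ : Rule} :
      Res S A θ A' V C N → ρ ∈ S → Step ρ V C A' γ A'' W K →
      Res S A (θ.comp γ) A'' (V ∪ W ∪ γ.fv ∪ A''.fv) (C ∪ K ∪ γ.oc ∪ A''.oc) (N ∪ K)

/-- There is a resolution from `A` to `A'` by rules in `S` with computed answer `θ` (the
composition of the intervening substitutions, restricted to the free variables of `A`), whose
generic steps introduce the constants `N`. -/
def DerivesWith (S : Set Rule) (A : StateVector B) (θ : Subst B) (A' : StateVector B)
    (N : Set (ACon B)) : Prop :=
  ∃ (η : Subst B) (V : Set (AVar B)) (C : Set (ACon B)),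
    Res S A η A' V C N ∧ θ = η.restrict A.fv

def Derives (S : Set Rule) (A : StateVector B) (θ : Subst B) (A' : StateVector B) : Prop :=
  ∃ N, DerivesWith S A θ A' N

/-- The rules of ordinary resolution. -/
def ordinary : Set Rule := {ρ | ρ ≠ .sub}

/-- The rules of enriched resolution. -/
def enriched : Set Rule := Set.univ

end Types

/-! ### Uniform algebras -/

/-- Uniform applicative structures. -/
structure UniformStructure (B : Type u) : Type (max u (v + 1)) where
  D : ℕ → Ty B → Type v
  app {i : ℕ} {α β : Ty B} : D i (.arr α β) → D i α → D i β
  ext {i : ℕ} {α β : Ty B} (f f' : D i (.arr α β)) : (∀ d, app f d = app f' d) → f = f'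
  const {τ : Ty B} (c : Con τ) : D c.level τ
  lconst {τ : Ty B} (k : LCon τ) : D 0 τ
  /-- The inclusions between levels. -/
  lift {i j : ℕ} {τ : Ty B} (hij : i ≤ j) : D i τ → D j τ
  lift_refl {i : ℕ} {τ : Ty B} (d : D i τ) : lift le_rfl d = d
  lift_trans {i j k : ℕ} {τ : Ty B} (hij : i ≤ j) (hjk : j ≤ k) (d : D i τ) :
    lift hjk (lift hij d) = lift (hij.trans hjk) d
  lift_injective {i j : ℕ} {τ : Ty B} (hij : i ≤ j) :
    Function.Injective (lift (τ := τ) hij)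
  lift_app {i j : ℕ} {α β : Ty B} (hij : i ≤ j) (f : D i (.arr α β)) (d : D i α) :
    lift hij (app f d) = app (lift hij f) (lift hij d)
  /-- The inclusions between the subtypes of the type of formulas. -/
  incl {i : ℕ} {σ τ : Ty B} (e : Incl σ τ) : D i σ → D i τ
  incl_injective {i : ℕ} {σ τ : Ty B} (e : Incl σ τ) : Function.Injective (incl (i := i) e)
  /-- The preorder on the carrier of programs. -/
  le {i : ℕ} : D i .p → D i .p → Prop
  le_refl {i : ℕ} (p : D i .p) : le p p
  le_trans {i : ℕ} (p q s : D i .p) : le p q → le q s → le p s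
  topP {i : ℕ} : D i .p
  top_and {i : ℕ} (p : D i .p) : app (app (lift (Nat.zero_le i) (lconst .andP)) topP) p = p
  and_top {i : ℕ} (p : D i .p) : app (app (lift (Nat.zero_le i) (lconst .andP)) p) topP = p
  le_and {i : ℕ} (p q : D i .p) : le p (app (app (lift (Nat.zero_le i) (lconst .andP)) p) q)
  and_comm {i : ℕ} (p q : D i .p) :
    le (app (app (lift (Nat.zero_le i) (lconst .andP)) p) q)
      (app (app (lift (Nat.zero_le i) (lconst .andP)) q) p)
  app_le_pi {i : ℕ} {α : Ty B} (hα : α.VarTy) (f : D i (.arr α .p)) (d : D i α) :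
    le (app f d) (app (lift (Nat.zero_le i) (lconst (.piP hα))) f)

namespace UniformStructure

variable {B : Type u} (M : UniformStructure.{u, v} B)

/-- The interpretation of a logical constant, included at level `i`. -/
def lc {τ : Ty B} (k : LCon τ) (i : ℕ) : M.D i τ := M.lift (Nat.zero_le i) (M.lconst k)

/-- Application of an interpreted binary connective. -/
def bin {i : ℕ} {α β τ : Ty B} (k : LCon (.arr α (.arr β τ))) (x : M.D i α) (y : M.D i β) :
    M.D i τ := M.app (M.app (M.lc k i) x) y

/-- The inclusion of rigid atoms into goals. -/
def rigid {i : ℕ} (x : M.D i .r) : M.D i .g := M.incl .hg (M.incl .ah (M.incl .ra x))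

/-- Assignments, respecting levels and types. -/
abbrev Assign : Type (max u v) := ∀ (τ : Ty B) (x : LVar τ), M.D x.level τ

end UniformStructure

/-- `Ω`-valuations on a uniform applicative structure. -/
structure Valuation {B : Type u} (M : UniformStructure.{u, v} B) (Ω : Type w)
    [DistribLattice Ω] [OrderTop Ω] : Type (max u v w) where
  I : ∀ i : ℕ, M.D i .p → M.D i .g → Ω
  atom {i : ℕ} (x : M.D i .r) : I i (M.incl .rp x) (M.rigid x) = ⊤
  mono {i : ℕ} (p : M.D i .p) (g : M.D i .g) :
    I i p g ≤ I (i + 1) (M.lift (Nat.le_succ i) p) (M.lift (Nat.le_succ i) g)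
  top {i : ℕ} (p : M.D i .p) : I i p (M.lc .topG i) = ⊤
  and {i : ℕ} (p : M.D i .p) (g g' : M.D i .g) : I i p (M.bin .andG g g') = I i p g ⊓ I i p g'
  or {i : ℕ} (p : M.D i .p) (g g' : M.D i .g) : I i p (M.bin .orG g g') = I i p g ⊔ I i p g'
  imp {i : ℕ} (p q : M.D i .p) (g : M.D i .g) :
    I i p (M.bin .impG q g) = I i (M.bin .andP p q) g
  ex {i : ℕ} {α : Ty B} (hα : α.VarTy) (p : M.D i .p) (f : M.D i (.arr α .g)) :
    IsLUB (Set.range fun d : M.D i α => I i p (M.app f d)) (I i p (M.app (M.lc (.sigG hα) i) f))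
  all {i : ℕ} {α : Ty B} (hα : α.VarTy) (p : M.D i .p) (f : M.D i (.arr α .g)) :
    IsGLB (Set.range fun d : M.D i α => I i p (M.app f d)) (I i p (M.app (M.lc (.piG hα) i) f))
  inclusion {i : ℕ} (p p' : M.D i .p) (g : M.D i .g) : M.le p p' → I i p g ≤ I i p' g
  backchain {i : ℕ} (p : M.D i .p) (g : M.D i .g) (x : M.D i .r) :
    M.le (M.bin .impP g x) p → I i p g ≤ I i p (M.rigid x)

/-- Uniform algebras. `U i t φ` is the interpretation of a term `t` of level at most `i` in the
carriers of level `i`; the values of `U` on other arguments are irrelevant. -/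
structure UniformAlgebra (B : Type u) (Ω : Type w) [DistribLattice Ω] [OrderTop Ω] :
    Type (max u (v + 1) w) where
  M : UniformStructure.{u, v} B
  val : Valuation M Ω
  U {τ : Ty B} (i : ℕ) : CTerm τ → M.Assign → M.D i τ
  /-- The interpretations at different levels are related by the (tacit) inclusions. -/
  U_lift {τ : Ty B} {i j : ℕ} (hij : i ≤ j) (t : CTerm τ) (φ : M.Assign) :
    t.LevelLE i → U j t φ = M.lift hij (U i t φ)
  U_var {τ : Ty B} {i : ℕ} (x : LVar τ) (φ : M.Assign) (hx : x.level ≤ i) :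
    U i (Term.var (.free x)) φ = M.lift hx (φ τ x)
  U_con {τ : Ty B} {i : ℕ} (c : Con τ) (φ : M.Assign) (hc : c.level ≤ i) :
    U i (Term.con c) φ = M.lift hc (M.const c)
  U_lcon {τ : Ty B} {i : ℕ} (k : LCon τ) (φ : M.Assign) : U i (Term.lcon k) φ = M.lc k i
  U_inc {σ τ : Ty B} {i : ℕ} (e : Incl σ τ) (t : CTerm σ) (φ : M.Assign) :
    t.LevelLE i → U i (Term.inc e t) φ = M.incl e (U i t φ)
  U_app {α β : Ty B} {i : ℕ} (t : CTerm (.arr α β)) (s : CTerm α) (φ : M.Assign) :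
    t.LevelLE i → s.LevelLE i → U i (Term.app t s) φ = M.app (U i t φ) (U i s φ)
  /-- The interpretation of `λ x. t` sends every `d` to the interpretation of `t[y/x]` under
  `φ[d/y]`, where `y` is a fresh variable; it is unique by extensionality. -/
  U_lam {α β : Ty B} {i : ℕ} (hα : α.VarTy) (t : Term [α] β) (n : ℕ) (φ φ' : M.Assign) :
    t.LevelLE i → (⟨α, ⟨i, n, hα⟩⟩ : AVar B) ∉ t.fv →
    (∀ x : AVar B, x ≠ ⟨α, ⟨i, n, hα⟩⟩ → φ' x.1 x.2 = φ x.1 x.2) →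
    M.app (U i (Term.lam hα t) φ) (φ' α ⟨i, n, hα⟩) =
      U i (t.inst (Term.var (.free ⟨i, n, hα⟩))) φ'

namespace UniformAlgebra

variable {B : Type u} {Ω : Type w} [DistribLattice Ω] [OrderTop Ω]
  (M : UniformAlgebra.{u, v, w} B Ω)

/-- The interpretation at level `i` of the conjunction of a program (`⊤ₚ` if it is empty). -/
def prog (i : ℕ) (P : List (CTerm (B := B) .p)) (φ : M.M.Assign) : M.M.D i .p :=
  P.foldl (fun d D => M.M.bin .andP d (M.U i D φ)) M.M.topP

def state (s : State B) (φ : M.M.Assign) : Ω :=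
  M.val.I s.idx (M.prog s.idx s.prog φ) (M.U s.idx s.goal φ)

/-- The truth value of a state vector. -/
def vector (A : StateVector B) (φ : M.M.Assign) : Ω :=
  A.foldr (fun s x => M.state s φ ⊓ x) ⊤

end UniformAlgebra

end UCTT

open UCTT

/-!
Every resolution step applies its substitution to the whole vector and then performs, on a single
state, a *direct* step, which needs no unification: a clause is used in an instance whose head
already equals the goal. Direct steps are stable under substitutions and under level-preserving
renamings of constants. So a property of states that passes backwards along direct steps passes
backwards along resolutions, from the final vector to the initial vector with the answer applied;
truth and provability by direct steps are such properties.

Conversely, a direct step is simulated by an ordinary resolution step: the clause is renamed apart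
and the unifier moves only the new variables. Hence a proof by direct steps, whose eigenconstants
can be renamed to fresh ones, yields an ordinary resolution with the identity answer, which is
conservativity. Lifting replays the resolution of `A.apply θ` after applying `θ` by the rule Sub.

Soundness of Generic is global, not local: truth of `G[c/x]` in *all* uniform algebras is used in
the algebras obtained from the given one by letting the fresh constant `c` denote an arbitrary
element of level `i` and collapsing all levels above `i` to `i`.
-/

namespace UCTT

section RawTerms

variable {B : Type u} {Γ Δ : List (Ty B)} {α τ : Ty B}

/-- Weakening of a closed term to an arbitrary context of bound variables. -/
def Tm.weaken : ∀ Γ : List (Ty B), Tm [] τ → Tm Γ τ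
  | [], t => t
  | α :: Γ, t => (weaken Γ t).wk α

/-- The term replacing a variable when the logic variables are replaced by closed terms. -/
def Vr.subst (ν : ∀ τ : Ty B, LVar τ → Tm [] τ) :
    ∀ {Γ : List (Ty B)} {τ : Ty B}, Vr Γ τ → Tm Γ τ
  | _, _, .free x => ν _ x
  | _, _, .zero => .var .zero
  | _, _, .succ y => (y.subst ν).wk _

/-- Simultaneous replacement of the constants and of the logic variables by closed terms. -/
def Tm.subst (κ : ∀ τ : Ty B, Con τ → Tm [] τ) (ν : ∀ τ : Ty B, LVar τ → Tm [] τ) :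
    ∀ {Γ : List (Ty B)} {τ : Ty B}, Tm Γ τ → Tm Γ τ
  | _, _, .var y => y.subst ν
  | Γ, _, .con c => (κ _ c).weaken Γ
  | _, _, .lcon k => .lcon k
  | _, _, .inc e t => .inc e (t.subst κ ν)
  | _, _, .app t s => .app (t.subst κ ν) (s.subst κ ν)
  | _, _, .lam hα t => .lam hα (t.subst κ ν)

theorem Tm.ren_eq_bind (t : Tm Γ τ) (ρ : ∀ σ, Vr Γ σ → Vr Δ σ) :
    t.ren ρ = t.bind fun _ y => .var (ρ _ y) := by
  rw [← bind_var (t.ren ρ), bind_ren]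

theorem Conv.ren {t t' : Tm Γ τ} (h : Conv t t') (ρ : ∀ σ, Vr Γ σ → Vr Δ σ) :
    Conv (t.ren ρ) (t'.ren ρ) := by
  simpa only [Tm.ren_eq_bind] using h.bind _

theorem Conv.weaken {t t' : Tm [] τ} (h : Conv t t') :
    ∀ Γ : List (Ty B), Conv (t.weaken Γ) (t'.weaken Γ)
  | [] => h
  | _ :: Γ => (h.weaken Γ).ren _

theorem Tm.conv_bind_of_conv (t : Tm Γ τ) {s s' : ∀ σ, Vr Γ σ → Tm Δ σ}
    (h : ∀ σ y, Conv (s σ y) (s' σ y)) : Conv (t.bind s) (t.bind s') := by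
  induction t generalizing Δ with
  | var y => exact h _ y
  | con c => exact .refl _
  | lcon k => exact .refl _
  | inc e t ih => exact .inc e (ih h)
  | app t u iht ihu => exact .app (iht h) (ihu h)
  | lam hα t ih =>
    refine .lam hα (ih fun σ y => ?_)
    cases y with
    | zero => exact .refl _
    | succ y => exact (h _ y).ren _

theorem Tm.wk_bind_instSub (t : Tm Γ τ) (u : Tm Γ α) : (t.wk α).bind (instSub u) = t := by
  rw [wk, bind_ren]
  exact bind_var t

section Subst

variable {κ κ' : ∀ τ : Ty B, Con τ → Tm [] τ} {ν ν' : ∀ τ : Ty B, LVar τ → Tm [] τ}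

theorem Tm.subst_ren (t : Tm Γ τ) {ρ : ∀ σ, Vr Γ σ → Vr Δ σ}
    (hν : ∀ σ y, (ρ σ y).subst ν = (y.subst ν).ren ρ)
    (hκ : ∀ (σ : Ty B) (u : Tm [] σ), (u.weaken Γ).ren ρ = u.weaken Δ) :
    (t.ren ρ).subst κ ν = (t.subst κ ν).ren ρ := by
  induction t generalizing Δ with
  | var y => exact hν _ y
  | con c => exact (hκ _ _).symm
  | lcon k => rfl
  | inc e t ih => simp only [ren, subst, ih hν hκ]
  | app t u iht ihu => simp only [ren, subst, iht hν hκ, ihu hν hκ]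
  | lam hα t ih =>
    simp only [ren, subst]
    rw [ih (ρ := liftRen ρ _)]
    · intro σ y
      cases y with
      | zero => rfl
      | succ y => simp only [liftRen, Vr.subst, ren_wk, hν]
    · intro σ u
      simp only [weaken, ren_wk, hκ]

theorem Tm.subst_wk (t : Tm Γ τ) (α : Ty B) : (t.wk α).subst κ ν = (t.subst κ ν).wk α :=
  subst_ren t (fun _ _ => rfl) fun _ _ => rfl

theorem Tm.subst_bind (t : Tm Γ τ) {s s' : ∀ σ, Vr Γ σ → Tm Δ σ}
    (hν : ∀ σ y, (s σ y).subst κ ν = (y.subst ν).bind s')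
    (hκ : ∀ (σ : Ty B) (u : Tm [] σ), (u.weaken Γ).bind s' = u.weaken Δ) :
    (t.bind s).subst κ ν = (t.subst κ ν).bind s' := by
  induction t generalizing Δ with
  | var y => exact hν _ y
  | con c => exact (hκ _ _).symm
  | lcon k => rfl
  | inc e t ih => simp only [bind, subst, ih hν hκ]
  | app t u iht ihu => simp only [bind, subst, iht hν hκ, ihu hν hκ]
  | lam hα t ih =>
    simp only [bind, subst]
    rw [ih (s := liftSub s _) (s' := liftSub s' _)]
    · intro σ y
      cases y with
      | zero => rfl
      | succ y => simp only [liftSub, Vr.subst, bind_wk, hν, subst_wk]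
    · intro σ u
      simp only [weaken, bind_wk, hκ]

theorem Tm.subst_instSub (t : Tm (α :: Γ) τ) (u : Tm Γ α) :
    (t.bind (instSub u)).subst κ ν = (t.subst κ ν).bind (instSub (u.subst κ ν)) := by
  refine subst_bind t (fun σ y => ?_) fun σ v => wk_bind_instSub _ _
  cases y with
  | zero => rfl
  | succ y => simp only [instSub, Vr.subst, wk_bind_instSub, subst]

theorem Conv.subst (κ : ∀ τ : Ty B, Con τ → Tm [] τ)
    (ν : ∀ τ : Ty B, LVar τ → Tm [] τ) {t t' : Tm Γ τ} (h : Conv t t') :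
    Conv (t.subst κ ν) (t'.subst κ ν) := by
  induction h with
  | refl t => exact .refl _
  | symm _ ih => exact ih.symm
  | trans _ _ ih ih' => exact ih.trans ih'
  | inc e _ ih => exact .inc e ih
  | app _ _ ih ih' => exact .app ih ih'
  | lam hα _ ih => exact .lam hα ih
  | beta hα t u => rw [Tm.subst_instSub]; exact .beta hα _ _
  | eta hα t => simp only [Tm.subst, Tm.subst_wk]; exact .eta hα _
  | incTop => exact .incTop
  | incAnd t u => exact .incAnd _ _
  | incOr t u => exact .incOr _ _
  | incSig hα t => exact .incSig hα _

theorem Tm.conv_subst_of_conv (t : Tm Γ τ) (hκ : ∀ σ c, Conv (κ σ c) (κ' σ c))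
    (hν : ∀ σ x, Conv (ν σ x) (ν' σ x)) : Conv (t.subst κ ν) (t.subst κ' ν') := by
  induction t with
  | var y =>
    simp only [subst]
    induction y with
    | free x => exact hν _ x
    | zero => exact .refl _
    | succ y ih => exact ih.ren _
  | con c => exact (hκ _ c).weaken _
  | lcon k => exact .refl _
  | inc e t ih => exact .inc e ih
  | app t u iht ihu => exact .app iht ihu
  | lam hα t ih => exact .lam hα ih

theorem Tm.weaken_con (c : Con τ) : ∀ Γ : List (Ty B), (con c : Tm [] τ).weaken Γ = con c
  | [] => rfl
  | _ :: Γ => by rw [weaken, weaken_con c Γ]; rfl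

theorem Tm.subst_con_eq_bind (t : Tm Γ τ) :
    t.subst (fun _ c => con c) ν = t.bind fun _ y => y.subst ν := by
  induction t with
  | var y => rfl
  | con c => exact weaken_con c _
  | lcon k => rfl
  | inc e t ih => simp only [subst, bind, ih]
  | app t u iht ihu => simp only [subst, bind, iht, ihu]
  | lam hα t ih =>
    simp only [subst, bind, ih]
    congr 2
    funext σ y
    cases y <;> rfl

theorem Vr.subst_var (y : Vr Γ τ) : y.subst (fun _ x => .var (.free x)) = .var y := by
  induction y with
  | free x => rfl
  | zero => rfl
  | succ y ih => rw [Vr.subst, ih]; rfl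

theorem Tm.subst_con_var (t : Tm Γ τ) :
    t.subst (fun _ c => con c) (fun _ x => var (.free x)) = t := by
  simp only [subst_con_eq_bind, Vr.subst_var, bind_var]

theorem Tm.subst_weaken (t : Tm [] τ) :
    ∀ Γ : List (Ty B), (t.weaken Γ).subst κ ν = (t.subst κ ν).weaken Γ
  | [] => rfl
  | _ :: Γ => by rw [weaken, subst_wk, subst_weaken t Γ]; rfl

theorem Tm.subst_subst (t : Tm Γ τ) : (t.subst κ ν).subst κ' ν' =
    t.subst (fun _ c => (κ _ c).subst κ' ν') (fun _ x => (ν _ x).subst κ' ν') := by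
  induction t with
  | var y =>
    simp only [subst]
    induction y with
    | free x => rfl
    | zero => rfl
    | succ y ih => simp only [Vr.subst, subst_wk, ih]
  | con c => exact subst_weaken _ _
  | lcon k => rfl
  | inc e t ih => simp only [subst, ih]
  | app t u iht ihu => simp only [subst, iht, ihu]
  | lam hα t ih => simp only [subst, ih]

end Subst

section Over

variable {X X' : Set (AVar B)} {Y Y' : Set (ACon B)}

/-- The logic variable, if it is one, lies in `X`. -/
def Vr.Over (X : Set (AVar B)) (y : Vr Γ τ) : Prop := ∀ x, y.Is x → x ∈ X

/-- The logic variables of a raw term lie in `X` and its constants in `Y`. Levels and free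
occurrences are special cases. -/
def Tm.Over (X : Set (AVar B)) (Y : Set (ACon B)) (t : Tm Γ τ) : Prop :=
  (∀ x, t.HasVar x → x ∈ X) ∧ ∀ c, t.HasCon c → c ∈ Y

theorem Tm.over_var {y : Vr Γ τ} : (var y).Over X Y ↔ y.Over X :=
  and_iff_left fun _ h => h.elim

theorem Tm.over_con {c : Con τ} : (con c : Tm Γ τ).Over X Y ↔ ⟨τ, c⟩ ∈ Y :=
  ⟨fun h => h.2 _ rfl, fun h => ⟨fun _ h' => h'.elim, fun _ h' => h' ▸ h⟩⟩

theorem Tm.over_lcon {k : LCon τ} : (lcon k : Tm Γ τ).Over X Y :=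
  ⟨fun _ h => h.elim, fun _ h => h.elim⟩

theorem Tm.over_app {β : Ty B} {t : Tm Γ (.arr α β)} {s : Tm Γ α} :
    (app t s).Over X Y ↔ t.Over X Y ∧ s.Over X Y := by
  simp only [Over, HasVar, HasCon, or_imp, forall_and]
  tauto

theorem Vr.over_free {x : LVar τ} : (Vr.free x).Over X ↔ ⟨τ, x⟩ ∈ X :=
  ⟨fun h => h _ rfl, fun h _ h' => h' ▸ h⟩

theorem Tm.Over.mono (hX : X ⊆ X') (hY : Y ⊆ Y') {t : Tm Γ τ} (ht : t.Over X Y) : t.Over X' Y' :=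
  ⟨fun x hx => hX (ht.1 x hx), fun c hc => hY (ht.2 c hc)⟩

theorem Vr.levelLE_iff_over {i : ℕ} {y : Vr Γ τ} :
    y.LevelLE i ↔ y.Over {x | x.2.level ≤ i} := by
  induction y with
  | free x => exact (Vr.over_free (X := {x | x.2.level ≤ i})).symm
  | zero => exact ⟨fun _ _ h => h.elim, fun _ => trivial⟩
  | succ _ ih => exact ih

theorem Tm.levelLE_iff_over {i : ℕ} {t : Tm Γ τ} :
    t.LevelLE i ↔ t.Over {x | x.2.level ≤ i} {c | c.2.level ≤ i} := by
  induction t with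
  | var y => exact Vr.levelLE_iff_over.trans over_var.symm
  | con c => exact (over_con (Y := {c | c.2.level ≤ i})).symm
  | lcon k => exact ⟨fun _ => over_lcon, fun _ => trivial⟩
  | inc _ _ ih => exact ih
  | app t s iht ihs => exact (and_congr iht ihs).trans over_app.symm
  | lam _ _ ih => exact ih

theorem Tm.Over.ren {ρ : ∀ σ, Vr Γ σ → Vr Δ σ} (hρ : ∀ σ y, y.Over X → (ρ σ y).Over X)
    {t : Tm Γ τ} (ht : t.Over X Y) : (t.ren ρ).Over X Y := by
  induction t generalizing Δ with
  | var y => exact over_var.2 (hρ _ y (over_var.1 ht))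
  | con c => exact over_con.2 (over_con.1 ht)
  | lcon k => exact over_lcon
  | inc e t ih => exact ih hρ ht
  | app t s iht ihs =>
    exact over_app.2 ((over_app.1 ht).imp (iht hρ) (ihs hρ))
  | lam hα t ih =>
    refine ih (fun σ y hy => ?_) ht
    cases y with
    | zero => exact hy
    | succ y => exact hρ _ y hy

theorem Tm.Over.wk {t : Tm Γ τ} (ht : t.Over X Y) : (t.wk α).Over X Y := by
  refine ht.ren fun _ _ hy => ?_
  exact hy

theorem Tm.Over.weaken {t : Tm [] τ} (ht : t.Over X Y) : ∀ Γ : List (Ty B), (t.weaken Γ).Over X Y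
  | [] => ht
  | _ :: Γ => (ht.weaken Γ).wk

theorem Tm.Over.bind {s : ∀ σ, Vr Γ σ → Tm Δ σ} {t : Tm Γ τ} (ht : t.Over X Y) (hY : Y ⊆ Y')
    (hs : ∀ σ y, y.Over X → (s σ y).Over X' Y') : (t.bind s).Over X' Y' := by
  induction t generalizing Δ with
  | var y => exact hs _ y (over_var.1 ht)
  | con c => exact over_con.2 (hY (over_con.1 ht))
  | lcon k => exact over_lcon
  | inc e t ih => exact ih ht hs
  | app t s iht ihs =>
    exact over_app.2 ((over_app.1 ht).imp (iht · hs) (ihs · hs))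
  | lam hα t ih =>
    refine ih ht fun σ y hy => ?_
    cases y with
    | zero => exact over_var.2 fun _ h => h.elim
    | succ y => exact (hs _ y hy).wk

variable {κ κ' : ∀ τ : Ty B, Con τ → Tm [] τ} {ν ν' : ∀ τ : Ty B, LVar τ → Tm [] τ}

theorem Tm.Over.subst {t : Tm Γ τ} (ht : t.Over X Y) (hκ : ∀ c ∈ Y, (κ c.1 c.2).Over X' Y')
    (hν : ∀ x ∈ X, (ν x.1 x.2).Over X' Y') : (t.subst κ ν).Over X' Y' := by
  induction t with
  | var y =>
    replace ht := over_var.1 ht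
    simp only [Tm.subst]
    induction y with
    | free x => exact hν ⟨_, x⟩ (Vr.over_free.1 ht)
    | zero => exact over_var.2 fun _ h => h.elim
    | succ y ih => exact (ih ht).wk
  | con c => exact (hκ ⟨_, c⟩ (over_con.1 ht)).weaken _
  | lcon k => exact over_lcon
  | inc e t ih => exact ih ht
  | app t s iht ihs => exact over_app.2 ((over_app.1 ht).imp iht ihs)
  | lam hα t ih => exact ih ht

theorem Tm.Over.bind_congr {s s' : ∀ σ, Vr Γ σ → Tm Δ σ} {t : Tm Γ τ} (ht : t.Over X Y)
    (h : ∀ σ y, y.Over X → s σ y = s' σ y) : t.bind s = t.bind s' := by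
  induction t generalizing Δ with
  | var y => exact h _ y (over_var.1 ht)
  | con c => rfl
  | lcon k => rfl
  | inc e t ih => exact congrArg _ (ih ht h)
  | app t s iht ihs =>
    exact congrArg₂ Tm.app (iht (over_app.1 ht).1 h) (ihs (over_app.1 ht).2 h)
  | lam hα t ih =>
    refine congrArg _ (ih ht fun σ y hy => ?_)
    cases y with
    | zero => rfl
    | succ y => exact congrArg _ (h _ y hy)

theorem Tm.Over.subst_congr {t : Tm Γ τ} (ht : t.Over X Y)
    (hκ : ∀ c ∈ Y, κ c.1 c.2 = κ' c.1 c.2) (hν : ∀ x ∈ X, ν x.1 x.2 = ν' x.1 x.2) :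
    t.subst κ ν = t.subst κ' ν' := by
  induction t with
  | var y =>
    replace ht := over_var.1 ht
    simp only [Tm.subst]
    induction y with
    | free x => exact hν ⟨_, x⟩ (Vr.over_free.1 ht)
    | zero => rfl
    | succ y ih => exact congrArg _ (ih ht)
  | con c => exact congrArg _ (hκ ⟨_, c⟩ (over_con.1 ht))
  | lcon k => rfl
  | inc e t ih => exact congrArg _ (ih ht)
  | app t s iht ihs => exact congrArg₂ Tm.app (iht (over_app.1 ht).1) (ihs (over_app.1 ht).2)
  | lam hα t ih => exact congrArg _ (ih ht)

end Over

theorem Vr.subsingleton_is (y : Vr Γ τ) : {x : AVar B | y.Is x}.Subsingleton := by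
  intro x hx x' hx'
  induction y with
  | free z => exact hx.symm.trans hx'
  | zero => exact hx.elim
  | succ y ih => exact ih hx hx'

theorem Tm.finite_hasVar (t : Tm Γ τ) : {x : AVar B | t.HasVar x}.Finite := by
  induction t with
  | var y => exact y.subsingleton_is.finite
  | con _ => exact Set.finite_empty
  | lcon _ => exact Set.finite_empty
  | inc _ _ ih => exact ih
  | app t u iht ihu => exact iht.union ihu
  | lam _ _ ih => exact ih

theorem Tm.finite_hasCon (t : Tm Γ τ) : {c : ACon B | t.HasCon c}.Finite := by
  induction t with
  | var _ => exact Set.finite_empty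
  | con c => exact Set.Subsingleton.finite fun x hx x' hx' => hx.symm.trans hx'
  | lcon _ => exact Set.finite_empty
  | inc _ _ ih => exact ih
  | app t u iht ihu => exact iht.union ihu
  | lam _ _ ih => exact ih

end RawTerms

section Terms

variable {B : Type u} {Γ Δ Θ : List (Ty B)} {σ τ α β : Ty B}

theorem Ty.VarTy.conTy (h : τ.VarTy) : τ.ConTy := by
  induction τ with
  | arr α β _ ih => exact ⟨h.1, ih h.2⟩
  | _ => trivial

theorem Conv.equivalence (Γ : List (Ty B)) (τ : Ty B) :
    Equivalence (Conv : Tm Γ τ → Tm Γ τ → Prop) :=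
  ⟨Conv.refl, Conv.symm, Conv.trans⟩

/-- Replacements of the constants by closed terms. -/
abbrev ConSubst (B : Type u) : Type u := ∀ τ : Ty B, Con τ → CTerm τ

namespace Term

theorem mk_eq_mk {t t' : Tm Γ τ} : mk t = mk t' ↔ Conv t t' :=
  ⟨fun h => ((Conv.equivalence Γ τ).quot_mk_eq_iff t t').1 h, fun h => Quot.sound h⟩

theorem mk_out (q : Term Γ τ) : mk q.out = q := Quot.out_eq q

theorem bind_mk {s : ∀ σ, Vr Γ σ → Term Δ σ} {s' : ∀ σ, Vr Γ σ → Tm Δ σ}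
    (h : ∀ σ y, mk (s' σ y) = s σ y) (t : Tm Γ τ) : (mk t).bind s = mk (t.bind s') :=
  mk_eq_mk.2 (t.conv_bind_of_conv fun σ y => mk_eq_mk.1 ((mk_out _).trans (h σ y).symm))

theorem bind_bind (q : Term Γ τ) (s : ∀ σ, Vr Γ σ → Term Δ σ) (s' : ∀ σ, Vr Δ σ → Term Θ σ) :
    (q.bind s).bind s' = q.bind fun σ y => (s σ y).bind s' := by
  induction q using Quot.ind with | mk t =>
  change (mk (t.bind fun σ y => (s σ y).out)).bind s' = (mk t).bind _
  rw [bind_mk (fun σ y => mk_out (s' σ y)), Tm.bind_bind, bind_mk]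
  intro σ y
  conv_rhs => rw [← mk_out (s σ y)]
  rfl

theorem bind_var (q : Term Γ τ) : q.bind (fun _ y => var y) = q := by
  induction q using Quot.ind with | mk t =>
  change (mk t).bind _ = mk t
  exact (bind_mk (s' := fun _ y => .var y) (fun _ _ => rfl) t).trans (congrArg mk (Tm.bind_var t))

theorem inst_mk (t : Tm (α :: Γ) β) (s : Tm Γ α) :
    (mk t).inst (mk s) = mk (t.bind (instSub s)) := by
  apply bind_mk
  intro σ y
  cases y <;> rfl

theorem beta (hα : α.VarTy) (q : Term (α :: Γ) β) (s : Term Γ α) :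
    app (lam hα q) s = q.inst s := by
  induction q using Quot.ind with | mk t =>
  induction s using Quot.ind with | mk s =>
  exact (mk_eq_mk.2 (.beta hα t s)).trans (inst_mk t s).symm

/-- Simultaneous replacement of the constants and of the logic variables by closed terms. -/
noncomputable def subst (κ : ConSubst B) (ν : Subst B) : Term Γ τ → Term Γ τ :=
  Quot.map (Tm.subst (fun _ c => (κ _ c).out) (fun _ x => (ν _ x).out))
    fun _ _ h => h.subst _ _

section Subst

variable {κ κ' : ConSubst B} {ν ν' : Subst B}

theorem subst_mk {κ₀ : ∀ τ : Ty B, Con τ → Tm [] τ} {ν₀ : ∀ τ : Ty B, LVar τ → Tm [] τ}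
    (hκ : ∀ τ c, mk (κ₀ τ c) = κ τ c) (hν : ∀ τ x, mk (ν₀ τ x) = ν τ x) (t : Tm Γ τ) :
    (mk t).subst κ ν = mk (t.subst κ₀ ν₀) :=
  mk_eq_mk.2 (t.conv_subst_of_conv (fun _ c => mk_eq_mk.1 ((mk_out _).trans (hκ _ c).symm))
    fun _ x => mk_eq_mk.1 ((mk_out _).trans (hν _ x).symm))

theorem subst_app (q : Term Γ (.arr α β)) (r : Term Γ α) :
    (app q r).subst κ ν = app (q.subst κ ν) (r.subst κ ν) := by
  induction q using Quot.ind
  induction r using Quot.ind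
  rfl

theorem subst_inc (e : Incl σ τ) (q : Term Γ σ) : (inc e q).subst κ ν = inc e (q.subst κ ν) := by
  induction q using Quot.ind
  rfl

theorem subst_lam (hα : α.VarTy) (q : Term (α :: Γ) β) :
    (lam hα q).subst κ ν = lam hα (q.subst κ ν) := by
  induction q using Quot.ind
  rfl

theorem subst_lcon (k : LCon τ) : (lcon k : Term Γ τ).subst κ ν = lcon k := rfl

theorem subst_con (c : Con τ) : (con c : CTerm τ).subst κ ν = κ τ c := mk_out _

theorem subst_free (x : LVar τ) : (var (.free x) : CTerm τ).subst κ ν = ν τ x := mk_out _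

theorem subst_inst (q : Term (α :: Γ) β) (s : Term Γ α) :
    (q.inst s).subst κ ν = (q.subst κ ν).inst (s.subst κ ν) := by
  induction q using Quot.ind with | mk t =>
  induction s using Quot.ind with | mk s =>
  change ((mk t).inst (mk s)).subst κ ν = (mk (t.subst _ _)).inst (mk (s.subst _ _))
  rw [inst_mk, inst_mk, ← Tm.subst_instSub]
  rfl

theorem subst_subst (q : Term Γ τ) : (q.subst κ ν).subst κ' ν' =
    q.subst (fun _ c => (κ _ c).subst κ' ν') (fun _ x => (ν _ x).subst κ' ν') := by
  induction q using Quot.ind with | mk t =>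
  change (mk (t.subst _ _)).subst κ' ν' = (mk t).subst _ _
  rw [subst_mk (fun _ c => mk_out (κ' _ c)) (fun _ x => mk_out (ν' _ x)), Tm.subst_subst, subst_mk]
  · intro σ c
    conv_rhs => rw [← mk_out (κ σ c)]
    rfl
  · intro σ x
    conv_rhs => rw [← mk_out (ν σ x)]
    rfl

theorem subst_con_id (q : Term Γ τ) : q.subst (fun _ c => con c) Subst.id = q := by
  induction q using Quot.ind with | mk t =>
  change (mk t).subst _ _ = mk t
  exact (subst_mk (κ₀ := fun _ c => .con c) (ν₀ := fun _ x => .var (.free x)) (fun _ _ => rfl)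
    (fun _ _ => rfl) t).trans (congrArg mk (Tm.subst_con_var t))

end Subst

section Over

variable {X X' : Set (AVar B)} {Y Y' : Set (ACon B)} {q : Term Γ τ}

/-- Some representative of the term has its logic variables in `X` and its constants in `Y`.
This replaces reasoning about the normal form. -/
def Over (X : Set (AVar B)) (Y : Set (ACon B)) (q : Term Γ τ) : Prop :=
  ∃ t, mk t = q ∧ t.Over X Y

theorem over_univ (q : Term Γ τ) : q.Over Set.univ Set.univ :=
  ⟨q.out, mk_out q, fun _ _ => trivial, fun _ _ => trivial⟩

theorem Over.mono (hX : X ⊆ X') (hY : Y ⊆ Y') : q.Over X Y → q.Over X' Y'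
  | ⟨t, h, ht⟩ => ⟨t, h, ht.mono hX hY⟩

theorem over_var {y : Vr Γ τ} (hy : y.Over X) : (var y).Over X Y := ⟨_, rfl, Tm.over_var.2 hy⟩

theorem over_con {c : Con τ} (hc : ⟨τ, c⟩ ∈ Y) : (con c : Term Γ τ).Over X Y :=
  ⟨_, rfl, Tm.over_con.2 hc⟩

theorem Over.fv_subset : q.Over X Y → q.fv ⊆ X
  | ⟨t, h, ht⟩ => fun x hx => ht.1 x (hx t h)

theorem Over.oc_subset : q.Over X Y → q.oc ⊆ Y
  | ⟨t, h, ht⟩ => fun x hx => ht.2 x (hx t h)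

theorem over_compl_of_notMem_fv {x : AVar B} (hx : x ∉ q.fv) : q.Over {x}ᶜ Set.univ := by
  simp only [fv, Set.mem_ofPred_eq, not_forall] at hx
  obtain ⟨t, ht, hxt⟩ := hx
  exact ⟨t, ht, fun z hz hzx => hxt (hzx ▸ hz), fun _ _ => trivial⟩

theorem over_compl_of_notMem_oc {c : ACon B} (hc : c ∉ q.oc) : q.Over Set.univ {c}ᶜ := by
  simp only [oc, Set.mem_ofPred_eq, not_forall] at hc
  obtain ⟨t, ht, hct⟩ := hc
  exact ⟨t, ht, fun _ _ => trivial, fun d hd hdc => hct (hdc ▸ hd)⟩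

theorem levelLE_iff_over {i : ℕ} :
    q.LevelLE i ↔ q.Over {x | x.2.level ≤ i} {c | c.2.level ≤ i} := by
  simp only [LevelLE, Over, Tm.levelLE_iff_over]

theorem exists_rep_family {ι : Ty B → Type*} {Δ : Ty B → List (Ty B)}
    (f : ∀ τ, ι τ → Term (Δ τ) τ) {P : ∀ τ, ι τ → Prop}
    (h : ∀ τ x, P τ x → (f τ x).Over X Y) :
    ∃ f₀ : ∀ τ, ι τ → Tm (Δ τ) τ,
      (∀ τ x, mk (f₀ τ x) = f τ x) ∧ ∀ τ x, P τ x → (f₀ τ x).Over X Y := by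
  have rep : ∀ τ x, ∃ t, mk t = f τ x ∧ (P τ x → t.Over X Y) := by
    intro τ x
    by_cases hP : P τ x
    · obtain ⟨t, ht, htX⟩ := h τ x hP
      exact ⟨t, ht, fun _ => htX⟩
    · exact ⟨(f τ x).out, mk_out _, fun h => absurd h hP⟩
  choose f₀ hf₀ hover using rep
  exact ⟨f₀, hf₀, hover⟩

theorem Over.bind {s : ∀ σ, Vr Γ σ → Term Δ σ} (hq : q.Over X Y) (hY : Y ⊆ Y')
    (hs : ∀ σ y, y.Over X → (s σ y).Over X' Y') : (q.bind s).Over X' Y' := by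
  obtain ⟨t, rfl, ht⟩ := hq
  obtain ⟨s₀, hs₀, hover⟩ := exists_rep_family (Δ := fun _ => Δ) s hs
  exact ⟨_, (bind_mk hs₀ t).symm, ht.bind hY hover⟩

theorem Over.bind_congr {s s' : ∀ σ, Vr Γ σ → Term Δ σ} (hq : q.Over X Y)
    (h : ∀ σ y, y.Over X → s σ y = s' σ y) : q.bind s = q.bind s' := by
  obtain ⟨t, rfl, ht⟩ := hq
  exact congrArg mk (ht.bind_congr fun σ y hy => congrArg _ (h σ y hy))

variable {κ κ' : ConSubst B} {ν ν' : Subst B}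

theorem Over.subst (hq : q.Over X Y) (hκ : ∀ c ∈ Y, (κ c.1 c.2).Over X' Y')
    (hν : ∀ x ∈ X, (ν x.1 x.2).Over X' Y') : (q.subst κ ν).Over X' Y' := by
  obtain ⟨t, rfl, ht⟩ := hq
  obtain ⟨κ₀, hκ₀, hκY⟩ := exists_rep_family (Δ := fun _ => []) κ fun τ c => hκ ⟨τ, c⟩
  obtain ⟨ν₀, hν₀, hνX⟩ := exists_rep_family (Δ := fun _ => []) ν fun τ x => hν ⟨τ, x⟩
  exact ⟨_, (subst_mk hκ₀ hν₀ t).symm, ht.subst (fun _ => hκY _ _) fun _ => hνX _ _⟩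

theorem Over.subst_congr (hq : q.Over X Y) (hκ : ∀ c ∈ Y, κ c.1 c.2 = κ' c.1 c.2)
    (hν : ∀ x ∈ X, ν x.1 x.2 = ν' x.1 x.2) : q.subst κ ν = q.subst κ' ν' := by
  obtain ⟨t, rfl, ht⟩ := hq
  exact congrArg mk (ht.subst_congr (fun c hc => congrArg _ (hκ c hc))
    fun x hx => congrArg _ (hν x hx))

/-- Replace the variables outside `X'` by constants in a representative over `X`: this does not
change a representative over `X'`, hence not the term. -/
theorem Over.inter (h : q.Over X .univ) (h' : q.Over X' .univ) : q.Over (X ∩ X') .univ := by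
  classical
  obtain ⟨t, rfl, ht⟩ := h
  obtain ⟨t', htt', ht'⟩ := h'
  let ν₀ : ∀ τ : Ty B, LVar τ → Tm [] τ := fun τ z =>
    if (⟨τ, z⟩ : AVar B) ∈ X' then .var (.free z) else .con ⟨0, 0, z.ok.conTy⟩
  have fixed : t'.subst (fun _ c => .con c) ν₀ = t' :=
    (ht'.subst_congr (fun _ _ => rfl) fun z hz => if_pos hz).trans t'.subst_con_var
  refine ⟨t.subst (fun _ c => .con c) ν₀, ?_, ht.subst (fun _ _ => Tm.over_con.2 trivial) ?_⟩
  · rw [← htt', mk_eq_mk]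
    conv_rhs => rw [← fixed]
    exact (mk_eq_mk.1 htt').symm.subst _ _
  · intro z hz
    by_cases hzX : z ∈ X'
    · exact (congrArg (Tm.Over _ _) (if_pos hzX)).mpr
        (Tm.over_var.2 (Vr.over_free.2 ⟨hz, hzX⟩))
    · exact (congrArg (Tm.Over _ _) (if_neg hzX)).mpr (Tm.over_con.2 trivial)

theorem over_fv (q : Term Γ τ) : q.Over q.fv .univ := by
  have remove : ∀ F : Set (AVar B), F.Finite → q.Over (Fᶜ ∪ q.fv) .univ := by
    intro F hF
    induction F, hF using Set.Finite.induction_on with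
    | empty => exact q.over_univ.mono (by simp) subset_rfl
    | @insert x F _ _ ih =>
      have hx : q.Over ({x}ᶜ ∪ q.fv) .univ := by
        by_cases hx : x ∈ q.fv
        · refine q.over_univ.mono (fun z _ => ?_) subset_rfl
          by_cases hzx : z = x
          · exact .inr (hzx ▸ hx)
          · exact .inl hzx
        · exact (over_compl_of_notMem_fv hx).mono Set.subset_union_left subset_rfl
      exact (hx.inter ih).mono (by
        rw [Set.insert_eq, Set.compl_union, Set.inter_union_distrib_right])
        subset_rfl
  have rep : q.Over {x | q.out.HasVar x} .univ :=
    ⟨q.out, mk_out q, fun _ hx => hx, fun _ _ => trivial⟩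
  exact (rep.inter (remove _ (Tm.finite_hasVar _))).mono
    (fun x hx => hx.2.resolve_left (not_not_intro hx.1)) subset_rfl

theorem finite_fv (q : Term Γ τ) : q.fv.Finite :=
  (Tm.finite_hasVar q.out).subset fun _ hx => hx _ (mk_out q)

theorem finite_oc (q : Term Γ τ) : q.oc.Finite :=
  (Tm.finite_hasCon q.out).subset fun _ hx => hx _ (mk_out q)

theorem fv_var_subset (x : LVar τ) : (var (.free x) : CTerm τ).fv ⊆ {⟨τ, x⟩} :=
  (over_var (X := {⟨τ, x⟩}) (Y := .univ) (Vr.over_free.2 rfl)).fv_subset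

theorem oc_var (x : LVar τ) : (var (.free x) : CTerm τ).oc = ∅ :=
  Set.subset_empty_iff.1 (over_var (X := .univ) fun _ _ => trivial).oc_subset

theorem subst_congr_fv (q : Term Γ τ) (h : ∀ x ∈ q.fv, ν x.1 x.2 = ν' x.1 x.2) :
    q.subst κ ν = q.subst κ ν' :=
  q.over_fv.subst_congr (fun _ _ => rfl) h

theorem fv_subst_subset (q : Term Γ τ) :
    (q.subst (fun _ c => con c) ν).fv ⊆ ⋃ x ∈ q.fv, (ν x.1 x.2).fv :=
  Over.fv_subset <| q.over_fv.subst (fun _ _ => over_con (Set.mem_univ _)) fun _ hx =>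
    (over_fv _).mono (Set.subset_biUnion_of_mem (u := fun x : AVar B => (ν x.1 x.2).fv) hx)
      subset_rfl

theorem notMem_oc_subst {c : ACon B} (q : Term Γ τ) (hq : c ∉ q.oc)
    (hν : ∀ τ x, c ∉ (ν τ x).oc) : c ∉ (q.subst (fun _ c => con c) ν).oc := fun hc =>
  ((over_compl_of_notMem_oc hq).subst (fun _ hd => over_con hd)
    fun x _ => over_compl_of_notMem_oc (hν x.1 x.2)).oc_subset hc rfl

end Over

section Level

variable {i j : ℕ} {q : Term Γ τ} {κ κ' : ConSubst B} {ν ν' : Subst B}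

theorem LevelLE.mono (hij : i ≤ j) (hq : q.LevelLE i) : q.LevelLE j :=
  levelLE_iff_over.2 <| (levelLE_iff_over.1 hq).mono (fun _ hx => le_trans hx hij)
    fun _ hc => le_trans hc hij

theorem levelLE_lcon (i : ℕ) (k : LCon τ) : (lcon k : Term Γ τ).LevelLE i := ⟨_, rfl, trivial⟩

theorem levelLE_var {y : Vr Γ τ} (hy : y.LevelLE i) : (var y).LevelLE i := ⟨_, rfl, hy⟩

theorem levelLE_con {c : Con τ} (hc : c.level ≤ i) : (con c : Term Γ τ).LevelLE i :=
  ⟨_, rfl, hc⟩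

theorem LevelLE.app {q : Term Γ (.arr α β)} {r : Term Γ α} :
    q.LevelLE i → r.LevelLE i → (q.app r).LevelLE i
  | ⟨t, h, h'⟩, ⟨s, hs, hs'⟩ => ⟨.app t s, by rw [← h, ← hs]; rfl, h', hs'⟩

theorem LevelLE.inc (e : Incl σ τ) {q : Term Γ σ} : q.LevelLE i → (inc e q).LevelLE i
  | ⟨t, h, h'⟩ => ⟨.inc e t, by rw [← h]; rfl, h'⟩

theorem LevelLE.lam (hα : α.VarTy) {q : Term (α :: Γ) β} :
    q.LevelLE i → (lam hα q).LevelLE i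
  | ⟨t, h, h'⟩ => ⟨.lam hα t, by rw [← h]; rfl, h'⟩

theorem LevelLE.bind {s : ∀ σ, Vr Γ σ → Term Δ σ} (hij : i ≤ j) (hq : q.LevelLE i)
    (hs : ∀ σ (y : Vr Γ σ), y.LevelLE i → (s σ y).LevelLE j) : (q.bind s).LevelLE j :=
  levelLE_iff_over.2 <| (levelLE_iff_over.1 hq).bind (fun _ hc => le_trans hc hij)
    fun σ y hy => levelLE_iff_over.1 (hs σ y (Vr.levelLE_iff_over.2 hy))

theorem LevelLE.inst {q : Term (α :: Γ) β} {s : Term Γ α} (hq : q.LevelLE i)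
    (hs : s.LevelLE i) : (q.inst s).LevelLE i := by
  refine hq.bind le_rfl fun σ y hy => ?_
  cases y with
  | zero => exact hs
  | succ y => exact levelLE_var hy

theorem LevelLE.subst (hq : q.LevelLE i)
    (hκ : ∀ σ (c : Con σ), c.level ≤ i → (κ σ c).LevelLE j)
    (hν : ∀ σ (x : LVar σ), x.level ≤ i → (ν σ x).LevelLE j) : (q.subst κ ν).LevelLE j :=
  levelLE_iff_over.2 <| (levelLE_iff_over.1 hq).subst
    (fun c hc => levelLE_iff_over.1 (hκ _ c.2 hc)) fun x hx => levelLE_iff_over.1 (hν _ x.2 hx)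

theorem LevelLE.subst_congr (hq : q.LevelLE i)
    (hκ : ∀ σ (c : Con σ), c.level ≤ i → κ σ c = κ' σ c)
    (hν : ∀ σ (x : LVar σ), x.level ≤ i → ν σ x = ν' σ x) : q.subst κ ν = q.subst κ' ν' :=
  (levelLE_iff_over.1 hq).subst_congr (fun c => hκ _ c.2) fun x => hν _ x.2

end Level

end Term

end Terms

section Substitutions

variable {B : Type u} {τ : Ty B}

namespace Subst

theorem apply_eq_subst (θ : Subst B) (q : CTerm τ) :
    θ.apply q = q.subst (fun _ c => Term.con c) θ := by
  induction q using Quot.ind with | mk t =>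
  change (Term.mk t).bind _ = (Term.mk t).subst _ _
  refine Eq.trans ?_ (Term.subst_mk (κ₀ := fun _ c => .con c) (fun _ _ => rfl)
    (fun _ x => Term.mk_out (θ _ x)) t).symm
  rw [Tm.subst_con_eq_bind]
  apply Term.bind_mk
  intro σ y
  cases y
  exact Term.mk_out _

theorem apply_id (q : CTerm τ) : Subst.id.apply q = q := by
  rw [apply_eq_subst, Term.subst_con_id]

theorem apply_comp (θ γ : Subst B) (q : CTerm τ) :
    (θ.comp γ).apply q = γ.apply (θ.apply q) := by
  simp only [apply_eq_subst, Term.subst_subst, Term.subst_con]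
  congr 1
  funext σ x
  exact apply_eq_subst γ _

theorem apply_var (θ : Subst B) (x : LVar τ) : θ.apply (Term.var (.free x)) = θ τ x := by
  rw [apply_eq_subst, Term.subst_free]

theorem apply_congr {θ θ' : Subst B} (q : CTerm τ)
    (h : ∀ x ∈ q.fv, θ x.1 x.2 = θ' x.1 x.2) : θ.apply q = θ'.apply q := by
  rw [apply_eq_subst, apply_eq_subst, Term.subst_congr_fv q h]

theorem id_comp (θ : Subst B) : Subst.id.comp θ = θ :=
  funext₂ fun _ x => apply_var θ x

theorem comp_id (θ : Subst B) : θ.comp Subst.id = θ :=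
  funext₂ fun _ _ => apply_id _

theorem comp_assoc (θ γ ζ : Subst B) : (θ.comp γ).comp ζ = θ.comp (γ.comp ζ) :=
  funext₂ fun τ x => (apply_comp γ ζ (θ τ x)).symm

theorem apply_eq_self {θ : Subst B} {q : CTerm τ}
    (h : ∀ x ∈ q.fv, θ x.1 x.2 = Subst.id x.1 x.2) : θ.apply q = q :=
  (apply_congr q h).trans (apply_id q)

theorem dom_id : (Subst.id : Subst B).dom = ∅ :=
  Set.eq_empty_iff_forall_notMem.2 fun _ h => h rfl

theorem oc_id : (Subst.id : Subst B).oc = ∅ := by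
  rw [oc, dom_id, Set.biUnion_empty]

theorem legal_id : (Subst.id : Subst B).Legal :=
  ⟨by rw [dom_id]; exact Set.finite_empty, fun _ _ => Term.levelLE_var le_rfl⟩

theorem Legal.levelLE {θ : Subst B} (hθ : θ.Legal) {i : ℕ} {x : LVar τ}
    (hx : x.level ≤ i) : (θ τ x).LevelLE i := (hθ.2 τ x).mono hx

theorem Legal.apply {θ : Subst B} (hθ : θ.Legal) {i : ℕ} {q : CTerm τ}
    (hq : q.LevelLE i) : (θ.apply q).LevelLE i := by
  rw [apply_eq_subst]
  exact hq.subst (fun _ _ => Term.levelLE_con) (fun _ _ => hθ.levelLE)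

theorem Legal.comp {θ γ : Subst B} (hθ : θ.Legal) (hγ : γ.Legal) : (θ.comp γ).Legal := by
  refine ⟨(hθ.1.union hγ.1).subset fun x hx => ?_, fun τ x => hγ.apply (hθ.2 τ x)⟩
  by_contra h
  simp only [Set.mem_union, not_or, dom, Set.mem_ofPred_eq, not_not] at h
  refine hx ?_
  change γ.apply (θ x.1 x.2) = _
  rw [h.1]
  exact (apply_var γ x.2).trans h.2

theorem restrict_of_mem {θ : Subst B} {X : Set (AVar B)} {x : LVar τ}
    (hx : (⟨τ, x⟩ : AVar B) ∈ X) : θ.restrict X τ x = θ τ x := if_pos hx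

theorem restrict_of_notMem {θ : Subst B} {X : Set (AVar B)} {x : LVar τ}
    (hx : (⟨τ, x⟩ : AVar B) ∉ X) : θ.restrict X τ x = Term.var (.free x) := if_neg hx

theorem restrict_eq_restrict_iff {θ θ' : Subst B} {X : Set (AVar B)} :
    θ.restrict X = θ'.restrict X ↔ ∀ x ∈ X, θ x.1 x.2 = θ' x.1 x.2 := by
  refine ⟨fun h x hx => ?_, fun h => funext₂ fun τ x => ?_⟩
  · rw [← restrict_of_mem (θ := θ) hx, h, restrict_of_mem hx]
  · by_cases hx : (⟨τ, x⟩ : AVar B) ∈ X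
    · rw [restrict_of_mem hx, restrict_of_mem hx]
      exact h _ hx
    · rw [restrict_of_notMem hx, restrict_of_notMem hx]

theorem id_restrict (X : Set (AVar B)) : (Subst.id : Subst B).restrict X = Subst.id :=
  funext₂ fun _ _ => ite_self _

theorem legal_restrict_of_finite {θ : Subst B} {X : Set (AVar B)} (hX : X.Finite)
    (hθ : ∀ τ x, (θ τ x).LevelLE x.level) : (θ.restrict X).Legal := by
  refine ⟨hX.subset fun x hx => ?_, fun τ x => ?_⟩
  · by_contra h
    exact hx (restrict_of_notMem h)
  · by_cases hx : (⟨τ, x⟩ : AVar B) ∈ X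
    · rw [restrict_of_mem hx]
      exact hθ τ x
    · rw [restrict_of_notMem hx]
      exact Term.levelLE_var le_rfl

theorem Legal.restrict {θ : Subst B} (hθ : θ.Legal) (X : Set (AVar B)) : (θ.restrict X).Legal := by
  refine ⟨hθ.1.subset fun x hx h => hx ?_, fun τ x => ?_⟩
  · by_cases hX : x ∈ X
    · exact (restrict_of_mem hX).trans h
    · exact restrict_of_notMem hX
  · by_cases hX : (⟨τ, x⟩ : AVar B) ∈ X
    · rw [restrict_of_mem hX]
      exact hθ.2 τ x
    · rw [restrict_of_notMem hX]
      exact Term.levelLE_var le_rfl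

theorem Legal.finite_fv {θ : Subst B} (hθ : θ.Legal) : θ.fv.Finite :=
  hθ.1.union (hθ.1.biUnion fun _ _ => Term.finite_fv _)

theorem Legal.finite_oc {θ : Subst B} (hθ : θ.Legal) : θ.oc.Finite :=
  hθ.1.biUnion fun _ _ => Term.finite_oc _

theorem fv_value_subset (θ : Subst B) (x : LVar τ) : (θ τ x).fv ⊆ θ.fv ∪ {⟨τ, x⟩} := by
  by_cases hx : (⟨τ, x⟩ : AVar B) ∈ θ.dom
  · exact fun z hz => .inl (.inr (Set.mem_iUnion₂.2 ⟨_, hx, hz⟩))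
  · have value : θ τ x = Term.var (.free x) := not_not.1 hx
    rw [value]
    exact (Term.fv_var_subset x).trans Set.subset_union_right

theorem oc_value_subset (θ : Subst B) (x : LVar τ) : (θ τ x).oc ⊆ θ.oc := by
  by_cases hx : (⟨τ, x⟩ : AVar B) ∈ θ.dom
  · exact fun z hz => Set.mem_iUnion₂.2 ⟨_, hx, hz⟩
  · have value : θ τ x = Term.var (.free x) := not_not.1 hx
    rw [value, Term.oc_var]
    exact Set.empty_subset _

theorem oc_apply_subset (θ : Subst B) (q : CTerm τ) : (θ.apply q).oc ⊆ q.oc ∪ θ.oc := by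
  intro c hc
  by_contra h
  simp only [Set.mem_union, not_or] at h
  rw [apply_eq_subst] at hc
  exact Term.notMem_oc_subst q h.1 (fun τ x hx => h.2 (oc_value_subset θ x hx)) hc

theorem oc_comp_subset (θ γ : Subst B) : (θ.comp γ).oc ⊆ θ.oc ∪ γ.oc :=
  Set.iUnion₂_subset fun x _ => (oc_apply_subset γ (θ x.1 x.2)).trans
    (Set.union_subset_union_left _ (oc_value_subset θ x.2))

theorem fv_apply_subset (θ : Subst B) (q : CTerm τ) : (θ.apply q).fv ⊆ θ.fv ∪ q.fv := by
  rw [apply_eq_subst]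
  refine (Term.fv_subst_subset q).trans (Set.iUnion₂_subset fun x hx => ?_)
  refine (fv_value_subset θ x.2).trans (Set.union_subset_union_right _ ?_)
  rintro _ rfl
  exact hx

end Subst

end Substitutions

section Environments

variable {B : Type u} {Γ Δ : List (Ty B)} {σ τ α β : Ty B}

/-- Values for the bound variables of a context. -/
inductive Env (F : Ty B → Type u) : List (Ty B) → Type u
  | nil : Env F []
  | cons {Γ : List (Ty B)} {α : Ty B} (t : F α) (e : Env F Γ) : Env F (α :: Γ)

/-- The values of all variables of a context, given those `v` of the logic variables. -/
def Env.get {F : Ty B → Type u} (v : ∀ τ, LVar τ → F τ) :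
    ∀ {Γ : List (Ty B)}, Env F Γ → ∀ σ, Vr Γ σ → F σ
  | _, .nil, _, .free x => v _ x
  | _, .cons t _, _, .zero => t
  | _, .cons _ e, _, .succ y => e.get v _ y

/-- The image of an environment under a family of maps. -/
def Env.map {F F' : Ty B → Type u} (g : ∀ τ, F τ → F' τ) :
    ∀ {Γ : List (Ty B)}, Env F Γ → Env F' Γ
  | _, .nil => .nil
  | _, .cons t e => .cons (g _ t) (e.map g)

theorem Env.get_map {F F' : Ty B → Type u} {v : ∀ τ, LVar τ → F τ} {v' : ∀ τ, LVar τ → F' τ}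
    (g : ∀ τ, F τ → F' τ) (hv : ∀ τ x, v' τ x = g τ (v τ x)) (e : Env F Γ) :
    ∀ (σ : Ty B) (y : Vr Γ σ), (e.map g).get v' σ y = g σ (e.get v σ y) := by
  induction e with
  | nil => intro σ y; cases y; exact hv _ _
  | cons t e ih =>
    intro σ y
    cases y with
    | zero => rfl
    | succ y => exact ih _ y

theorem Env.exists_map_mk (e : Env CTerm Γ) :
    ∃ e₀ : Env (Tm []) Γ, e₀.map (fun _ => Term.mk) = e := by
  induction e with
  | nil => exact ⟨.nil, rfl⟩
  | cons t e ih =>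
    obtain ⟨e₀, rfl⟩ := ih
    exact ⟨.cons t.out e₀, by simp only [Env.map, Term.mk_out]⟩

/-- The substitution of raw terms given by an environment. -/
abbrev Env.raw (e : Env (Tm []) Γ) : ∀ σ, Vr Γ σ → Tm [] σ :=
  e.get fun _ x => .var (.free x)

/-- The substitution of terms given by an environment. -/
abbrev Env.sub (e : Env CTerm Γ) : ∀ σ, Vr Γ σ → CTerm σ := e.get Subst.id

theorem Env.raw_nil : (Env.nil : Env (Tm (B := B) []) []).raw = fun _ y => .var y := by
  funext σ y
  cases y
  rfl

theorem Env.wk_bind_raw (t : Tm [] α) (e : Env (Tm []) Γ) (u : Tm Γ τ) :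
    (u.wk α).bind (Env.cons t e).raw = u.bind e.raw := by
  rw [Tm.wk, Tm.bind_ren]
  rfl

theorem Env.weaken_bind_raw (u : Tm [] τ) (e : Env (Tm []) Γ) : (u.weaken Γ).bind e.raw = u := by
  induction e with
  | nil => rw [Env.raw_nil]; exact Tm.bind_var u
  | cons t e ih => exact (Env.wk_bind_raw t e _).trans ih

theorem Env.subst_bind_raw (ν : ∀ τ : Ty B, LVar τ → Tm [] τ) (e : Env (Tm []) Γ) :
    ∀ (σ : Ty B) (y : Vr Γ σ), (y.subst ν).bind e.raw = e.get ν σ y := by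
  induction e with
  | nil =>
    intro σ y
    cases y
    rw [Env.raw_nil, Tm.bind_var]
    rfl
  | cons t e ih =>
    intro σ y
    cases y with
    | zero => rfl
    | succ y => exact (Env.wk_bind_raw _ _ _).trans (ih _ y)

theorem Tm.subst_bind_raw (κ : ∀ τ : Ty B, Con τ → Tm [] τ) (ν : ∀ τ : Ty B, LVar τ → Tm [] τ)
    (t : Tm Γ τ) (e : Env (Tm []) Γ) :
    (t.bind e.raw).subst κ ν = (t.subst κ ν).bind (e.map fun _ t => t.subst κ ν).raw := by
  refine t.subst_bind (fun σ y => ?_) fun _ u => Env.weaken_bind_raw u _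
  rw [Env.subst_bind_raw]
  exact (e.get_map (v := fun _ x => .var (.free x)) (v' := ν) (fun _ t => t.subst κ ν)
    (fun _ _ => rfl) σ y).symm

namespace Term

/-- Replacement of the bound variables by the values in an environment. -/
noncomputable def close (e : Env CTerm Γ) (q : Term Γ τ) : CTerm τ := q.bind e.sub

theorem close_mk (e : Env (Tm []) Γ) (t : Tm Γ τ) :
    (mk t).close (e.map fun _ => mk) = mk (t.bind e.raw) :=
  bind_mk (fun σ y => (Env.get_map (fun _ => mk) (fun _ _ => rfl) e σ y).symm) t

theorem close_nil (q : CTerm τ) : q.close .nil = q := by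
  refine Eq.trans (congrArg q.bind (funext₂ fun σ y => ?_)) q.bind_var
  cases y
  rfl

theorem close_app (e : Env CTerm Γ) (q : Term Γ (.arr α β)) (r : Term Γ α) :
    (app q r).close e = app (q.close e) (r.close e) := by
  induction q using Quot.ind
  induction r using Quot.ind
  rfl

theorem close_inc (e : Env CTerm Γ) (ε : Incl σ τ) (q : Term Γ σ) :
    (inc ε q).close e = inc ε (q.close e) := by
  induction q using Quot.ind
  rfl

theorem close_lcon (e : Env CTerm Γ) (k : LCon τ) : (lcon k : Term Γ τ).close e = lcon k := rfl

theorem app_close_lam (e : Env CTerm Γ) (hα : α.VarTy) (q : Term (α :: Γ) β) (t : CTerm α) :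
    app ((lam hα q).close e) t = q.close (.cons t e) := by
  obtain ⟨e, rfl⟩ := e.exists_map_mk
  induction q using Quot.ind with | mk q =>
  induction t using Quot.ind with | mk t =>
  have close_lam :
      (lam hα (mk q)).close (e.map fun _ => mk) = mk (.lam hα (q.bind (liftSub e.raw α))) :=
    close_mk e (.lam hα q)
  have close_cons :
      (mk q).close (.cons (mk t) (e.map fun _ => mk)) = mk (q.bind (Env.cons t e).raw) :=
    close_mk (.cons t e) q
  change app ((lam hα (mk q)).close _) (mk t) = (mk q).close (.cons (mk t) _)
  rw [close_lam, close_cons]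
  refine (mk_eq_mk.2 (Conv.beta hα _ t)).trans (congrArg mk ?_)
  rw [Tm.bind_bind]
  congr 1
  funext σ y
  cases y with
  | zero => rfl
  | succ y => exact Tm.wk_bind_instSub _ _

theorem subst_close {κ : ConSubst B} {ν : Subst B} (q : Term Γ τ) (e : Env CTerm Γ) :
    (q.close e).subst κ ν = (q.subst κ ν).close (e.map fun _ t => t.subst κ ν) := by
  obtain ⟨e, rfl⟩ := e.exists_map_mk
  induction q using Quot.ind with | mk q =>
  change ((mk q).close _).subst κ ν = ((mk q).subst κ ν).close _
  rw [close_mk]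
  change mk ((q.bind e.raw).subst _ _) = (mk (q.subst _ _)).close _
  have map_mk : ((e.map fun _ => mk).map fun _ t => t.subst κ ν) = (e.map fun _ t =>
      Tm.subst (fun _ c => (κ _ c).out) (fun _ x => (ν _ x).out) t).map fun _ => mk := by
    clear q
    induction e with
    | nil => rfl
    | cons t e ih => simp only [Env.map, ih]; rfl
  rw [map_mk, close_mk, Tm.subst_bind_raw]

theorem close_subst_con (γ : Subst B) (q : Term Γ τ) (e : Env CTerm Γ) :
    (q.subst (fun _ c => con c) γ).close e = q.bind (e.get γ) := by
  obtain ⟨e, rfl⟩ := e.exists_map_mk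
  induction q using Quot.ind with | mk q =>
  change ((mk q).subst _ _).close _ = (mk q).bind _
  have out_get : ∀ σ y, mk (e.get (fun _ x => (γ _ x).out) σ y) =
      (e.map fun _ => mk).get γ σ y := fun σ y =>
    (Env.get_map (fun _ => mk) (fun _ _ => (mk_out _).symm) e σ y).symm
  rw [subst_mk (κ := fun _ c => con c) (κ₀ := fun _ c => .con c) (fun _ _ => rfl)
    fun τ x => mk_out (γ τ x), close_mk,
    Tm.subst_con_eq_bind, Tm.bind_bind, bind_mk out_get]
  simp only [Env.subst_bind_raw]

theorem LevelLE.close {i : ℕ} {q : Term Γ τ} {e : Env CTerm Γ} (hq : q.LevelLE i)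
    (he : ∀ σ (y : Vr Γ σ), y.LevelLE i → (e.sub σ y).LevelLE i) : (q.close e).LevelLE i :=
  hq.bind le_rfl he

theorem apply_renFree (γ : Subst B) (δ : ∀ σ, Vr Γ σ → LVar σ) (q : Term Γ τ) :
    γ.apply (q.renFree δ) = q.bind fun σ y => γ σ (δ σ y) := by
  rw [renFree, Subst.apply, bind_bind]
  congr 1
  funext σ y
  exact Subst.apply_var γ _

end Term

end Environments

section Clauses

variable {B : Type u} {Γ : List (Ty B)}

/-- Simultaneous replacement of the constants and of the logic variables of a clause. -/
noncomputable def Clause.subst (κ : ConSubst B) (ν : Subst B) :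
    ∀ {Γ : List (Ty B)}, Clause Γ → Clause Γ
  | _, .fact A => .fact (A.subst κ ν)
  | _, .rule G A => .rule (G.subst κ ν) (A.subst κ ν)
  | _, .all hα K => .all hα (K.subst κ ν)

/-- The free logic variables of a clause. -/
def Clause.fv : ∀ {Γ : List (Ty B)}, Clause Γ → Set (AVar B)
  | _, .fact A => A.fv
  | _, .rule G A => G.fv ∪ A.fv
  | _, .all _ K => K.fv

theorem Clause.finite_fv (K : Clause Γ) : K.fv.Finite := by
  induction K with
  | fact A => exact A.finite_fv
  | rule G A => exact G.finite_fv.union A.finite_fv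
  | all _ _ ih => exact ih

/-- `InstanceAt T i e K G A`: the body `G` (`none` for a fact) and the head `A` are those of an
instance of the clause `K`, with the values `e` for the variables of its context, and terms of
level at most `i` with constants in `T` for the quantified variables. -/
inductive InstanceAt (T : Set (ACon B)) (i : ℕ) : ∀ {Γ : List (Ty B)}, Env CTerm Γ → Clause Γ →
    Option (CTerm (B := B) .g) → CTerm (B := B) .r → Prop
  | fact {Γ : List (Ty B)} (e : Env CTerm Γ) (A : Term Γ .r) :
      InstanceAt T i e (.fact A) none (A.close e)
  | rule {Γ : List (Ty B)} (e : Env CTerm Γ) (G : Term Γ .g) (A : Term Γ .r) :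
      InstanceAt T i e (.rule G A) (some (G.close e)) (A.close e)
  | all {Γ : List (Ty B)} {e : Env CTerm Γ} {α : Ty B} (hα : α.VarTy) {K : Clause (α :: Γ)}
      {t : CTerm α} {G : Option (CTerm (B := B) .g)} {A : CTerm (B := B) .r} :
      t.LevelLE i → t.oc ⊆ T → InstanceAt T i (.cons t e) K G A → InstanceAt T i e (.all hα K) G A

section Subst

variable {κ : ConSubst B} {ν : Subst B} {i : ℕ}

theorem InElaboration.subst (hκ : ∀ σ (c : Con σ), c.level ≤ i → (κ σ c).LevelLE i)
    (hν : ∀ σ (x : LVar σ), x.level ≤ i → (ν σ x).LevelLE i)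
    {D : Term Γ .p} {K : Clause Γ} (h : InElaboration i D K) :
    InElaboration i (D.subst κ ν) (K.subst κ ν) := by
  induction h with
  | fact hA => rw [Term.subst_inc]; exact .fact (hA.subst hκ hν)
  | rule hG hA =>
    simp only [Term.impP, Term.subst_app, Term.subst_lcon]
    exact .rule (hG.subst hκ hν) (hA.subst hκ hν)
  | left hD _ ih =>
    simp only [Term.andP, Term.subst_app, Term.subst_lcon]
    exact .left (hD.subst hκ hν) ih
  | right hD _ ih =>
    simp only [Term.andP, Term.subst_app, Term.subst_lcon]
    exact .right (hD.subst hκ hν) ih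
  | all hα _ ih =>
    simp only [Term.allP, Term.subst_app, Term.subst_lcon, Term.subst_lam]
    exact .all hα ih

theorem InstanceAt.subst {T T' : Set (ACon B)}
    (hκ : ∀ σ (c : Con σ), c.level ≤ i → (κ σ c).LevelLE i)
    (hν : ∀ σ (x : LVar σ), x.level ≤ i → (ν σ x).LevelLE i)
    (hT : ∀ (τ : Ty B) (q : CTerm τ), q.oc ⊆ T → (q.subst κ ν).oc ⊆ T')
    {e : Env CTerm Γ} {K : Clause Γ} {G : Option (CTerm (B := B) .g)} {A : CTerm (B := B) .r}
    (h : InstanceAt T i e K G A) :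
    InstanceAt T' i (e.map fun _ t => t.subst κ ν) (K.subst κ ν)
      (G.map (Term.subst κ ν)) (A.subst κ ν) := by
  induction h with
  | fact e A => rw [Term.subst_close]; exact .fact _ _
  | rule e G A => rw [Option.map_some, Term.subst_close, Term.subst_close]; exact .rule _ _ _
  | all hα ht hc _ ih => exact .all hα (ht.subst hκ hν) (hT _ _ hc) ih

end Subst

theorem InElaboration.levelLE {i : ℕ} {D : Term Γ .p} {K : Clause Γ} (h : InElaboration i D K) :
    D.LevelLE i := by
  induction h with
  | fact hA => exact hA.inc _
  | rule hG hA => exact ((Term.levelLE_lcon i _).app hG).app hA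
  | left hD _ ih => exact ((Term.levelLE_lcon i _).app ih).app hD
  | right hD _ ih => exact ((Term.levelLE_lcon i _).app hD).app ih
  | all hα _ ih => exact (Term.levelLE_lcon i _).app (ih.lam hα)

theorem InElaboration.levelLE_body {T : Set (ACon B)} {i : ℕ} {D : Term Γ .p} {K : Clause Γ}
    (h : InElaboration i D K) : ∀ {e : Env CTerm Γ} {G : CTerm (B := B) .g} {A : CTerm (B := B) .r},
    (∀ σ (y : Vr Γ σ), y.LevelLE i → (e.sub σ y).LevelLE i) →
      InstanceAt T i e K (some G) A → G.LevelLE i := by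
  induction h with
  | fact _ => intro e G A _ h; cases h
  | rule hG _ => intro e G A he h; cases h; exact hG.close he
  | left _ _ ih => exact ih
  | right _ _ ih => exact ih
  | all hα _ ih =>
    intro e G A he h
    cases h with
    | all _ ht _ h =>
      refine ih (fun σ y hy => ?_) h
      cases y with
      | zero => exact ht
      | succ y => exact he _ y hy

theorem Apart.instanceAt {γ : Subst B} (hγ : γ.Legal) {i : ℕ} {δ : ∀ σ, Vr Γ σ → LVar σ}
    {K : Clause Γ} {ws : List (AVar B)} {G : Option (CTerm (B := B) .g)} {A : CTerm (B := B) .r}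
    (h : Apart δ K ws G A) : ∀ {e : Env CTerm Γ}, (∀ x ∈ ws, x.2.level ≤ i) →
      (∀ σ y, γ σ (δ σ y) = e.get γ σ y) →
      InstanceAt γ.oc i e (K.subst (fun _ c => Term.con c) γ) (G.map γ.apply) (γ.apply A) := by
  induction h with
  | fact δ A =>
    intro e _ h
    simp only [Term.apply_renFree, h, ← Term.close_subst_con]
    exact .fact _ _
  | rule δ G A =>
    intro e _ h
    simp only [Option.map_some, Term.apply_renFree, h, ← Term.close_subst_con]
    exact .rule _ _ _
  | @all Γ δ α hα K w ws G A _ ih =>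
    intro e hws h
    refine .all hα (t := γ α w) (hγ.levelLE (hws _ (List.mem_cons_self ..)))
      (Subst.oc_value_subset γ w) (ih (fun x hx => hws x (List.mem_cons_of_mem _ hx)) ?_)
    intro σ y
    cases y with
    | zero => rfl
    | succ y => exact h σ y

end Clauses

section FreshNames

variable {B : Type u} {α : Ty B}

open Classical in
/-- The family `f` with the value at `x` replaced by `y`. -/
noncomputable def updateAt {ι : Type*} {X : ι → Type*} {Y : ∀ i, X i → Type*} (f : ∀ i x, Y i x)
    {i : ι} (x : X i) (y : Y i x) : ∀ i x, Y i x := fun j z =>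
  Function.update (β := fun a : Sigma X => Y a.1 a.2) (fun a => f a.1 a.2) ⟨i, x⟩ y ⟨j, z⟩

theorem updateAt_self {ι : Type*} {X : ι → Type*} {Y : ∀ i, X i → Type*} (f : ∀ i x, Y i x)
    {i : ι} (x : X i) (y : Y i x) : updateAt f x y i x = y := by
  classical
  exact Function.update_self ..

theorem updateAt_of_ne {ι : Type*} {X : ι → Type*} {Y : ∀ i, X i → Type*} (f : ∀ i x, Y i x)
    {i j : ι} {x : X i} (y : Y i x) {z : X j} (h : (⟨j, z⟩ : Sigma X) ≠ ⟨i, x⟩) :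
    updateAt f x y j z = f j z := by
  classical
  exact Function.update_of_ne (β := fun a : Sigma X => Y a.1 a.2) h ..

theorem Subst.Legal.updateAt {ψ : Subst B} (hψ : ψ.Legal) {w : LVar α} {t : CTerm α}
    (ht : t.LevelLE w.level) : Subst.Legal (updateAt ψ w t) := by
  constructor
  · refine (hψ.1.insert ⟨α, w⟩).subset fun x hx => ?_
    by_contra h
    simp only [Set.mem_insert_iff, not_or] at h
    exact h.2 fun h' => hx ((updateAt_of_ne ψ t h.1).trans h')
  · intro τ x
    by_cases h : (⟨τ, x⟩ : AVar B) = ⟨α, w⟩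
    · cases h
      rw [updateAt_self]
      exact ht
    · rw [updateAt_of_ne ψ t h]
      exact hψ.2 τ x

theorem Subst.oc_updateAt_subset (ψ : Subst B) {w : LVar α} {t : CTerm α} :
    Subst.oc (updateAt ψ w t) ⊆ ψ.oc ∪ t.oc := by
  intro c hc
  obtain ⟨⟨τ, x⟩, -, hc⟩ := Set.mem_iUnion₂.1 hc
  by_cases h : (⟨τ, x⟩ : AVar B) = ⟨α, w⟩
  · cases h
    rw [updateAt_self] at hc
    exact .inr hc
  · simp only [updateAt_of_ne ψ t h] at hc
    exact .inl (oc_value_subset ψ x hc)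

theorem exists_fresh_var {V : Set (AVar B)} (hV : V.Finite) (hα : α.VarTy) (i : ℕ) :
    ∃ w : LVar α, w.level = i ∧ (⟨α, w⟩ : AVar B) ∉ V := by
  have injective : Function.Injective fun n : ℕ => (⟨α, ⟨i, n, hα⟩⟩ : AVar B) := by
    intro n m h
    simpa using h
  obtain ⟨_, ⟨n, rfl⟩, hn⟩ := (Set.infinite_range_of_injective injective).exists_notMem_finite hV
  exact ⟨⟨i, n, hα⟩, rfl, hn⟩

theorem exists_fresh_con {C : Set (ACon B)} (hC : C.Finite) (hα : α.ConTy) (i : ℕ) :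
    ∃ c : Con α, c.level = i ∧ (⟨α, c⟩ : ACon B) ∉ C := by
  have injective : Function.Injective fun n : ℕ => (⟨α, ⟨i, n, hα⟩⟩ : ACon B) := by
    intro n m h
    simpa using h
  obtain ⟨_, ⟨n, rfl⟩, hn⟩ := (Set.infinite_range_of_injective injective).exists_notMem_finite hC
  exact ⟨⟨i, n, hα⟩, rfl, hn⟩

variable {Γ : List (Ty B)}

theorem Clause.exists_apart (K : Clause Γ) (i : ℕ) {V : Set (AVar B)} (hV : V.Finite)
    (δ : ∀ σ, Vr Γ σ → LVar σ) : ∃ ws G A, Apart δ K ws G A ∧ ws.Nodup ∧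
      ∀ x ∈ ws, x ∉ V ∧ x.2.level = i := by
  induction K generalizing V with
  | fact A => exact ⟨_, _, _, .fact δ A, List.nodup_nil, fun _ h => absurd h List.not_mem_nil⟩
  | rule G A => exact ⟨_, _, _, .rule δ G A, List.nodup_nil, fun _ h => absurd h List.not_mem_nil⟩
  | @all Γ α hα K ih =>
    obtain ⟨w, hwi, hwV⟩ := exists_fresh_var hV hα i
    obtain ⟨ws, G, A, hK, hnodup, hws⟩ := ih (hV.insert ⟨α, w⟩) (consVar w δ)
    refine ⟨_, G, A, .all hα w hK, List.nodup_cons.2 ⟨fun hw => ?_, hnodup⟩,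
      List.forall_mem_cons.2 ⟨⟨hwV, hwi⟩, fun x hx => ⟨fun hxV => ?_, (hws x hx).2⟩⟩⟩
    · exact (hws _ hw).1 (Set.mem_insert _ _)
    · exact (hws x hx).1 (Set.mem_insert_of_mem _ hxV)

theorem InstanceAt.exists_legal_of_apart {T : Set (ACon B)} {i : ℕ} {e : Env CTerm Γ}
    {K : Clause Γ} {G G' : Option (CTerm (B := B) .g)} {A A' : CTerm (B := B) .r}
    (h : InstanceAt T i e K G A) : ∀ {δ : ∀ σ, Vr Γ σ → LVar σ} {ws : List (AVar B)} {ψ : Subst B},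
      Apart δ K ws G' A' → ws.Nodup → (∀ x ∈ ws, x.2.level = i) → ψ.Legal →
      (∀ σ (y : Vr Γ σ), y.Over K.fv → (⟨σ, δ σ y⟩ : AVar B) ∉ ws ∧ ψ σ (δ σ y) = e.sub σ y) →
      ∃ ψ' : Subst B, ψ'.Legal ∧ (∀ x ∉ ws, ψ' x.1 x.2 = ψ x.1 x.2) ∧ ψ'.oc ⊆ ψ.oc ∪ T ∧
        ψ'.apply A' = A ∧ G'.map ψ'.apply = G := by
  induction h with
  | fact e A =>
    rintro δ _ ψ ⟨⟩ - - hψ h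
    refine ⟨ψ, hψ, fun _ _ => rfl, Set.subset_union_left, ?_, rfl⟩
    exact (Term.apply_renFree ..).trans (A.over_fv.bind_congr fun σ y hy => (h σ y hy).2)
  | rule e G A =>
    rintro δ _ ψ ⟨⟩ - - hψ h
    refine ⟨ψ, hψ, fun _ _ => rfl, Set.subset_union_left, ?_, congrArg some ?_⟩
    · exact (Term.apply_renFree ..).trans
        (A.over_fv.bind_congr fun σ y hy => (h σ y fun x hx => .inr (hy x hx)).2)
    · exact (Term.apply_renFree ..).trans
        (G.over_fv.bind_congr fun σ y hy => (h σ y fun x hx => .inl (hy x hx)).2)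
  | @all Γ e α hα K t G A ht hT _ ih =>
    rintro δ _ ψ (_ | _ | ⟨_, w, hK⟩) hnodup hlevel hψ h
    rename_i ws
    obtain ⟨hw, hnodup⟩ := List.nodup_cons.1 hnodup
    obtain ⟨hwi, hlevel⟩ := List.forall_mem_cons.1 hlevel
    obtain ⟨ψ', hψ', heq, hoc, hA, hG⟩ := ih hK hnodup hlevel
      (hψ.updateAt (w := w) (hwi.symm ▸ ht)) fun σ y hy => by
        cases y with
        | zero => exact ⟨hw, updateAt_self ..⟩
        | succ y =>
          obtain ⟨hyws, hψy⟩ := h σ y hy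
          exact ⟨fun hy' => hyws (List.mem_cons_of_mem _ hy'),
            (updateAt_of_ne ψ t fun hyw => hyws (hyw ▸ List.mem_cons_self ..)).trans hψy⟩
    refine ⟨ψ', hψ', fun x hx => ?_, hoc.trans (Set.union_subset
      (ψ.oc_updateAt_subset.trans (Set.union_subset_union_right _ hT)) Set.subset_union_right),
      hA, hG⟩
    simp only [List.mem_cons, not_or] at hx
    exact (heq x hx.2).trans (updateAt_of_ne ψ t hx.1)

theorem InstanceAt.exists_unifier {T : Set (ACon B)} {i : ℕ} {K : Clause []}
    {G : Option (CTerm (B := B) .g)} {A : CTerm (B := B) .r} (h : InstanceAt T i .nil K G A)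
    {V : Set (AVar B)} (hV : V.Finite) :
    ∃ (ws : List (AVar B)) (G' : Option (CTerm .g)) (A' : CTerm .r) (ψ : Subst B),
      Apart freeVar K ws G' A' ∧ ws.Nodup ∧ (∀ x ∈ ws, x ∉ V ∧ x.2.level ≤ i) ∧ ψ.Legal ∧
        (∀ x ∈ V, ψ x.1 x.2 = Subst.id x.1 x.2) ∧ ψ.oc ⊆ T ∧ ψ.apply A = ψ.apply A' ∧
          G'.map ψ.apply = G := by
  obtain ⟨ws, G', A', apart, nodup, fresh⟩ :=
    K.exists_apart i ((hV.union A.finite_fv).union K.finite_fv) freeVar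
  obtain ⟨ψ, legal, fix, oc_subset, hA, hG⟩ :=
    h.exists_legal_of_apart apart nodup (fun x hx => (fresh x hx).2) Subst.legal_id
      fun σ y hy => by
        cases y
        exact ⟨fun hx => (fresh _ hx).1 (.inr (hy _ rfl)), rfl⟩
  rw [Subst.oc_id, Set.empty_union] at oc_subset
  refine ⟨ws, G', A', ψ, apart, nodup, fun x hx => ⟨fun hxV => (fresh x hx).1 (.inl (.inl hxV)),
    (fresh x hx).2.le⟩, legal, fun x hx => fix x fun hw => (fresh x hw).1 (.inl (.inl hx)),
    oc_subset, ?_, hG⟩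
  rw [hA]
  exact Subst.apply_eq_self fun x hx => fix x fun hw => (fresh x hw).1 (.inl (.inr hx))

end FreshNames

section States

variable {B : Type u}

/-- Simultaneous replacement of the constants and of the logic variables of a state. -/
noncomputable def State.subst (κ : ConSubst B) (ν : Subst B) (s : State B) : State B :=
  ⟨s.idx, s.prog.map fun D => D.subst κ ν, s.goal.subst κ ν⟩

/-- The free logic variables of a state. -/
def State.fv (s : State B) : Set (AVar B) := {x | (∃ D ∈ s.prog, x ∈ D.fv) ∨ x ∈ s.goal.fv}

namespace State

theorem apply_eq_subst (θ : Subst B) : State.apply θ = State.subst (fun _ c => Term.con c) θ := by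
  funext s
  simp only [State.apply, State.subst, Subst.apply_eq_subst]
  congr 1
  exact congrArg (fun f => List.map f s.prog) (funext fun D => Subst.apply_eq_subst θ D)

theorem apply_id (s : State B) : s.apply Subst.id = s := by
  have h : (Subst.id : Subst B).apply (τ := .p) = _root_.id := funext Subst.apply_id
  rw [State.apply, Subst.apply_id, h, List.map_id]

theorem subst_id (s : State B) : s.subst (fun _ c => Term.con c) Subst.id = s := by
  rw [← apply_eq_subst, apply_id]

theorem apply_comp (θ γ : Subst B) (s : State B) :
    s.apply (θ.comp γ) = (s.apply θ).apply γ := by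
  simp only [State.apply, Subst.apply_comp, List.map_map]
  congr 2
  exact funext fun D => Subst.apply_comp θ γ D

theorem apply_congr {θ θ' : Subst B} {s : State B}
    (h : ∀ x ∈ s.fv, θ x.1 x.2 = θ' x.1 x.2) : s.apply θ = s.apply θ' := by
  simp only [State.apply]
  congr 1
  · exact List.map_congr_left fun D hD => Subst.apply_congr D fun x hx => h x (.inl ⟨D, hD, hx⟩)
  · exact Subst.apply_congr _ fun x hx => h x (.inr hx)

theorem apply_eq_self {θ : Subst B} {s : State B}
    (h : ∀ x ∈ s.fv, θ x.1 x.2 = Subst.id x.1 x.2) : s.apply θ = s :=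
  (apply_congr h).trans s.apply_id

theorem Valid.apply {θ : Subst B} (hθ : θ.Legal) {s : State B} (hs : s.Valid) :
    (s.apply θ).Valid :=
  ⟨List.forall_mem_map.2 fun D hD => hθ.apply (hs.1 D hD), hθ.apply hs.2⟩

end State

namespace StateVector

theorem apply_append (θ : Subst B) (L R : StateVector B) :
    apply θ (L ++ R) = apply θ L ++ apply θ R := List.map_append

theorem apply_append_cons (θ : Subst B) (L R : StateVector B) (s : State B) :
    apply θ (L ++ s :: R) = apply θ L ++ s.apply θ :: apply θ R := List.map_append

theorem apply_id (A : StateVector B) : A.apply Subst.id = A :=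
  (List.map_congr_left fun s _ => State.apply_id s).trans (List.map_id A)

theorem apply_comp (θ γ : Subst B) (A : StateVector B) :
    A.apply (θ.comp γ) = (A.apply θ).apply γ := by
  simp only [apply, List.map_map]
  exact List.map_congr_left fun s _ => State.apply_comp θ γ s

theorem apply_congr {θ θ' : Subst B} {A : StateVector B}
    (h : ∀ x ∈ A.fv, θ x.1 x.2 = θ' x.1 x.2) : A.apply θ = A.apply θ' :=
  List.map_congr_left fun s hs => State.apply_congr fun x hx => h x ⟨s, hs, hx⟩

theorem apply_eq_self {θ : Subst B} {A : StateVector B}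
    (h : ∀ x ∈ A.fv, θ x.1 x.2 = Subst.id x.1 x.2) : A.apply θ = A :=
  (apply_congr h).trans A.apply_id

theorem fv_append_cons (L R : StateVector B) (s : State B) :
    fv (L ++ s :: R) = L.fv ∪ (s.fv ∪ R.fv) := by
  ext x
  simp only [fv, State.fv, List.mem_append, List.mem_cons, Set.mem_union, Set.mem_ofPred_eq,
    or_and_right, exists_or, exists_eq_left]

theorem apply_restrict (θ : Subst B) (A : StateVector B) : A.apply (θ.restrict A.fv) = A.apply θ :=
  apply_congr fun _ hx => Subst.restrict_of_mem hx

theorem Valid.apply {θ : Subst B} (hθ : θ.Legal) {A : StateVector B} (hA : A.Valid) :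
    (A.apply θ).Valid :=
  List.forall_mem_map.2 fun s hs => (hA s hs).apply hθ

theorem finite_fv (A : StateVector B) : A.fv.Finite := by
  have h : A.fv = ⋃ s ∈ {s | s ∈ A}, ((⋃ D ∈ {D | D ∈ s.prog}, D.fv) ∪ s.goal.fv) := by
    ext x
    simp only [fv, Set.mem_ofPred_eq, Set.mem_iUnion, Set.mem_union, exists_prop]
  rw [h]
  exact A.finite_toSet.biUnion fun s _ =>
    (s.prog.finite_toSet.biUnion fun D _ => D.finite_fv).union s.goal.finite_fv

theorem finite_oc (A : StateVector B) : A.oc.Finite := by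
  have h : A.oc = ⋃ s ∈ {s | s ∈ A}, ((⋃ D ∈ {D | D ∈ s.prog}, D.oc) ∪ s.goal.oc) := by
    ext x
    simp only [oc, Set.mem_ofPred_eq, Set.mem_iUnion, Set.mem_union, exists_prop]
  rw [h]
  exact A.finite_toSet.biUnion fun s _ =>
    (s.prog.finite_toSet.biUnion fun D _ => D.finite_oc).union s.goal.finite_oc

theorem oc_apply_subset (θ : Subst B) (A : StateVector B) : (A.apply θ).oc ⊆ A.oc ∪ θ.oc := by
  rintro c ⟨s, hs, hc⟩
  obtain ⟨s', hs', rfl⟩ := List.mem_map.1 hs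
  by_contra h
  simp only [Set.mem_union, not_or] at h
  have mem_of_mem_apply {τ : Ty B} (q : CTerm τ) (hq : c ∈ (θ.apply q).oc) : c ∈ q.oc :=
    (Subst.oc_apply_subset θ q hq).resolve_right h.2
  refine h.1 ⟨s', hs', hc.imp ?_ (mem_of_mem_apply _)⟩
  rintro ⟨D, hD, hc⟩
  obtain ⟨D', hD', rfl⟩ := List.mem_map.1 hD
  exact ⟨D', hD', mem_of_mem_apply _ hc⟩

end StateVector

end States

section DirectSteps

variable {B : Type u}

/-- Resolution steps on a single state that need no unification: `DirectStep T s ss K` replaces the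
state `s` by the states `ss`, introducing the constants `K`; clauses are instantiated with terms
whose constants belong to `T`. -/
inductive DirectStep (T : Set (ACon B)) : State B → List (State B) → Set (ACon B) → Prop
  | stay (s : State B) : DirectStep T s [s] ∅
  | null (i : ℕ) (P : List (CTerm (B := B) .p)) : DirectStep T ⟨i, P, Term.topG⟩ [] ∅
  | clause (i : ℕ) (P : List (CTerm (B := B) .p)) {A : CTerm (B := B) .r}
      {D : CTerm (B := B) .p} {K : Clause []} {G : Option (CTerm (B := B) .g)} :
      A.LevelLE i → D ∈ P → InElaboration i D K → InstanceAt T i .nil K G A →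
      DirectStep T ⟨i, P, Term.rigid A⟩ (G.toList.map fun G => ⟨i, P, G⟩) ∅
  | orLeft (i : ℕ) (P : List (CTerm (B := B) .p)) {G G' : CTerm (B := B) .g} :
      G.LevelLE i → G'.LevelLE i → DirectStep T ⟨i, P, Term.orG G G'⟩ [⟨i, P, G⟩] ∅
  | orRight (i : ℕ) (P : List (CTerm (B := B) .p)) {G G' : CTerm (B := B) .g} :
      G.LevelLE i → G'.LevelLE i → DirectStep T ⟨i, P, Term.orG G G'⟩ [⟨i, P, G'⟩] ∅
  | and (i : ℕ) (P : List (CTerm (B := B) .p)) {G G' : CTerm (B := B) .g} :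
      G.LevelLE i → G'.LevelLE i →
      DirectStep T ⟨i, P, Term.andG G G'⟩ [⟨i, P, G⟩, ⟨i, P, G'⟩] ∅
  | instance_ (i : ℕ) (P : List (CTerm (B := B) .p)) {α : Ty B} (hα : α.VarTy) {G : Term [α] .g}
      {t : CTerm α} : G.LevelLE i → t.LevelLE i →
      DirectStep T ⟨i, P, Term.exG hα G⟩ [⟨i, P, G.inst t⟩] ∅
  | augment (i : ℕ) (P : List (CTerm (B := B) .p)) {D : CTerm (B := B) .p}
      {G : CTerm (B := B) .g} : D.LevelLE i → G.LevelLE i →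
      DirectStep T ⟨i, P, Term.impG D G⟩ [⟨i, P ++ [D], G⟩] ∅
  | generic (i : ℕ) (P : List (CTerm (B := B) .p)) {α : Ty B} (hα : α.VarTy) {G : Term [α] .g}
      {c : Con α} : (∀ D ∈ P, D.LevelLE i) → G.LevelLE i → c.level = i + 1 →
      DirectStep T ⟨i, P, Term.allG hα G⟩ [⟨i + 1, P, G.inst (Term.con c)⟩] {⟨α, c⟩}

namespace DirectStep

variable {T T' K : Set (ACon B)} {s : State B} {ss : List (State B)} {ν : Subst B}

theorem subst {f : ∀ τ : Ty B, Con τ → Con τ} (h : DirectStep T s ss K)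
    (hf : ∀ τ c, (f τ c).level = c.level) (hν : ∀ τ x, (ν τ x).LevelLE x.level)
    (hT : ∀ (τ : Ty B) (q : CTerm τ), q.oc ⊆ T →
      (q.subst (fun _ c => Term.con (f _ c)) ν).oc ⊆ T') :
    DirectStep T' (s.subst (fun _ c => Term.con (f _ c)) ν)
      (ss.map (State.subst (fun _ c => Term.con (f _ c)) ν))
      ((fun c => ⟨c.1, f c.1 c.2⟩) '' K) := by
  have levelLE_con (i : ℕ) (σ : Ty B) (c : Con σ) (hc : c.level ≤ i) :
      (Term.con (f σ c) : CTerm σ).LevelLE i := Term.levelLE_con ((hf σ c).trans_le hc)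
  have levelLE_var (i : ℕ) (σ : Ty B) (x : LVar σ) (hx : x.level ≤ i) : (ν σ x).LevelLE i :=
    (hν σ x).mono hx
  have levelLE {Γ : List (Ty B)} {τ : Ty B} {i : ℕ} {q : Term Γ τ} (hq : q.LevelLE i) :=
    hq.subst (levelLE_con i) (levelLE_var i)
  cases h <;> simp only [State.subst, Set.image_empty, Set.image_singleton, List.map_cons,
    List.map_nil, List.map_map, Term.rigid, Term.topG, Term.orG, Term.andG,
    Term.exG, Term.impG, Term.allG, Term.subst_app, Term.subst_lcon, Term.subst_inc,
    Term.subst_lam, Term.subst_inst, Term.subst_con, List.map_append]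
  case stay => exact .stay _
  case null i P => exact .null i _
  case clause i P A D K G hA hD hK hI =>
    have clause_instance := hI.subst (levelLE_con i) (levelLE_var i) hT
    have step := clause i _ (levelLE hA) (List.mem_map_of_mem hD)
      (hK.subst (levelLE_con i) (levelLE_var i)) clause_instance
    rwa [Option.toList_map, List.map_map] at step
  case orLeft i P G G' hG hG' => exact .orLeft i _ (levelLE hG) (levelLE hG')
  case orRight i P G G' hG hG' => exact .orRight i _ (levelLE hG) (levelLE hG')
  case and i P G G' hG hG' => exact .and i _ (levelLE hG) (levelLE hG')
  case instance_ i P α hα G t hG ht => exact .instance_ i _ hα (levelLE hG) (levelLE ht)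
  case augment i P D G hD hG => exact .augment i _ (levelLE hD) (levelLE hG)
  case generic i P α hα G c hP hG hc =>
    exact .generic i _ hα (List.forall_mem_map.2 fun D hD => levelLE (hP D hD)) (levelLE hG)
      ((hf _ _).trans hc)

theorem apply (h : DirectStep T s ss K) (hν : ν.Legal)
    (hT : ∀ (τ : Ty B) (q : CTerm τ), q.oc ⊆ T → (ν.apply q).oc ⊆ T') :
    DirectStep T' (s.apply ν) (ss.map (State.apply ν)) K := by
  have step := h.subst (f := fun _ c => c) (fun _ _ => rfl) hν.2 fun τ q hq => by
    rw [← Subst.apply_eq_subst]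
    exact hT τ q hq
  rwa [Set.image_id', ← State.apply_eq_subst] at step

theorem valid (h : DirectStep T s ss K) (hs : s.Valid) : ∀ s' ∈ ss, s'.Valid := by
  cases h with
  | stay => exact List.forall_mem_singleton.2 hs
  | null i P => exact List.forall_mem_nil _
  | @clause i P A D K G hA hD hK hI =>
    refine List.forall_mem_map.2 fun G hG => ⟨hs.1, ?_⟩
    obtain rfl := Option.mem_toList.1 hG
    refine hK.levelLE_body (fun σ y hy => ?_) hI
    cases y
    exact Term.levelLE_var hy
  | orLeft i P hG hG' => exact List.forall_mem_singleton.2 ⟨hs.1, hG⟩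
  | orRight i P hG hG' => exact List.forall_mem_singleton.2 ⟨hs.1, hG'⟩
  | and i P hG hG' =>
    exact List.forall_mem_cons.2 ⟨⟨hs.1, hG⟩, List.forall_mem_singleton.2 ⟨hs.1, hG'⟩⟩
  | instance_ i P hα hG ht => exact List.forall_mem_singleton.2 ⟨hs.1, hG.inst ht⟩
  | augment i P hD hG =>
    exact List.forall_mem_singleton.2
      ⟨List.forall_mem_append.2 ⟨hs.1, List.forall_mem_singleton.2 hD⟩, hG⟩
  | generic i P hα hP hG hc =>
    exact List.forall_mem_singleton.2 ⟨fun D hD => (hs.1 D hD).mono (Nat.le_succ i),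
      (hG.mono (Nat.le_succ i)).inst (Term.levelLE_con hc.le)⟩

theorem of_apart {γ : Subst B} (hγ : γ.Legal) (i : ℕ) {P : List (CTerm (B := B) .p)}
    {A' A : CTerm (B := B) .r} {D : CTerm (B := B) .p} {K : Clause []} {ws : List (AVar B)}
    {G : Option (CTerm (B := B) .g)} (hA' : A'.LevelLE i) (hD : D ∈ P)
    (hK : InElaboration i D K) (hG : Apart freeVar K ws G A) (hws : ∀ x ∈ ws, x.2.level ≤ i)
    (hA : γ.apply A' = γ.apply A) :
    DirectStep γ.oc (State.apply γ ⟨i, P, Term.rigid A'⟩)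
      (G.toList.map fun G => State.apply γ ⟨i, P, G⟩) ∅ := by
  have elaboration : InElaboration i (γ.apply D) (K.subst (fun _ c => Term.con c) γ) := by
    rw [Subst.apply_eq_subst]
    exact hK.subst (fun _ _ => Term.levelLE_con) fun _ _ => hγ.levelLE
  have clause_instance : InstanceAt γ.oc i .nil (K.subst (fun _ c => Term.con c) γ)
      (G.map γ.apply) (γ.apply A') := by
    rw [hA]
    refine hG.instanceAt hγ hws fun σ y => ?_
    cases y
    rfl
  have step := clause i _ (hγ.apply hA') (List.mem_map_of_mem hD) elaboration clause_instance
  rw [Option.toList_map, List.map_map] at step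
  have apply_rigid : γ.apply (Term.rigid A') = Term.rigid (γ.apply A') := by
    simp only [Term.rigid, Subst.apply_eq_subst, Term.subst_inc]
  rwa [State.apply, apply_rigid]

end DirectStep

namespace Step

variable {ρ : Rule} {V W : Set (AVar B)} {C K : Set (ACon B)} {A A' : StateVector B} {γ : Subst B}

theorem legal (h : Step ρ V C A γ A' W K) : γ.Legal := by
  cases h <;> first | assumption | exact Subst.legal_id

theorem finite (h : Step ρ V C A γ A' W K) : W.Finite ∧ K.Finite := by
  cases h <;>
    first
    | exact ⟨Set.finite_empty, Set.finite_empty⟩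
    | exact ⟨Set.finite_empty, Set.finite_singleton _⟩
    | exact ⟨List.finite_toSet _, Set.finite_empty⟩

theorem disjoint (h : Step ρ V C A γ A' W K) : Disjoint K C := by
  cases h <;> simp only [Set.empty_disjoint, Set.disjoint_singleton_left]
  assumption

theorem eq_empty_of_ne_generic (h : Step ρ V C A γ A' W K) (hρ : ρ ≠ .generic) : K = ∅ := by
  cases h <;> first | rfl | exact absurd rfl hρ

theorem eq_empty_or_eq_id (h : Step ρ V C A γ A' W K) : K = ∅ ∨ γ = Subst.id := by
  cases h <;> first | exact .inl rfl | exact .inr rfl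

theorem ne_nil (h : Step ρ V C A γ A' W K) : A ≠ [] := by
  cases h <;> exact List.append_ne_nil_of_right_ne_nil _ (List.cons_ne_nil _ _)

theorem exists_directStep (h : Step ρ V C A γ A' W K) (hA : A.Valid) :
    ∃ (L R : StateVector B) (s : State B) (ss : List (State B)),
      A.apply γ = L ++ s :: R ∧ A' = L ++ (ss ++ R) ∧ DirectStep γ.oc s ss K := by
  have apply_id := @StateVector.apply_id B
  have apply_append_cons := @StateVector.apply_append_cons B γ
  cases h with
  | null L R i P => exact ⟨L, R, _, _, apply_id _, rfl, .null i P⟩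
  | @true _ _ L R i P G _ _ _ _ hG =>
    refine ⟨_, _, _, [⟨i, P.map γ.apply, Term.topG⟩], apply_append_cons L R _, rfl, ?_⟩
    rw [State.apply, hG]
    exact .stay _
  | backchain L R i P hA' hD hK hG _ hws hγ hA =>
    exact ⟨_, _, _, _, apply_append_cons L R _, rfl,
      .of_apart hγ i hA' hD hK hG (fun x hx => (hws x hx).2) hA⟩
  | axm L R i P hA' hD hK hG _ hws hγ hA =>
    exact ⟨_, _, _, _, apply_append_cons L R _, rfl,
      .of_apart hγ i hA' hD hK hG (fun x hx => (hws x hx).2) hA⟩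
  | orLeft L R i P hG hG' => exact ⟨L, R, _, _, apply_id _, rfl, .orLeft i P hG hG'⟩
  | orRight L R i P hG hG' => exact ⟨L, R, _, _, apply_id _, rfl, .orRight i P hG hG'⟩
  | and L R i P hG hG' => exact ⟨L, R, _, _, apply_id _, rfl, .and i P hG hG'⟩
  | instance_ L R i P hα hG ht => exact ⟨L, R, _, _, apply_id _, rfl, .instance_ i P hα hG ht⟩
  | augment L R i P hD hG => exact ⟨L, R, _, _, apply_id _, rfl, .augment i P hD hG⟩
  | generic L R i P hα hG hc _ =>
    have levelLE_prog := (hA _ (List.mem_append_right L (List.mem_cons_self ..))).1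
    exact ⟨L, R, _, _, apply_id _, rfl, .generic i P hα levelLE_prog hG hc⟩
  | sub L R i P G hγ => exact ⟨_, _, _, _, apply_append_cons L R _, rfl, .stay _⟩

theorem valid (h : Step ρ V C A γ A' W K) (hA : A.Valid) : A'.Valid := by
  obtain ⟨L, R, s, ss, hAγ, rfl, hs⟩ := h.exists_directStep hA
  have valid := hA.apply h.legal
  rw [hAγ] at valid
  obtain ⟨hL, valid⟩ := List.forall_mem_append.1 valid
  obtain ⟨valid_s, hR⟩ := List.forall_mem_cons.1 valid
  exact List.forall_mem_append.2 ⟨hL, List.forall_mem_append.2 ⟨hs.valid valid_s, hR⟩⟩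

end Step

end DirectSteps

section Resolutions

variable {B : Type u} {S : Set Rule} {A A' : StateVector B} {θ η : Subst B} {V : Set (AVar B)}
  {C N : Set (ACon B)}

namespace Res

theorem finite (h : Res S A η A' V C N) : V.Finite ∧ C.Finite := by
  induction h with
  | refl => exact ⟨A.finite_fv, A.finite_oc⟩
  | step _ _ hs ih =>
    exact ⟨((ih.1.union hs.finite.1).union hs.legal.finite_fv).union (StateVector.finite_fv _),
      ((ih.2.union hs.finite.2).union hs.legal.finite_oc).union (StateVector.finite_oc _)⟩

theorem fv_subset (h : Res S A η A' V C N) : A'.fv ⊆ V := by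
  cases h with
  | refl => exact subset_rfl
  | step => exact Set.subset_union_right

theorem oc_subset (h : Res S A η A' V C N) : A'.oc ⊆ C := by
  cases h with
  | refl => exact subset_rfl
  | step => exact Set.subset_union_right

theorem start_fv_subset (h : Res S A η A' V C N) : A.fv ⊆ V := by
  induction h with
  | refl => exact subset_rfl
  | step _ _ _ ih => exact fun x hx => .inl (.inl (.inl (ih hx)))

theorem legal (h : Res S A η A' V C N) : η.Legal := by
  induction h with
  | refl => exact Subst.legal_id
  | step _ _ hs ih => exact ih.comp hs.legal

theorem valid (h : Res S A η A' V C N) (hA : A.Valid) : A'.Valid := by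
  induction h with
  | refl => exact hA
  | step _ _ hs ih => exact hs.valid ih

theorem value_of_notMem (h : Res S A η A' V C N) : ∀ x ∉ V, η x.1 x.2 = Subst.id x.1 x.2 := by
  induction h with
  | refl => exact fun _ _ => rfl
  | step _ _ _ ih =>
    intro x hx
    simp only [Set.mem_union, not_or] at hx
    rw [Subst.comp, ih x hx.1.1.1, Subst.id, Subst.apply_var]
    exact not_not.1 fun h => hx.1.2 (.inl h)

theorem fv_value_subset (h : Res S A η A' V C N) : ∀ x ∈ V, (η x.1 x.2).fv ⊆ V := by
  induction h with
  | refl =>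
    intro x hx z hz
    rw [Set.mem_singleton_iff.1 (Term.fv_var_subset x.2 hz)]
    exact hx
  | @step η γ A' A'' V W C N _ _ hr _ _ ih =>
    intro x hx z hz
    by_cases hxV : x ∈ V
    · rcases Subst.fv_apply_subset γ _ hz with hz | hz
      · exact .inl (.inr hz)
      · exact .inl (.inl (.inl (ih x hxV hz)))
    · rw [Subst.comp, hr.value_of_notMem x hxV, Subst.id, Subst.apply_var] at hz
      rcases Subst.fv_value_subset γ _ hz with hz | hz
      · exact .inl (.inr hz)
      · rw [Set.mem_singleton_iff.1 hz]
        exact hx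

theorem eq_nil (h : Res S [] η A' V C N) : A' = [] := by
  induction h with
  | refl => rfl
  | step _ _ hs ih => exact absurd ih hs.ne_nil

theorem backward {Q : State B → Prop}
    (hQ : ∀ s ss K, DirectStep Set.univ s ss K → .generic ∈ S ∨ K = ∅ → (∀ s' ∈ ss, Q s') → Q s)
    (h : Res S A η A' V C N) (hA : A.Valid) : ∀ {ζ : Subst B}, ζ.Legal →
      (∀ s ∈ A'.apply ζ, Q s) → ∀ s ∈ A.apply (η.comp ζ), Q s := by
  induction h with
  | refl =>
    intro ζ _ h
    rwa [Subst.id_comp]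
  | @step η γ A' A'' V W C N K ρ hr hρ hs ih =>
    intro ζ hζ h
    rw [Subst.comp_assoc]
    refine ih (hs.legal.comp hζ) ?_
    obtain ⟨L, R, s, ss, hγ, rfl, direct⟩ := hs.exists_directStep (hr.valid hA)
    rw [StateVector.apply_append, StateVector.apply_append] at h
    rw [StateVector.apply_comp, hγ, StateVector.apply_append_cons]
    simp only [List.forall_mem_append, List.forall_mem_cons] at h ⊢
    refine ⟨h.1, hQ _ _ _ (direct.apply hζ fun _ _ _ => Set.subset_univ _) ?_ h.2.1, h.2.2⟩
    by_cases generic : ρ = .generic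
    · exact .inl (generic ▸ hρ)
    · exact .inr (hs.eq_empty_of_ne_generic generic)

end Res

theorem Derives.backward {Q : State B → Prop}
    (hQ : ∀ s ss K, DirectStep Set.univ s ss K → .generic ∈ S ∨ K = ∅ → (∀ s' ∈ ss, Q s') → Q s)
    (hA : A.Valid) (h : Derives S A θ A') (hA' : ∀ s ∈ A', Q s) : ∀ s ∈ A.apply θ, Q s := by
  obtain ⟨N, η, V, C, hr, rfl⟩ := h
  rw [StateVector.apply_restrict, ← Subst.comp_id η]
  refine hr.backward hQ hA Subst.legal_id ?_
  rwa [StateVector.apply_id]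

end Resolutions

section Simulation

variable {B : Type u} {S : Set Rule} {A A' : StateVector B} {θ η ψ γ : Subst B} {V : Set (AVar B)}
  {C C' N K T : Set (ACon B)}

/-- There is a resolution from `A` to `A'` by rules in `S` whose substitutions compose to one that
agrees with `θ` on the free variables of `A`; all constants occurring in it belong to `C`, and its
generic steps introduce the constants `N`. -/
def DerivesWithin (S : Set Rule) (A : StateVector B) (θ : Subst B) (A' : StateVector B)
    (C N : Set (ACon B)) : Prop :=
  ∃ (η : Subst B) (V : Set (AVar B)) (C' : Set (ACon B)), Res S A η A' V C' N ∧ C' ⊆ C ∧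
    ∀ x ∈ A.fv, η x.1 x.2 = θ x.1 x.2

theorem Derives.exists_derivesWithin (h : Derives S A (θ.restrict A.fv) A') :
    ∃ C N, C.Finite ∧ DerivesWithin S A θ A' C N :=
  let ⟨N, η, V, C, hr, eq⟩ := h
  ⟨C, N, hr.finite.2, η, V, C, hr, subset_rfl,
    fun x hx => (Subst.restrict_eq_restrict_iff.1 eq x hx).symm⟩

theorem DerivesWithin.derives (h : DerivesWithin S A θ A' C N) :
    Derives S A (θ.restrict A.fv) A' :=
  let ⟨η, V, C', hr, _, eq⟩ := h
  ⟨N, η, V, C', hr, Subst.restrict_eq_restrict_iff.2 fun x hx => (eq x hx).symm⟩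

theorem Res.derivesWithin_step {ρ : Rule} {A'' : StateVector B} {W : Set (AVar B)}
    (h : Res S A η A' V C N) (hρ : ρ ∈ S) (hs : Step ρ V C A' γ A'' W K)
    (hγ : ∀ x ∈ V, γ x.1 x.2 = Subst.id x.1 x.2) :
    DerivesWithin S A η A'' (C ∪ K ∪ γ.oc ∪ A''.oc) (N ∪ K) :=
  ⟨_, _, _, .step h hρ hs, subset_rfl, fun x hx => Subst.apply_eq_self fun z hz =>
    hγ z (h.fv_value_subset x (h.start_fv_subset hx) hz)⟩

theorem Step.exists_of_apart (L R : StateVector B) (i : ℕ) {P : List (CTerm (B := B) .p)}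
    {H H' : CTerm (B := B) .r} {D : CTerm (B := B) .p} {K' : Clause []} {ws : List (AVar B)}
    {G : Option (CTerm (B := B) .g)} (hH' : H'.LevelLE i) (hD : D ∈ P) (hK : InElaboration i D K')
    (apart : Apart freeVar K' ws G H) (nodup : ws.Nodup)
    (fresh : ∀ x ∈ ws, x ∉ V ∧ x.2.level ≤ i) (legal : ψ.Legal) (unify : ψ.apply H' = ψ.apply H) :
    ∃ ρ ∈ ordinary, Step ρ V C (L ++ ⟨i, P, Term.rigid H'⟩ :: R) ψ
      (L.apply ψ ++ ((G.map ψ.apply).toList.map (fun G => ⟨i, P.map ψ.apply, G⟩) ++ R.apply ψ))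
      {x | x ∈ ws} ∅ := by
  cases G with
  | none => exact ⟨.axm, nofun, .axm L R i P hH' hD hK apart nodup fresh legal unify⟩
  | some G =>
    exact ⟨.backchain, nofun, .backchain L R i P hH' hD hK apart nodup fresh legal unify⟩

theorem DirectStep.exists_step {L R : StateVector B} {s : State B} {ss : List (State B)}
    (h : DirectStep T s ss K) (hV : V.Finite) (hfv : StateVector.fv (L ++ s :: R) ⊆ V)
    (hK : Disjoint K C) : (ss = [s] ∧ K = ∅) ∨ ∃ ρ ∈ ordinary, ∃ ψ W,
      Step ρ V C (L ++ s :: R) ψ (L ++ (ss ++ R)) W K ∧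
        (∀ x ∈ V, ψ x.1 x.2 = Subst.id x.1 x.2) ∧ ψ.oc ⊆ T := by
  have of_step_id {ρ : Rule} {A' : StateVector B} {W : Set (AVar B)}
      (h : Step ρ V C (L ++ s :: R) Subst.id A' W K) (hρ : ρ ≠ .sub) : ∃ ρ ∈ ordinary, ∃ ψ W,
        Step ρ V C (L ++ s :: R) ψ A' W K ∧
          (∀ x ∈ V, ψ x.1 x.2 = Subst.id x.1 x.2) ∧ ψ.oc ⊆ T :=
    ⟨ρ, hρ, _, _, h, fun _ _ => rfl, Subst.oc_id.trans_subset (Set.empty_subset T)⟩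
  cases h with
  | stay => exact .inl ⟨rfl, rfl⟩
  | null i P => exact .inr (of_step_id (.null L R i P) nofun)
  | @clause i P H D K' G hH hD hK' hI =>
    obtain ⟨ws, G', H', ψ, apart, nodup, fresh, legal, fix, oc_subset, unify, rfl⟩ :=
      hI.exists_unifier hV
    obtain ⟨ρ, hρ, step⟩ := Step.exists_of_apart (C := C) L R i hH hD hK' apart nodup fresh legal
      unify
    simp only [StateVector.fv_append_cons, Set.union_subset_iff] at hfv
    obtain ⟨hL, hs, hR⟩ := hfv
    have map_prog : P.map ψ.apply = P :=
      congrArg State.prog (State.apply_eq_self fun x hx => fix x (hs hx))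
    rw [map_prog, StateVector.apply_eq_self fun x hx => fix x (hL hx),
      StateVector.apply_eq_self fun x hx => fix x (hR hx)] at step
    exact .inr ⟨ρ, hρ, ψ, _, step, fix, oc_subset⟩
  | orLeft i P hG hG' => exact .inr (of_step_id (.orLeft L R i P hG hG') nofun)
  | orRight i P hG hG' => exact .inr (of_step_id (.orRight L R i P hG hG') nofun)
  | and i P hG hG' => exact .inr (of_step_id (.and L R i P hG hG') nofun)
  | instance_ i P hα hG ht => exact .inr (of_step_id (.instance_ L R i P hα hG ht) nofun)
  | augment i P hD hG => exact .inr (of_step_id (.augment L R i P hD hG) nofun)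
  | generic i P hα hP hG hc =>
    exact .inr (of_step_id
      (.generic L R i P hα hG hc (Set.disjoint_singleton_left.1 hK)) nofun)

namespace DerivesWithin

theorem refl : DerivesWithin S A Subst.id A A.oc ∅ :=
  ⟨_, _, _, .refl, subset_rfl, fun _ _ => rfl⟩

theorem mono (h : DerivesWithin S A θ A' C N) (hC : C ⊆ C') : DerivesWithin S A θ A' C' N :=
  let ⟨η, V, C'', hr, hC'', eq⟩ := h
  ⟨η, V, C'', hr, hC''.trans hC, eq⟩

theorem directStep (hS : ordinary ⊆ S) {L R : StateVector B} {s : State B} {ss : List (State B)}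
    (h : DerivesWithin S A θ (L ++ s :: R) C N) (hs : DirectStep T s ss K) (hK : Disjoint K C) :
    DerivesWithin S A θ (L ++ (ss ++ R)) (C ∪ K ∪ T ∪ StateVector.oc (L ++ (ss ++ R))) (N ∪ K) := by
  obtain ⟨η, V, C', hr, hC', eq⟩ := h
  obtain ⟨rfl, rfl⟩ | ⟨ρ, hρ, ψ, W, step, fix, hψ⟩ :=
    hs.exists_step hr.finite.1 hr.fv_subset (hK.mono_right hC')
  · rw [Set.union_empty N]
    exact ⟨η, V, C', hr, fun c hc => .inl (.inl (.inl (hC' hc))), eq⟩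
  · obtain ⟨η', V', C'', hr', hC'', eq'⟩ := hr.derivesWithin_step (hS hρ) step fix
    exact ⟨η', V', C'', hr', hC''.trans (by gcongr), fun x hx => (eq' x hx).trans (eq x hx)⟩

theorem sub (hS : .sub ∈ S) (h : DerivesWithin S A θ A' C N) (hA' : A' ≠ []) (hγ : γ.Legal) :
    DerivesWithin S A (θ.comp γ) (A'.apply γ) (C ∪ γ.oc ∪ (A'.apply γ).oc) N := by
  obtain ⟨η, V, C', hr, hC', eq⟩ := h
  obtain ⟨⟨i, P, G⟩, R, rfl⟩ := List.exists_cons_of_ne_nil hA'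
  have step := hr.step hS (.sub [] R i P G hγ)
  rw [Set.union_empty, Set.union_empty, Set.union_empty] at step
  exact ⟨_, _, _, step, Set.union_subset_union_left _ (Set.union_subset_union_left _ hC'),
    fun x hx => congrArg γ.apply (eq x hx)⟩

end DerivesWithin

end Simulation

section Provability

variable {B : Type u} {S : Set Rule} {A A' : StateVector B} {θ φ : Subst B}

/-- States from which direct steps lead to the empty vector, with no freshness condition on the
constants they introduce. -/
inductive Provable : State B → Prop
  | mk {K : Set (ACon B)} {s : State B} {ss : List (State B)} :
      DirectStep Set.univ s ss K → (∀ s' ∈ ss, Provable s') → Provable s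

theorem Derives.provable (hA : A.Valid) (h : Derives S A θ []) : ∀ s ∈ A.apply θ, Provable s :=
  h.backward (fun _ _ _ direct _ => .mk direct) hA (List.forall_mem_nil _)

theorem DirectStep.exists_rename {T K : Set (ACon B)} {s : State B} {ss : List (State B)}
    (h : DirectStep T s ss K) {f : ∀ τ : Ty B, Con τ → Con τ}
    (hf : ∀ τ c, (f τ c).level = c.level) {C : Set (ACon B)} (hC : C.Finite) :
    ∃ f' : ∀ τ : Ty B, Con τ → Con τ, (∀ τ c, (f' τ c).level = c.level) ∧
      s.subst (fun _ c => Term.con (f' _ c)) Subst.id =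
        s.subst (fun _ c => Term.con (f _ c)) Subst.id ∧
      Disjoint ((fun c : ACon B => (⟨c.1, f' c.1 c.2⟩ : ACon B)) '' K) C := by
  cases h with
  | @generic i P α hα G c hP hG hc =>
    obtain ⟨c', hc', hcC⟩ := exists_fresh_con hC hα.conTy (i + 1)
    refine ⟨updateAt f c c', fun τ d => ?_, ?_, ?_⟩
    · by_cases h : (⟨τ, d⟩ : ACon B) = ⟨α, c⟩
      · cases h
        rw [updateAt_self]
        exact hc'.trans hc.symm
      · rw [updateAt_of_ne f c' h]
        exact hf τ d
    · have ne_of_level_le (τ : Ty B) (d : Con τ) (hd : d.level ≤ i) :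
          (⟨τ, d⟩ : ACon B) ≠ ⟨α, c⟩ := by
        rintro h
        cases h
        omega
      have subst_eq {Γ : List (Ty B)} {τ : Ty B} (q : Term Γ τ) (hq : q.LevelLE i) :
          q.subst (fun τ d => Term.con (updateAt f c c' τ d)) Subst.id =
            q.subst (fun τ d => Term.con (f τ d)) Subst.id :=
        hq.subst_congr (fun σ d hd => by rw [updateAt_of_ne f c' (ne_of_level_le σ d hd)])
          fun _ _ _ => rfl
      simp only [State.subst, Term.allG, Term.subst_app, Term.subst_lcon, Term.subst_lam]
      rw [subst_eq G hG, List.map_congr_left fun D hD => subst_eq D (hP D hD)]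
    · rwa [Set.image_singleton, Set.disjoint_singleton_left, updateAt_self]
  | _ => exact ⟨f, hf, rfl, by rw [Set.image_empty]; exact Set.empty_disjoint C⟩

theorem of_append_of_forall_of_cons {β : Type*} {X : List β → Prop} {l : List β}
    (h : ∀ a ∈ l, ∀ R, X (a :: R) → X R) (R : List β) (hX : X (l ++ R)) : X R := by
  induction l with
  | nil => exact hX
  | cons a l ih =>
    obtain ⟨ha, hl⟩ := List.forall_mem_cons.1 h
    exact ih hl (ha _ hX)

theorem Provable.derives_of_cons (hS : ordinary ⊆ S) {s : State B} (h : Provable s) :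
    ∀ {f : ∀ τ : Ty B, Con τ → Con τ}, (∀ τ c, (f τ c).level = c.level) → ∀ R : StateVector B,
      Derives S A (θ.restrict A.fv) (s.subst (fun _ c => Term.con (f _ c)) Subst.id :: R) →
        Derives S A (θ.restrict A.fv) R := by
  induction h with
  | @mk K s ss direct _ ih =>
    intro f hf R hR
    obtain ⟨C, N, hC, hR⟩ := hR.exists_derivesWithin
    obtain ⟨f', hf', hs, disjoint⟩ := direct.exists_rename hf hC
    rw [← hs] at hR
    have step := hR.directStep (L := []) hS (direct.subst (T' := Set.univ) hf'
      (fun _ _ => Term.levelLE_var le_rfl) fun _ _ _ => Set.subset_univ _) disjoint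
    exact of_append_of_forall_of_cons (X := Derives S A (θ.restrict A.fv))
      (List.forall_mem_map.2 fun s' hs' => ih s' hs' hf') R step.derives

theorem derives_null_of_provable (hS : ordinary ⊆ S) (hA' : ∀ s ∈ A', Provable s)
    (h : Derives S A (θ.restrict A.fv) A') : Derives S A (θ.restrict A.fv) [] := by
  refine of_append_of_forall_of_cons (X := Derives S A (θ.restrict A.fv)) (fun s hs R hR => ?_) []
    (A'.append_nil.symm ▸ h)
  rw [← s.subst_id] at hR
  exact (hA' s hs).derives_of_cons hS (f := fun _ c => c) (fun _ _ => rfl) R hR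

theorem derives_ordinary_of_enriched (hA : A.Valid) (h : Derives enriched A Subst.id []) :
    Derives ordinary A Subst.id [] := by
  have provable := h.provable hA
  rw [StateVector.apply_id] at provable
  rw [← Subst.id_restrict A.fv]
  exact derives_null_of_provable subset_rfl provable DerivesWithin.refl.derives

theorem derives_null_of_apply (hA : A.Valid) (hθ : θ.Legal)
    (h : Derives enriched (A.apply θ) φ []) : Derives enriched A ((θ.comp φ).restrict A.fv) [] := by
  have provable := h.provable (hA.apply hθ)
  rw [← StateVector.apply_comp] at provable
  obtain ⟨N, η, V, C, hr, rfl⟩ := h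
  have legal := hθ.comp (hr.legal.restrict (A.apply θ).fv)
  obtain rfl | hne := eq_or_ne A []
  · have fv_nil : StateVector.fv ([] : StateVector B) = ∅ :=
      Set.eq_empty_of_forall_notMem fun _ ⟨_, hs, _⟩ => List.not_mem_nil hs
    refine ⟨∅, _, _, _, .refl, Subst.restrict_eq_restrict_iff.2 ?_⟩
    rw [fv_nil]
    exact fun _ hx => hx.elim
  · refine derives_null_of_provable (Set.subset_univ _) provable ?_
    have sub := DerivesWithin.refl.sub (S := enriched) (Set.mem_univ _) hne legal
    rw [Subst.id_comp] at sub
    exact sub.derives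

end Provability

section Lifting

variable {B : Type u} {A A' : StateVector B} {θ η φ : Subst B} {V : Set (AVar B)}
  {C N : Set (ACon B)}

theorem exists_renaming_apart {Z V : Set (AVar B)} (hZ : Z.Finite) (hV : V.Finite) :
    ∃ p q : Subst B, p.Legal ∧ q.Legal ∧ p.oc = ∅ ∧ (∀ x ∉ Z, p x.1 x.2 = Subst.id x.1 x.2) ∧
      (∀ x ∈ V, q x.1 x.2 = Subst.id x.1 x.2) ∧ ∀ x ∈ Z, ∃ y : LVar x.1, ⟨x.1, y⟩ ∉ V ∧
        p x.1 x.2 = Term.var (.free y) ∧ q x.1 y = Subst.id x.1 x.2 := by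
  obtain ⟨n, hn⟩ := (hV.image fun x : AVar B => x.2.idx).bddAbove
  let shift (τ : Ty B) (x : LVar τ) : LVar τ := ⟨x.level, x.idx + (n + 1), x.ok⟩
  let unshift (τ : Ty B) (x : LVar τ) : LVar τ := ⟨x.level, x.idx - (n + 1), x.ok⟩
  let Z' : Set (AVar B) := (fun x => ⟨x.1, shift x.1 x.2⟩) '' Z
  have shift_notMem (τ : Ty B) (x : LVar τ) : (⟨τ, shift τ x⟩ : AVar B) ∉ V := fun hx => by
    have shift_idx_le := hn ⟨_, hx, rfl⟩
    simp only [shift] at shift_idx_le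
    omega
  have unshift_shift (τ : Ty B) (x : LVar τ) : unshift τ (shift τ x) = x := by
    simp only [unshift, shift, Nat.add_sub_cancel]
  refine ⟨Subst.restrict (fun τ x => Term.var (.free (shift τ x))) Z,
    Subst.restrict (fun τ x => Term.var (.free (unshift τ x))) Z',
    Subst.legal_restrict_of_finite hZ fun τ x => Term.levelLE_var le_rfl,
    Subst.legal_restrict_of_finite (hZ.image _) fun τ x => Term.levelLE_var le_rfl, ?_,
    fun x hx => Subst.restrict_of_notMem hx, fun x hx => Subst.restrict_of_notMem ?_,
    fun x hx => ⟨shift x.1 x.2, shift_notMem _ _, Subst.restrict_of_mem hx, ?_⟩⟩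
  · refine Set.eq_empty_of_forall_notMem fun c hc => ?_
    obtain ⟨x, -, hc⟩ := Set.mem_iUnion₂.1 hc
    by_cases hx : x ∈ Z
    · rw [Subst.restrict_of_mem hx, Term.oc_var] at hc
      exact hc
    · rw [Subst.restrict_of_notMem hx, Term.oc_var] at hc
      exact hc
  · rintro ⟨y, -, hy⟩
    change (⟨y.1, shift y.1 y.2⟩ : AVar B) = x at hy
    exact shift_notMem y.1 y.2 (hy ▸ hx)
  · have mem : (⟨x.1, shift x.1 x.2⟩ : AVar B) ∈ Z' := ⟨x, hx, rfl⟩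
    rw [Subst.restrict_of_mem mem, unshift_shift, Subst.id]

theorem Res.lift (h : Res enriched (A.apply θ) η A' V C N) (hA : A.Valid) (hne : A ≠ [])
    (hθ : θ.Legal) : Disjoint N (A.oc ∪ θ.oc) →
      DerivesWithin enriched A (θ.comp η) A' (C ∪ (A.oc ∪ θ.oc)) N := by
  induction h with
  | refl =>
    intro _
    have sub := DerivesWithin.refl.sub (S := enriched) (Set.mem_univ _) hne hθ
    rw [Subst.id_comp] at sub
    rw [Subst.comp_id, Set.union_comm]
    exact sub
  | @step η γ A' A'' V W C N K ρ hr _ hs ih =>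
    intro hN
    obtain ⟨hN, hK⟩ := Set.disjoint_union_left.1 hN
    have sub := (ih hN).sub (Set.mem_univ _) hs.ne_nil hs.legal
    obtain ⟨L, R, s, ss, hγ, rfl, direct⟩ := hs.exists_directStep (hr.valid (hA.apply hθ))
    have constants : C ∪ (A.oc ∪ θ.oc) ∪ γ.oc ∪ (A'.apply γ).oc ⊆ C ∪ γ.oc ∪ (A.oc ∪ θ.oc) := by
      refine Set.union_subset (Set.union_right_comm ..).subset ?_
      refine (StateVector.oc_apply_subset γ A').trans ?_
      exact (Set.union_subset_union_left _ hr.oc_subset).trans Set.subset_union_left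
    have fresh : Disjoint K (C ∪ γ.oc ∪ (A.oc ∪ θ.oc)) := by
      rcases hs.eq_empty_or_eq_id with rfl | rfl
      · exact Set.empty_disjoint _
      · rw [Subst.oc_id, Set.union_empty]
        exact hs.disjoint.union_right hK
    have lifted := sub.mono constants
    rw [hγ, Subst.comp_assoc] at lifted
    refine (lifted.directStep (Set.subset_univ _) direct fresh).mono fun c => ?_
    simp only [Set.mem_union]
    tauto

/- The resolution of `A.apply θ` may take fresh names from the variables of `A` and `θ` that
`A.apply θ` lacks: `p` moves these out of its way, and `q` moves them back at its end. -/
theorem Res.exists_renaming_comp {S : Set Rule} (h : Res S (A.apply θ) η A' V C N)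
    (hθ : θ.Legal) : ∃ p q : Subst B, p.Legal ∧ q.Legal ∧ p.oc = ∅ ∧
      A.apply ((θ.restrict A.fv).comp p) = A.apply θ ∧
      (∀ x ∈ V, q x.1 x.2 = Subst.id x.1 x.2) ∧
      ∀ x ∈ A.fv, (((θ.restrict A.fv).comp p).comp η).comp q x.1 x.2 =
        θ.comp (η.restrict (A.apply θ).fv) x.1 x.2 := by
  let Z := (A.fv ∪ (θ.restrict A.fv).fv) \ (A.apply θ).fv
  obtain ⟨p, q, hp, hq, oc_p, p_fix, q_fix, hpq⟩ := exists_renaming_apart (Z := Z)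
    (A.finite_fv.union (hθ.restrict A.fv).finite_fv).sdiff h.finite.1
  refine ⟨p, q, hp, hq, oc_p, ?_, q_fix, fun x hx => ?_⟩
  · rw [StateVector.apply_comp, StateVector.apply_restrict]
    exact StateVector.apply_eq_self fun x hx => p_fix x fun hZ => hZ.2 hx
  have value : θ.restrict A.fv x.1 x.2 = θ x.1 x.2 := Subst.restrict_of_mem hx
  rw [Subst.comp_assoc, Subst.comp_assoc, Subst.comp, Subst.comp, value]
  refine Subst.apply_congr (θ x.1 x.2) fun z hz => ?_
  rw [Subst.comp, Subst.apply_comp]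
  by_cases hzA : z ∈ (A.apply θ).fv
  · rw [Subst.restrict_of_mem hzA, p_fix z fun hZ => hZ.2 hzA, Subst.id, Subst.apply_var,
      Subst.apply_eq_self fun w hw => q_fix w (h.fv_value_subset z (h.start_fv_subset hzA) hw)]
  · have hzZ : z ∈ Z := by
      rw [← value] at hz
      exact ⟨((θ.restrict A.fv).fv_value_subset x.2 hz).elim .inr fun h => .inl (h ▸ hx), hzA⟩
    obtain ⟨y, hyV, hpz, hqy⟩ := hpq z hzZ
    rw [Subst.restrict_of_notMem hzA, hpz, Subst.apply_var, h.value_of_notMem _ hyV, Subst.id,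
      Subst.apply_var, hqy]
    rfl

theorem derives_of_apply (hA : A.Valid) (hθ : θ.Legal)
    (h : DerivesWith enriched (A.apply θ) φ A' N) (hne : A' ≠ [])
    (hN : Disjoint N (A.oc ∪ (θ.restrict A.fv).oc)) :
    Derives enriched A ((θ.comp φ).restrict A.fv) A' := by
  obtain ⟨η, V, C, hr, rfl⟩ := h
  have hA_ne : A ≠ [] := by
    rintro rfl
    exact hne hr.eq_nil
  obtain ⟨p, q, hp, hq, oc_p, apply_comp_p, q_fix, value⟩ := hr.exists_renaming_comp hθ
  rw [← apply_comp_p] at hr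
  have oc_comp_p := (θ.restrict A.fv).oc_comp_subset p
  rw [oc_p, Set.union_empty] at oc_comp_p
  have lifted := hr.lift hA hA_ne ((hθ.restrict A.fv).comp hp)
    (hN.mono_right (Set.union_subset_union_right _ oc_comp_p))
  have renamed := (lifted.sub (S := enriched) (Set.mem_univ _) hne hq).derives
  rw [StateVector.apply_eq_self fun x hx => q_fix x (hr.fv_subset hx)] at renamed
  exact Subst.restrict_eq_restrict_iff.2 value ▸ renamed

end Lifting

theorem Vr.finite_setOf_over {B : Type u} {X : Set (AVar B)} (hX : X.Finite) :
    ∀ Γ : List (Ty B), {y : Σ σ : Ty B, Vr Γ σ | y.2.Over X}.Finite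
  | [] => by
    refine (hX.image fun x => (⟨x.1, .free x.2⟩ : Σ σ : Ty B, Vr [] σ)).subset ?_
    rintro ⟨σ, y⟩ hy
    cases y with
    | free x => exact ⟨⟨σ, x⟩, over_free.1 hy, rfl⟩
  | α :: Γ => by
    refine (((finite_setOf_over hX Γ).image fun y =>
      (⟨y.1, .succ y.2⟩ : Σ σ : Ty B, Vr (α :: Γ) σ)).insert ⟨α, .zero⟩).subset ?_
    rintro ⟨σ, y⟩ hy
    cases y with
    | zero => exact .inl rfl
    | succ y => exact .inr ⟨⟨σ, y⟩, hy, rfl⟩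

theorem Tm.Over.levelLE_bind {B : Type u} {Γ : List (Ty B)} {τ : Ty B} {X : Set (AVar B)} {i : ℕ}
    {t : Tm Γ τ} {s : ∀ σ, Vr Γ σ → Tm [] σ} (ht : t.Over X {c | c.2.level ≤ i})
    (hs : ∀ σ y, y.Over X → (s σ y).LevelLE i) : (Term.mk (t.bind s)).LevelLE i :=
  ⟨_, rfl, levelLE_iff_over.2 (ht.bind subset_rfl fun σ y hy => levelLE_iff_over.1 (hs σ y hy))⟩

namespace UniformAlgebra

variable {B : Type u} {Ω : Type w} [DistribLattice Ω] [OrderTop Ω]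
  (M : UniformAlgebra.{u, v, w} B Ω)

section Substitution

variable {i : ℕ} {Γ : List (Ty B)} {τ α β : Ty B} {X : Set (AVar B)} {φ φ' : M.M.Assign}

/-- `d` is the value at level `i` of a raw term under every assignment that agrees with `φ` on
its logic variables. The freedom in the assignment makes the notion stable under changes of `φ`
at fresh variables, which is what an induction passing under a binder requires. -/
def Denotes (i : ℕ) (t : Tm [] τ) (φ : M.M.Assign) (d : M.M.D i τ) : Prop :=
  t.LevelLE i ∧ ∀ φ₁ : M.M.Assign, (∀ x, t.HasVar x → φ₁ x.1 x.2 = φ x.1 x.2) →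
    M.U i (Term.mk t) φ₁ = d

variable {M}

theorem Denotes.var {x : LVar τ} (hx : x.level ≤ i) :
    M.Denotes i (.var (.free x)) φ (M.M.lift hx (φ τ x)) :=
  ⟨hx, fun φ₁ h => (M.U_var x φ₁ hx).trans (congrArg _ (h ⟨τ, x⟩ rfl))⟩

theorem Denotes.updateAt {t : Tm [] τ} {d : M.M.D i τ} (h : M.Denotes i t φ d) {w : LVar α}
    (hw : ¬ t.HasVar ⟨α, w⟩) (e : M.M.D w.level α) : M.Denotes i t (updateAt φ w e) d :=
  ⟨h.1, fun φ₁ h₁ => h.2 φ₁ fun x hx =>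
    (h₁ x hx).trans (updateAt_of_ne φ e fun hxw => hw (hxw ▸ hx))⟩

theorem Denotes.updateAt_self (φ : M.M.Assign) (w : LVar α) (d : M.M.D w.level α) :
    M.Denotes w.level (.var (.free w)) (UCTT.updateAt φ w d) d := by
  simpa only [UCTT.updateAt_self, M.M.lift_refl] using
    Denotes.var (φ := UCTT.updateAt φ w d) (le_refl w.level)

theorem app_U_lam_bind (hα : α.VarTy) {t : Tm (α :: Γ) β} {s : ∀ σ, Vr Γ σ → Tm [] σ}
    {w : LVar α} (ht : t.Over X {c | c.2.level ≤ w.level})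
    (hs : ∀ σ y, y.Over X → (s σ y).LevelLE w.level ∧ ¬ (s σ y).HasVar ⟨α, w⟩)
    (d : M.M.D w.level α) :
    M.M.app (M.U w.level (Term.mk ((Tm.lam hα t).bind s)) φ) d =
      M.U w.level (Term.mk (t.bind fun σ y =>
        (liftSub s α σ y).bind (instSub (.var (.free w))))) (updateAt φ w d) := by
  have body_over : (t.bind (liftSub s α)).Over {x | x.2.level ≤ w.level ∧ x ≠ ⟨α, w⟩}
      {c | c.2.level ≤ w.level} := by
    refine ht.bind subset_rfl fun σ y hy => ?_
    cases y with
    | zero => exact Tm.over_var.2 fun _ h => h.elim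
    | succ y =>
      have hsy := Tm.levelLE_iff_over.1 (hs σ y hy).1
      exact Tm.Over.wk ⟨fun x hx => ⟨hsy.1 x hx, fun hxw => (hs σ y hy).2 (hxw ▸ hx)⟩, hsy.2⟩
  have app_lam := M.U_lam hα (Term.mk (t.bind (liftSub s α))) w.idx φ (updateAt φ w d)
    ⟨_, rfl, Tm.levelLE_iff_over.2 (body_over.mono (fun _ hx => hx.1) subset_rfl)⟩
    (fun h => (Term.Over.fv_subset ⟨_, rfl, body_over⟩ h).2 rfl)
    fun x hx => updateAt_of_ne φ d hx
  rw [updateAt_self, Term.var, Term.inst_mk, Tm.bind_bind] at app_lam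
  exact app_lam

theorem U_bind_congr (hX : X.Finite) {t : Tm Γ τ} (ht : t.Over X {c | c.2.level ≤ i})
    {s s' : ∀ σ, Vr Γ σ → Tm [] σ}
    (h : ∀ σ y, y.Over X → ∃ d, M.Denotes i (s σ y) φ d ∧ M.Denotes i (s' σ y) φ' d) :
    M.U i (Term.mk (t.bind s)) φ = M.U i (Term.mk (t.bind s')) φ' := by
  induction t generalizing φ φ' with
  | var y =>
    obtain ⟨d, hd, hd'⟩ := h _ y (Tm.over_var.1 ht)
    exact (hd.2 φ fun _ _ => rfl).trans (hd'.2 φ' fun _ _ => rfl).symm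
  | con c => exact (M.U_con c φ (Tm.over_con.1 ht)).trans (M.U_con c φ' (Tm.over_con.1 ht)).symm
  | lcon k => exact (M.U_lcon k φ).trans (M.U_lcon k φ').symm
  | inc e t ih =>
    have ht : t.Over X _ := ht
    exact (M.U_inc e _ φ (ht.levelLE_bind fun σ y hy => (h σ y hy).elim fun _ hd => hd.1.1)).trans
      ((congrArg _ (ih ht h)).trans
        (M.U_inc e _ φ' (ht.levelLE_bind fun σ y hy => (h σ y hy).elim fun _ hd => hd.2.1)).symm)
  | app t u iht ihu =>
    obtain ⟨ht, hu⟩ := Tm.over_app.1 ht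
    have app_bind (ψ : M.M.Assign) {r : ∀ σ, Vr _ σ → Tm [] σ}
        (hr : ∀ σ y, y.Over X → (r σ y).LevelLE i) :=
      M.U_app _ _ ψ (ht.levelLE_bind hr) (hu.levelLE_bind hr)
    exact (app_bind φ fun σ y hy => (h σ y hy).elim fun _ hd => hd.1.1).trans
      ((congrArg₂ M.M.app (iht ht h) (ihu hu h)).trans
        (app_bind φ' fun σ y hy => (h σ y hy).elim fun _ hd => hd.2.1).symm)
  | @lam Γ α β hα t ih =>
    refine M.M.ext _ _ fun d => ?_
    obtain ⟨w, rfl, hw⟩ := exists_fresh_var ((Vr.finite_setOf_over hX Γ).biUnion fun y _ =>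
      (s y.1 y.2).finite_hasVar.union (s' y.1 y.2).finite_hasVar) hα i
    have fresh : ∀ σ (y : Vr Γ σ), y.Over X →
        ¬ (s σ y).HasVar ⟨α, w⟩ ∧ ¬ (s' σ y).HasVar ⟨α, w⟩ := fun σ y hy =>
      not_or.1 fun hwy => hw (Set.mem_iUnion₂.2 ⟨⟨σ, y⟩, hy, hwy⟩)
    rw [app_U_lam_bind hα ht fun σ y hy =>
        ⟨(h σ y hy).elim fun _ hd => hd.1.1, (fresh σ y hy).1⟩,
      app_U_lam_bind hα ht fun σ y hy =>
        ⟨(h σ y hy).elim fun _ hd => hd.2.1, (fresh σ y hy).2⟩]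
    refine ih ht fun σ y hy => ?_
    cases y with
    | zero => exact ⟨d, .updateAt_self φ w d, .updateAt_self φ' w d⟩
    | succ y =>
      obtain ⟨e, he, he'⟩ := h σ y hy
      simp only [liftSub, Tm.wk_bind_instSub]
      exact ⟨e, he.updateAt (fresh σ y hy).1 d, he'.updateAt (fresh σ y hy).2 d⟩

theorem Denotes.of_levelLE {t : Tm [] τ} (ht : t.LevelLE i) (φ : M.M.Assign) :
    M.Denotes i t φ (M.U i (Term.mk t) φ) := by
  refine ⟨ht, fun φ₁ agree => ?_⟩
  have t_over := Tm.levelLE_iff_over.1 ht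
  have h := U_bind_congr (φ := φ₁) (φ' := φ) (s := fun _ y => .var y) (s' := fun _ y => .var y)
    t.finite_hasVar (⟨fun _ hx => hx, t_over.2⟩ : t.Over {x | t.HasVar x} _) fun σ y hy => by
      cases y with
      | free x =>
        have hx : t.HasVar ⟨σ, x⟩ := Vr.over_free.1 hy
        refine ⟨_, .var (t_over.1 _ hx), ?_⟩
        rw [agree ⟨σ, x⟩ hx]
        exact .var (t_over.1 _ hx)
  rwa [Tm.bind_var] at h

theorem U_congr_of_over {q : CTerm τ} (hq : q.Over X {c | c.2.level ≤ i})
    (hX : ∀ x ∈ X, x.2.level ≤ i) (h : ∀ x ∈ X, φ x.1 x.2 = φ' x.1 x.2) :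
    M.U i q φ = M.U i q φ' := by
  obtain ⟨t, rfl, ht⟩ := hq
  exact (Denotes.of_levelLE (Tm.levelLE_iff_over.2 (ht.mono hX subset_rfl)) φ').2 φ
    fun x hx => h x (ht.1 x hx)

theorem U_subst {q : CTerm τ} (hq : q.LevelLE i) {ν : Subst B}
    (hν : ∀ σ (x : LVar σ) (hx : x.level ≤ i),
      (ν σ x).LevelLE i ∧ M.U i (ν σ x) φ = M.M.lift hx (φ' σ x)) :
    M.U i (q.subst (fun _ c => Term.con c) ν) φ = M.U i q φ' := by
  obtain ⟨t, rfl, ht⟩ := hq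
  obtain ⟨ν₀, hν₀, hν₀_over⟩ := Term.exists_rep_family (Δ := fun _ => []) ν
    (P := fun σ x => x.level ≤ i) fun σ x hx => Term.levelLE_iff_over.1 (hν σ x hx).1
  have ht' := Tm.levelLE_iff_over.1 ht
  rw [Term.subst_mk (κ := fun _ c => Term.con c) (κ₀ := fun _ c => .con c) (fun _ _ => rfl) hν₀,
    Tm.subst_con_eq_bind]
  conv_rhs => rw [← Tm.bind_var t]
  refine U_bind_congr t.finite_hasVar ⟨fun _ hx => hx, ht'.2⟩ fun σ y hy => ?_
  cases y with
  | free x =>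
    have hx : x.level ≤ i := ht'.1 ⟨σ, x⟩ (Vr.over_free.1 hy)
    refine ⟨_, .of_levelLE (Tm.levelLE_iff_over.2 (hν₀_over σ x hx)) φ, ?_⟩
    rw [hν₀, (hν σ x hx).2]
    exact .var hx

end Substitution

end UniformAlgebra

namespace UniformAlgebra

variable {B : Type u} {Ω : Type w} [DistribLattice Ω] [OrderTop Ω]
  (M : UniformAlgebra.{u, v, w} B Ω)

section TruthValues

variable {i : ℕ} (φ : M.M.Assign)

theorem prog_append (P : List (CTerm (B := B) .p)) (D : CTerm (B := B) .p) :
    M.prog i (P ++ [D]) φ = M.M.bin .andP (M.prog i P φ) (M.U i D φ) :=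
  List.foldl_append

theorem le_vector_iff {A : StateVector B} {x : Ω} :
    x ≤ M.vector A φ ↔ ∀ s ∈ A, x ≤ M.state s φ := by
  induction A with
  | nil => exact iff_of_true le_top (List.forall_mem_nil _)
  | cons s A ih => rw [List.forall_mem_cons, ← ih]; exact le_inf_iff

theorem vector_eq_top_iff {A : StateVector B} :
    M.vector A φ = ⊤ ↔ ∀ s ∈ A, M.state s φ = ⊤ := by
  simp only [← top_le_iff, le_vector_iff]

theorem U_bin {α β τ : Ty B} (k : LCon (.arr α (.arr β τ))) {q : CTerm α} {r : CTerm β}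
    (hq : q.LevelLE i) (hr : r.LevelLE i) :
    M.U i (Term.app (Term.app (Term.lcon k) q) r) φ = M.M.bin k (M.U i q φ) (M.U i r φ) := by
  rw [M.U_app _ _ φ ((Term.levelLE_lcon i k).app hq) hr, M.U_app _ _ φ (Term.levelLE_lcon i k) hq,
    M.U_lcon, UniformStructure.bin]

theorem U_rigid {A : CTerm (B := B) .r} (hA : A.LevelLE i) :
    M.U i (Term.rigid A) φ = M.M.rigid (M.U i A φ) := by
  rw [Term.rigid, M.U_inc _ _ φ ((hA.inc _).inc _), M.U_inc _ _ φ (hA.inc _), M.U_inc _ _ φ hA,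
    UniformStructure.rigid]

/-- The value of the clause with head `A` and body `G`, where the body of a fact is `none`. -/
def clause (i : ℕ) (φ : M.M.Assign) (G : Option (CTerm (B := B) .g)) (A : CTerm (B := B) .r) :
    M.M.D i .p :=
  match G with
  | none => M.M.incl .rp (M.U i A φ)
  | some G => M.M.bin .impP (M.U i G φ) (M.U i A φ)

theorem clause_le_of_instanceAt {T : Set (ACon B)} {Γ : List (Ty B)} {D : Term Γ .p} {K : Clause Γ}
    (hK : InElaboration i D K) {e : Env CTerm Γ} {G : Option (CTerm (B := B) .g)}
    {A : CTerm (B := B) .r} (he : ∀ σ (y : Vr Γ σ), y.LevelLE i → (e.sub σ y).LevelLE i)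
    (h : InstanceAt T i e K G A) : M.M.le (M.clause i φ G A) (M.U i (D.close e) φ) := by
  induction hK with
  | fact hA =>
    cases h
    rw [Term.close_inc, M.U_inc _ _ φ (hA.close he)]
    exact M.M.le_refl _
  | rule hG hA =>
    cases h
    rw [Term.impP, Term.close_app, Term.close_app, Term.close_lcon,
      M.U_bin φ _ (hG.close he) (hA.close he)]
    exact M.M.le_refl _
  | left hD hK ih =>
    rw [Term.andP, Term.close_app, Term.close_app, Term.close_lcon,
      M.U_bin φ _ (hK.levelLE.close he) (hD.close he)]
    exact M.M.le_trans _ _ _ (ih he h) (M.M.le_and _ _)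
  | right hD hK ih =>
    rw [Term.andP, Term.close_app, Term.close_app, Term.close_lcon,
      M.U_bin φ _ (hD.close he) (hK.levelLE.close he)]
    exact M.M.le_trans _ _ _ (ih he h)
      (M.M.le_trans _ _ _ (M.M.le_and _ _) (M.M.and_comm _ _))
  | all hα hK ih =>
    cases h with
    | all _ ht _ h =>
      have hlam := (hK.levelLE.lam hα).close he
      rw [Term.allP, Term.close_app, Term.close_lcon, M.U_app _ _ φ (Term.levelLE_lcon i _) hlam,
        M.U_lcon]
      refine M.M.le_trans _ _ _ (ih (fun σ y hy => ?_) h) ?_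
      · cases y with
        | zero => exact ht
        | succ y => exact he _ y hy
      · rw [← Term.app_close_lam e hα, M.U_app _ _ φ hlam ht]
        exact M.M.app_le_pi hα _ _

theorem U_le_prog {P : List (CTerm (B := B) .p)} {D : CTerm (B := B) .p} (hD : D ∈ P) :
    M.M.le (M.U i D φ) (M.prog i P φ) := by
  induction P using List.reverseRecOn with
  | nil => exact (List.not_mem_nil hD).elim
  | append_singleton P D' ih =>
    rw [prog_append]
    rcases List.mem_append.1 hD with hD | hD
    · exact M.M.le_trans _ _ _ (ih hD) (M.M.le_and _ _)
    · rw [List.mem_singleton.1 hD]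
      exact M.M.le_trans _ _ _ (M.M.le_and _ _) (M.M.and_comm _ _)

theorem clause_le_prog {T : Set (ACon B)} {P : List (CTerm (B := B) .p)} {D : CTerm (B := B) .p}
    {K : Clause []} {G : Option (CTerm (B := B) .g)} {A : CTerm (B := B) .r} (hD : D ∈ P)
    (hK : InElaboration i D K) (h : InstanceAt T i .nil K G A) :
    M.M.le (M.clause i φ G A) (M.prog i P φ) := by
  have clause_le := M.clause_le_of_instanceAt φ hK (fun σ y hy => by
    cases y
    exact Term.levelLE_var hy) h
  rw [Term.close_nil] at clause_le
  exact M.M.le_trans _ _ _ clause_le (M.U_le_prog φ hD)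

theorem le_state_of_directStep {T : Set (ACon B)} {s : State B} {ss : List (State B)} {x : Ω}
    (h : DirectStep T s ss ∅) (hx : ∀ s' ∈ ss, x ≤ M.state s' φ) : x ≤ M.state s φ := by
  generalize hK : (∅ : Set (ACon B)) = N at h
  cases h with
  | stay => exact hx _ (.head _)
  | null i P =>
    refine le_top.trans_eq ?_
    rw [state, Term.topG, M.U_lcon, M.val.top]
  | @clause i P A D K G hA hD hE hI =>
    have clause_le := M.clause_le_prog φ hD hE hI
    rw [state, M.U_rigid φ hA]
    cases G with
    | none => exact (le_top.trans_eq (M.val.atom _).symm).trans (M.val.inclusion _ _ _ clause_le)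
    | some G => exact (hx _ (.head _)).trans (M.val.backchain _ _ _ clause_le)
  | orLeft i P hG hG' =>
    rw [state, Term.orG, M.U_bin φ _ hG hG', M.val.or]
    exact (hx _ (.head _)).trans le_sup_left
  | orRight i P hG hG' =>
    rw [state, Term.orG, M.U_bin φ _ hG hG', M.val.or]
    exact (hx _ (.head _)).trans le_sup_right
  | and i P hG hG' =>
    rw [state, Term.andG, M.U_bin φ _ hG hG', M.val.and]
    exact le_inf (hx _ (.head _)) (hx _ (.tail _ (.head _)))
  | instance_ i P hα hG ht =>
    have le_instance := hx _ (.head _)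
    rw [state, ← Term.beta hα, M.U_app _ _ φ (hG.lam hα) ht] at le_instance
    rw [state, Term.exG, M.U_app _ _ φ (Term.levelLE_lcon i _) (hG.lam hα), M.U_lcon]
    exact le_instance.trans ((M.val.ex hα _ _).1 ⟨_, rfl⟩)
  | augment i P hD hG =>
    have le_augmented := hx _ (.head _)
    rw [state, prog_append] at le_augmented
    rw [state, Term.impG, M.U_bin φ _ hD hG, M.val.imp]
    exact le_augmented
  | generic => exact ((Set.singleton_ne_empty _) hK.symm).elim

end TruthValues

end UniformAlgebra

section Pullback

variable {B : Type u} {Ω : Type w} [DistribLattice Ω] [OrderTop Ω]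

section Structure

variable {M : UniformStructure.{u, v} B} {s : ℕ → ℕ}

/-- The structure whose carriers of level `j` are those of level `s j` of `M`, in which the
constants have the values `v`. -/
def UniformStructure.pullback (M : UniformStructure.{u, v} B) {s : ℕ → ℕ} (hs : Monotone s)
    (v : ∀ {τ : Ty B} (c : Con τ), M.D (s c.level) τ) : UniformStructure.{u, v} B where
  D j τ := M.D (s j) τ
  app := M.app
  ext := M.ext
  const c := v c
  lconst k := M.lc k (s 0)
  lift hij := M.lift (hs hij)
  lift_refl d := M.lift_refl d
  lift_trans hij hjk d := M.lift_trans (hs hij) (hs hjk) d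
  lift_injective hij := M.lift_injective (hs hij)
  lift_app hij f d := M.lift_app (hs hij) f d
  incl := M.incl
  incl_injective := M.incl_injective
  le := M.le
  le_refl := M.le_refl
  le_trans := M.le_trans
  topP := M.topP
  top_and p := by rw [UniformStructure.lc, M.lift_trans]; exact M.top_and p
  and_top p := by rw [UniformStructure.lc, M.lift_trans]; exact M.and_top p
  le_and p q := by rw [UniformStructure.lc, M.lift_trans]; exact M.le_and p q
  and_comm p q := by rw [UniformStructure.lc, M.lift_trans]; exact M.and_comm p q
  app_le_pi hα f d := by rw [UniformStructure.lc, M.lift_trans]; exact M.app_le_pi hα f d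

section

variable {hs : Monotone s} {v : ∀ {τ : Ty B} (c : Con τ), M.D (s c.level) τ}

theorem UniformStructure.lc_pullback {τ : Ty B} (k : LCon τ) (j : ℕ) :
    (M.pullback hs v).lc k j = M.lc k (s j) := M.lift_trans _ _ _

theorem UniformStructure.bin_pullback {j : ℕ} {α β τ : Ty B} (k : LCon (.arr α (.arr β τ)))
    (x : M.D (s j) α) (y : M.D (s j) β) :
    (M.pullback hs v).bin (i := j) k x y = M.bin (i := s j) k x y :=
  congrArg (fun f => M.app (M.app f x) y) (lc_pullback k j)

theorem Valuation.le_lift (I : Valuation M Ω) {i j : ℕ} (hij : i ≤ j) (p : M.D i .p)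
    (g : M.D i .g) : I.I i p g ≤ I.I j (M.lift hij p) (M.lift hij g) := by
  induction j, hij using Nat.le_induction with
  | base => rw [M.lift_refl, M.lift_refl]
  | succ j hij ih =>
    refine ih.trans ((I.mono _ _).trans ?_)
    rw [M.lift_trans, M.lift_trans]

/-- The valuation that reads a value of level `j` at level `s j`. -/
def Valuation.pullback (I : Valuation M Ω) : Valuation (M.pullback hs v) Ω where
  I j := I.I (s j)
  atom x := I.atom x
  mono p g := I.le_lift (hs (Nat.le_succ _)) p g
  top p := by rw [UniformStructure.lc_pullback]; exact I.top p
  and p g g' := (congrArg (I.I _ p) (UniformStructure.bin_pullback _ g g')).trans (I.and p g g')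
  or p g g' := (congrArg (I.I _ p) (UniformStructure.bin_pullback _ g g')).trans (I.or p g g')
  imp p q g := (congrArg (I.I _ p) (UniformStructure.bin_pullback _ q g)).trans ((I.imp p q g).trans
    (congrArg (fun x => I.I _ x g) (UniformStructure.bin_pullback _ p q).symm))
  ex hα p f := by rw [UniformStructure.lc_pullback]; exact I.ex hα p f
  all hα p f := by rw [UniformStructure.lc_pullback]; exact I.all hα p f
  inclusion p p' g := I.inclusion p p' g
  backchain p g x h := I.backchain p g x
    (Eq.subst (motive := fun q => M.le q p) (UniformStructure.bin_pullback _ g x) h)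

end

/-- An injective renaming of the logic variables that changes levels according to `s` and leaves
the variables of index `0` free for other purposes. -/
def relevel (s : ℕ → ℕ) (τ : Ty B) (x : LVar τ) : LVar τ :=
  ⟨s x.level, Nat.pair x.level x.idx + 1, x.ok⟩

theorem relevel_injective (s : ℕ → ℕ) (τ : Ty B) : Function.Injective (relevel s τ) := by
  rintro ⟨l, n, h⟩ ⟨l', n', h'⟩ heq
  simp only [relevel, LVar.mk.injEq, Nat.add_right_cancel_iff, Nat.pair_eq_pair] at heq
  rw [LVar.mk.injEq]
  exact heq.2

theorem relevel_ne_of_idx_eq_zero {τ : Ty B} {z : LVar τ} (hz : z.idx = 0) (x : LVar τ) :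
    relevel s τ x ≠ z := fun h =>
  Nat.succ_ne_zero _ ((congrArg LVar.idx h).trans hz)

open Classical in
/-- The assignment in `M` whose value at `relevel s τ x` is `φ τ x`; the variables that are not of
this form keep their value under `ψ`. -/
noncomputable def extendAssign (ψ : M.Assign) (φ : ∀ (τ : Ty B) (x : LVar τ), M.D (s x.level) τ) :
    M.Assign := fun τ z =>
  if h : ∃ x, relevel s τ x = z then h.choose_spec ▸ φ τ h.choose else ψ τ z

theorem extendAssign_relevel (ψ : M.Assign) (φ : ∀ (τ : Ty B) (x : LVar τ), M.D (s x.level) τ)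
    {τ : Ty B} (x : LVar τ) : extendAssign ψ φ τ (relevel s τ x) = φ τ x := by
  have cast_eq (x' : LVar τ) (h : relevel s τ x' = relevel s τ x) :
      (h ▸ φ τ x' : M.D (relevel s τ x).level τ) = φ τ x := by
    obtain rfl := relevel_injective s τ h
    rfl
  exact (dif_pos ⟨x, rfl⟩).trans (cast_eq _ _)

theorem extendAssign_of_ne (ψ : M.Assign) (φ : ∀ (τ : Ty B) (x : LVar τ), M.D (s x.level) τ)
    {τ : Ty B} {z : LVar τ} (hz : ∀ x, relevel s τ x ≠ z) : extendAssign ψ φ τ z = ψ τ z :=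
  dif_neg fun ⟨x, hx⟩ => hz x hx

theorem extendAssign_congr (ψ : M.Assign) {φ φ' : ∀ (τ : Ty B) (x : LVar τ), M.D (s x.level) τ}
    {x : AVar B} (h : ∀ z : LVar x.1, relevel s x.1 z = x.2 → φ x.1 z = φ' x.1 z) :
    extendAssign ψ φ x.1 x.2 = extendAssign ψ φ' x.1 x.2 := by
  by_cases hx : ∃ z, relevel s x.1 z = x.2
  · obtain ⟨z, hz⟩ := hx
    rw [← hz, extendAssign_relevel, extendAssign_relevel, h z hz]
  · rw [not_exists] at hx
    rw [extendAssign_of_ne ψ φ hx, extendAssign_of_ne ψ φ' hx]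

end Structure

/-- The substitution of `relevel s τ x` for the logic variables `x`. -/
noncomputable def relevelSubst (s : ℕ → ℕ) : Subst B := fun τ x => Term.var (.free (relevel s τ x))

/-- `κ` sends constants of level `j` to terms over `𝒰_{s j}` all of whose logic variables have
index `0`, so that they are not affected by `relevel s`. -/
def ConSubst.Relevels (s : ℕ → ℕ) (κ : ConSubst B) : Prop :=
  ∀ (τ : Ty B) (c : Con τ),
    (κ τ c).Over {x | x.2.level ≤ s c.level ∧ x.2.idx = 0} {e | e.2.level ≤ s c.level}

variable {s : ℕ → ℕ} {κ : ConSubst B}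

theorem ConSubst.Relevels.levelLE (hκ : κ.Relevels s) {τ : Ty B} (c : Con τ) :
    (κ τ c).LevelLE (s c.level) :=
  Term.levelLE_iff_over.2 ((hκ τ c).mono (fun _ hx => hx.1) subset_rfl)

theorem Term.LevelLE.subst_relevel (hs : Monotone s) (hκ : κ.Relevels s) {i : ℕ}
    {Γ : List (Ty B)} {τ : Ty B} {q : Term Γ τ} (hq : q.LevelLE i) :
    (q.subst κ (relevelSubst s)).LevelLE (s i) :=
  hq.subst (fun _ c hc => (hκ.levelLE c).mono (hs hc)) fun _ _ hx => Term.levelLE_var (hs hx)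

theorem Term.notMem_fv_subst_relevel (hκ : κ.Relevels s) {Γ : List (Ty B)} {α τ : Ty B}
    {q : Term Γ τ} {x : LVar α} (hx : (⟨α, x⟩ : AVar B) ∉ q.fv) :
    (⟨α, relevel s α x⟩ : AVar B) ∉ (q.subst κ (relevelSubst s)).fv := fun hmem => by
  have subst_over := (Term.over_compl_of_notMem_fv hx).subst (κ := κ) (ν := relevelSubst s)
    (X' := {⟨α, relevel s α x⟩}ᶜ) (Y' := Set.univ)
    (fun c _ => (hκ c.1 c.2).mono (by
      rintro _ ⟨-, hz⟩ rfl
      exact Nat.succ_ne_zero _ hz) (Set.subset_univ _))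
    fun ⟨σ, z⟩ hz => Term.over_var <| Vr.over_free.2 fun hzx => hz <| by
      obtain ⟨rfl, hzx⟩ := Sigma.mk.inj_iff.1 hzx
      obtain rfl := relevel_injective s σ (eq_of_heq hzx)
      rfl
  exact subst_over.fv_subset hmem rfl

namespace UniformAlgebra

variable (M : UniformAlgebra.{u, v, w} B Ω)

theorem U_extendAssign_of_relevels (hκ : κ.Relevels s) (ψ : M.M.Assign)
    (φ : ∀ (τ : Ty B) (x : LVar τ), M.M.D (s x.level) τ) {τ : Ty B} (c : Con τ) :
    M.U (s c.level) (κ τ c) (extendAssign ψ φ) = M.U (s c.level) (κ τ c) ψ :=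
  U_congr_of_over (hκ τ c) (fun _ hx => hx.1) fun _ hx =>
    extendAssign_of_ne ψ φ (relevel_ne_of_idx_eq_zero hx.2)

theorem app_U_subst_relevel (hs : Monotone s) (hκ : κ.Relevels s) (ψ : M.M.Assign)
    {φ φ' : ∀ (τ : Ty B) (x : LVar τ), M.M.D (s x.level) τ} {α β : Ty B} (hα : α.VarTy) {i : ℕ}
    {q : Term [α] β} (n : ℕ) (hq : q.LevelLE i) (hfv : (⟨α, ⟨i, n, hα⟩⟩ : AVar B) ∉ q.fv)
    (hφ : ∀ x : AVar B, x ≠ ⟨α, ⟨i, n, hα⟩⟩ → φ' x.1 x.2 = φ x.1 x.2) :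
    M.M.app (M.U (s i) ((Term.lam hα q).subst κ (relevelSubst s)) (extendAssign ψ φ))
        (φ' α ⟨i, n, hα⟩) =
      M.U (s i) ((q.inst (Term.var (.free ⟨i, n, hα⟩))).subst κ (relevelSubst s))
        (extendAssign ψ φ') := by
  have app_lam := M.U_lam (i := s i) hα (q.subst κ (relevelSubst s)) (Nat.pair i n + 1)
    (extendAssign ψ φ) (extendAssign ψ φ') (hq.subst_relevel hs hκ)
    (Term.notMem_fv_subst_relevel hκ hfv) fun ⟨σ, y⟩ hy => extendAssign_congr ψ fun z hz =>
      hφ ⟨σ, z⟩ fun hzx => hy <| (congrArg (Sigma.mk σ) hz.symm).trans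
        (congrArg (fun x : AVar B => (⟨x.1, relevel s x.1 x.2⟩ : AVar B)) hzx)
  rw [Term.subst_lam, Term.subst_inst, Term.subst_free]
  exact (congrArg (M.M.app _) (extendAssign_relevel ψ φ' ⟨i, n, hα⟩).symm).trans app_lam

/-- The uniform algebra in which a term of level `j` takes the value in `M` at level `s j` of the
term with the constants replaced according to `κ` and the logic variables renamed by
`relevel s`. -/
noncomputable def pullback (hs : Monotone s) (hκ : κ.Relevels s) (ψ : M.M.Assign) :
    UniformAlgebra.{u, v, w} B Ω where
  M := M.M.pullback hs fun {τ} c => M.U (s c.level) (κ τ c) ψ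
  val := M.val.pullback
  U j q φ := M.U (s j) (q.subst κ (relevelSubst s)) (extendAssign ψ φ)
  U_lift hij _ _ ht := M.U_lift (hs hij) _ _ (ht.subst_relevel hs hκ)
  U_var x φ hx := by
    rw [Term.subst_free]
    exact (M.U_var (relevel s _ x) _ (hs hx)).trans
      (congrArg (M.M.lift (hs hx)) (extendAssign_relevel ψ φ x))
  U_con c φ hc := by
    rw [Term.subst_con, M.U_lift (hs hc) _ _ (hκ.levelLE c)]
    exact congrArg (M.M.lift (hs hc)) (M.U_extendAssign_of_relevels hκ ψ φ c)
  U_lcon k _ := by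
    rw [Term.subst_lcon, UniformStructure.lc_pullback]
    exact M.U_lcon k _
  U_inc e _ _ ht := by
    rw [Term.subst_inc]
    exact M.U_inc e _ _ (ht.subst_relevel hs hκ)
  U_app _ _ _ ht hr := by
    rw [Term.subst_app]
    exact M.U_app _ _ _ (ht.subst_relevel hs hκ) (hr.subst_relevel hs hκ)
  U_lam hα _ n _ _ ht hfv hφ := M.app_U_subst_relevel hs hκ ψ hα n ht hfv hφ

theorem state_pullback (hs : Monotone s) (hκ : κ.Relevels s) (ψ : M.M.Assign) (S : State B)
    (φ : (M.pullback hs hκ ψ).M.Assign) :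
    (M.pullback hs hκ ψ).state S φ =
      M.state ⟨s S.idx, S.prog.map fun D => D.subst κ (relevelSubst s),
        S.goal.subst κ (relevelSubst s)⟩ (extendAssign ψ φ) := by
  refine congrArg (fun p => M.val.I (s S.idx) p _) ?_
  simp only [prog, List.foldl_map]
  exact List.foldl_ext _ _ _ fun p D _ => UniformStructure.bin_pullback _ _ _

end UniformAlgebra

end Pullback

section Generic

variable {B : Type u} {τ : Ty B}

/-- Lowers the level of a constant to at most `i`. -/
def truncate (i : ℕ) (e : Con τ) : Con τ := ⟨min e.level i, e.idx, e.ok⟩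

theorem truncate_of_level_le {i : ℕ} {e : Con τ} (he : e.level ≤ i) : truncate i e = e := by
  rw [truncate, min_eq_left he]

/-- Replaces the constant `c` by the variable of index `0` at level `i`, and lowers the level of
the other constants to at most `i`. -/
noncomputable def genericConSubst (i : ℕ) {α : Ty B} (hα : α.VarTy) (c : Con α) : ConSubst B :=
  updateAt (fun _ e => Term.con (truncate i e)) c (Term.var (.free ⟨i, 0, hα⟩))

variable {i : ℕ} {α : Ty B} (hα : α.VarTy) {c : Con α}

theorem genericConSubst_self : genericConSubst i hα c α c = Term.var (.free ⟨i, 0, hα⟩) :=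
  updateAt_self ..

theorem genericConSubst_of_level_le (hc : c.level = i + 1) {e : Con τ} (he : e.level ≤ i) :
    genericConSubst i hα c τ e = Term.con e := by
  have ne : (⟨τ, e⟩ : ACon B) ≠ ⟨α, c⟩ := by
    rintro ⟨⟩
    omega
  rw [genericConSubst, updateAt_of_ne _ _ ne, truncate_of_level_le he]

theorem genericConSubst_relevels (hc : c.level = i + 1) :
    (genericConSubst i hα c).Relevels (min · i) := by
  intro τ e
  by_cases he : (⟨τ, e⟩ : ACon B) = ⟨α, c⟩
  · cases he
    rw [genericConSubst_self]
    exact Term.over_var (Vr.over_free.2 ⟨le_min (hc ▸ i.le_succ) le_rfl, rfl⟩)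
  · rw [genericConSubst, updateAt_of_ne _ _ he]
    exact Term.over_con (Set.mem_ofPred_eq ▸ le_rfl)

variable {Ω : Type w} [DistribLattice Ω] [OrderTop Ω] (M : UniformAlgebra.{u, v, w} B Ω)

/-- The assignment for a pullback along `min · i` that agrees with `φ` up to level `i`. Its values
at higher levels, which only need to exist, are those of variables of level `i`. -/
def truncateAssign (M : UniformStructure.{u, v} B) (i : ℕ) (φ : M.Assign) (τ : Ty B)
    (x : LVar τ) : M.D (min x.level i) τ :=
  if hx : x.level ≤ i then M.lift (le_min le_rfl hx) (φ τ x) else φ τ ⟨min x.level i, x.idx, x.ok⟩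

theorem lift_truncateAssign (M : UniformStructure.{u, v} B) (φ : M.Assign) {x : LVar τ}
    (hx : x.level ≤ i) :
    M.lift (min_le_right x.level i) (truncateAssign M i φ τ x) = M.lift hx (φ τ x) := by
  rw [truncateAssign, dif_pos hx]
  exact M.lift_trans _ _ _

namespace UniformAlgebra

theorem U_subst_generic (hc : c.level = i + 1) {q : CTerm τ} (hq : q.LevelLE i)
    (ψ φ : M.M.Assign) :
    M.U i (q.subst (genericConSubst i hα c) (relevelSubst (min · i)))
      (extendAssign (s := (min · i)) ψ (truncateAssign M.M i φ)) = M.U i q φ := by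
  rw [hq.subst_congr (fun σ e he => genericConSubst_of_level_le hα hc he) fun _ _ _ => rfl]
  refine M.U_subst hq fun σ x hx => ⟨Term.levelLE_var (min_le_right _ _), ?_⟩
  rw [relevelSubst, M.U_var (relevel _ σ x) _ (min_le_right x.level i), extendAssign_relevel]
  exact lift_truncateAssign M.M φ hx

theorem U_subst_generic_inst (hc : c.level = i + 1) {G : Term [α] τ} (hG : G.LevelLE i)
    (φ : M.M.Assign) (d : M.M.D i α) :
    M.U i ((G.inst (Term.con c)).subst (genericConSubst i hα c) (relevelSubst (min · i)))
      (extendAssign (s := (min · i)) (updateAt φ ⟨i, 0, hα⟩ d) (truncateAssign M.M i φ)) =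
      M.M.app (M.U i (Term.lam hα G) φ) d := by
  have lam_le :
      ((Term.lam hα G).subst (genericConSubst i hα c) (relevelSubst (min · i))).LevelLE i :=
    ((hG.lam hα).subst_relevel (fun _ _ => min_le_min_right i)
      (genericConSubst_relevels hα hc)).mono (min_le_right _ _)
  rw [Term.subst_inst, Term.subst_con, genericConSubst_self, ← Term.beta hα, ← Term.subst_lam,
    M.U_app _ _ _ lam_le (Term.levelLE_var le_rfl), M.U_subst_generic hα hc (hG.lam hα),
    M.U_var ⟨i, 0, hα⟩ _ le_rfl, M.M.lift_refl,
    extendAssign_of_ne _ _ (relevel_ne_of_idx_eq_zero rfl), updateAt_self]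

theorem prog_subst_generic (hc : c.level = i + 1) {P : List (CTerm (B := B) .p)}
    (hP : ∀ D ∈ P, D.LevelLE i) (ψ φ : M.M.Assign) :
    M.prog i (P.map fun D => D.subst (genericConSubst i hα c) (relevelSubst (min · i)))
      (extendAssign (s := (min · i)) ψ (truncateAssign M.M i φ)) = M.prog i P φ := by
  rw [prog, List.foldl_map]
  exact List.foldl_ext _ _ _ fun p D hD =>
    congrArg (M.M.bin .andP p) (M.U_subst_generic hα hc (hP D hD) ψ φ)

theorem state_allG_eq_top {P : List (CTerm (B := B) .p)} {G : Term [α] .g}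
    (hP : ∀ D ∈ P, D.LevelLE i) (hG : G.LevelLE i) (hc : c.level = i + 1)
    (h : ∀ (M : UniformAlgebra.{u, v, w} B Ω) (φ : M.M.Assign),
      M.state ⟨i + 1, P, G.inst (Term.con c)⟩ φ = ⊤) (φ : M.M.Assign) :
    M.state ⟨i, P, Term.allG hα G⟩ φ = ⊤ := by
  have generic_instance (d : M.M.D i α) :
      M.val.I i (M.prog i P φ) (M.M.app (M.U i (Term.lam hα G) φ) d) = ⊤ := by
    have pullback_eq_top := (M.state_pullback (fun _ _ => min_le_min_right i)
      (genericConSubst_relevels hα hc) (updateAt φ ⟨i, 0, hα⟩ d) _ _).symm.trans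
        (h _ (truncateAssign M.M i φ))
    simp only [min_eq_right i.le_succ] at pullback_eq_top
    rw [← M.U_subst_generic_inst hα hc hG, ← M.prog_subst_generic hα hc hP]
    exact pullback_eq_top
  rw [state, Term.allG, M.U_app _ _ φ (Term.levelLE_lcon i _) (hG.lam hα), M.U_lcon]
  refine top_unique ((M.val.all hα _ _).2 ?_)
  rintro _ ⟨d, rfl⟩
  exact (generic_instance d).ge

theorem state_eq_top_of_directStep {T K : Set (ACon B)} {s : State B} {ss : List (State B)}
    (hstep : DirectStep T s ss K)
    (h : ∀ s' ∈ ss, ∀ (M : UniformAlgebra.{u, v, w} B Ω) (φ : M.M.Assign), M.state s' φ = ⊤)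
    (φ : M.M.Assign) : M.state s φ = ⊤ := by
  by_cases hK : K = ∅
  · subst hK
    exact top_unique (M.le_state_of_directStep φ hstep fun s' hs' => (h s' hs' M φ).ge)
  · cases hstep with
    | generic i P hα hP hG hc => exact M.state_allG_eq_top hα hP hG hc (h _ (.head _)) φ
    | _ => exact absurd rfl hK

theorem vector_apply_eq_top_of_derives {S : Set Rule} {A A' : StateVector B} {θ : Subst B}
    (hA : A.Valid) (hr : Derives S A θ A')
    (h : ∀ (M : UniformAlgebra.{u, v, w} B Ω) (φ : M.M.Assign), M.vector A' φ = ⊤)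
    (φ : M.M.Assign) : M.vector (A.apply θ) φ = ⊤ :=
  (M.vector_eq_top_iff φ).2 fun s hs => Derives.backward
    (Q := fun s => ∀ (M : UniformAlgebra.{u, v, w} B Ω) (φ : M.M.Assign), M.state s φ = ⊤)
    (fun _ _ _ hstep _ h M φ => M.state_eq_top_of_directStep hstep h φ) hA hr
    (fun s hs M φ => (M.vector_eq_top_iff φ).1 (h M φ) s hs) s hs M φ

theorem vector_le_vector_apply_of_derives {S : Set Rule} {A A' : StateVector B} {θ : Subst B}
    (hA : A.Valid) (hr : Derives S A θ A') (hS : Rule.generic ∉ S) (φ : M.M.Assign) :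
    M.vector A' φ ≤ M.vector (A.apply θ) φ :=
  (M.le_vector_iff φ).2 <| Derives.backward
    (fun _ _ _ hstep hK h => by
      obtain rfl := hK.resolve_left hS
      exact M.le_state_of_directStep φ hstep h)
    hA hr ((M.le_vector_iff φ).1 le_rfl)

end UniformAlgebra

end Generic

end UCTT

theorem mainTheorem10 {B : Type u} :
    -- Soundness: truth in all uniform algebras is preserved backwards along enriched resolutions.
    (∀ (A A' : StateVector B) (θ : Subst B), A.Valid → Derives enriched A θ A' →
      ∀ (Ω : Type w) [DistribLattice Ω] [OrderTop Ω],
        (∀ (M : UniformAlgebra.{u, v, w} B Ω) (φ : M.M.Assign), M.vector A' φ = ⊤) →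
        ∀ (M : UniformAlgebra.{u, v, w} B Ω) (φ : M.M.Assign), M.vector (A.apply θ) φ = ⊤) ∧
    -- Soundness of successful enriched resolutions.
    (∀ (A : StateVector B) (θ : Subst B), A.Valid → Derives enriched A θ [] →
      ∀ (Ω : Type w) [DistribLattice Ω] [OrderTop Ω] (M : UniformAlgebra.{u, v, w} B Ω)
        (φ : M.M.Assign), M.vector (A.apply θ) φ = ⊤) ∧
    -- Soundness, locally in each uniform algebra, of enriched resolutions without generic steps.
    (∀ (A A' : StateVector B) (θ : Subst B), A.Valid →
      Derives {ρ | ρ ≠ Rule.generic} A θ A' →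
      ∀ (Ω : Type w) [DistribLattice Ω] [OrderTop Ω] (M : UniformAlgebra.{u, v, w} B Ω)
        (φ : M.M.Assign), M.vector A' φ ≤ M.vector (A.apply θ) φ) ∧
    -- Conservativity over ordinary resolution.
    (∀ A : StateVector B, A.Valid → Derives enriched A Subst.id [] →
      Derives ordinary A Subst.id []) ∧
    -- Lifting.
    (∀ (A A' : StateVector B) (θ φ : Subst B) (N : Set (ACon B)), A.Valid → θ.Legal →
      DerivesWith enriched (A.apply θ) φ A' N →
      A' = [] ∨ Disjoint N (A.oc ∪ (θ.restrict A.fv).oc) →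
      Derives enriched A ((θ.comp φ).restrict A.fv) A') := by
  refine ⟨fun A A' θ hA h Ω _ _ hA' M => M.vector_apply_eq_top_of_derives hA h hA',
    fun A θ hA h Ω _ _ M => M.vector_apply_eq_top_of_derives hA h fun _ _ => rfl,
    fun A A' θ hA h Ω _ _ M => M.vector_le_vector_apply_of_derives hA h fun hS => hS rfl,
    fun A hA h => derives_ordinary_of_enriched hA h, fun A A' θ φ N hA hθ h hN => ?_⟩
  by_cases hA' : A' = []
  · subst hA'
    exact derives_null_of_apply hA hθ ⟨N, h⟩
  · exact derives_of_apply hA hθ h hA' (hN.resolve_left hA')
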